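/- **Setting.** Let $\|M\|_\infty=\max_{i,j}|M_{ij}|$ and let $\|M\|_F$ be the Frobenius norm. For $A\in\mathbb R^{n\times d}$, $B\in\mathbb R^{n\times d'}$ put $\nu(A,B)=\sqrt{\|A^TA\|_\infty\|B^TB\|_\infty}$. Let $S$ be a random $t\times n$ matrix ($t\ge 1$), let $s_1,\dots,s_t\in\mathbb R^n$ be the rows of $\sqrt t\,S$, and put $D_i=A^Ts_is_i^TB$. Let $\xi_1,\dots,\xi_t$ be i.i.d. $N(0,1)$ variables, independent of $S$, and $$Z_t^\star=\sqrt t\,\Big\|\frac1t\sum_{i=1}^t\xi_i\,(D_i-A^TS^TSB)\Big\|_\infty .$$ For $\mathbf j=(j_1,j_2,s)\in[d]\times[d']\times\{-1,1\}$ and $W\in\mathbb R^{d\times d'}$ put $f_{\mathbf j}(W)=s\,W_{j_1j_2}$. Let $Z=\max_{\mathbf j}\mathbb G(f_{\mathbf j})$, where $\mathbb G$ is a centred Gaussian process with covariance $\mathrm{cov}(f_{\mathbf j}(D_1),f_{\mathbf k}(D_1))$. If $S$ is built from a random sign matrix $D_n^\circ$ (case (c)), let $\tilde Z=\max_{\mathbf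 j}\tilde{\mathbb G}(f_{\mathbf j})$, where, conditionally on $D_n^\circ$, $\tilde{\mathbb G}$ is a centred Gaussian process with covariance $\mathrm{cov}(f_{\mathbf j}(D_1),f_{\mathbf k}(D_1)\mid D_n^\circ)$. Let $d_{\mathrm{LP}}$ be the Lévy–Prohorov metric between laws on $\mathbb R$, and let $\mathcal L(\cdot)$, $\mathcal L(\cdot\mid\cdot)$ denote laws and conditional laws. The $\psi_2$-Orlicz norm of $X$ is $\|X\|_{\psi_2}=\inf\{r>0:\mathbb E[\exp(X^2/r^2)-1]\le 1\}$. **Proposition (bootstrap approximation).** For all constants $C>0$ and $\kappa\ge1$ there is a constant $c>0$, depending only on $C$ and $\kappa$, such that the following holds whenever $d\ge 2$, $d\le Cd'$, $d'\le Cd$, and $d^{1/\kappa}\le Ct$, $t\le Cd^{\kappa}$. (a) (Sub-Gaussian case.) Suppose that the entries of $S$ are i.i.d. with $\mathbb E[S_{ij}]=0$, $\mathbb E[S_{ij}^2]=1/t$ and $\|\sqrt t\,S_{ij}\|_{\psi_2}\le C$, and that $\nu(A,B)^{2/3}(\log d)^5\le Ct$. Then, with probability at least $1-\frac1t-\frac1{dd'}$,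 $$d_{\mathrm{LP}}\big(\mathcal L(Z),\mathcal L(Z_t^\star\mid S)\big)\le\frac{c\,\nu(A,B)^{1/2}\sqrt{\log d}}{t^{1/8}} .$$ (b) (Length sampling.) Write $a_l$, $b_l$ for the $l$-th rows of $A$, $B$. Suppose that $\sum_j\|a_j\|_2\|b_j\|_2>0$, put $p_l=\|a_l\|_2\|b_l\|_2/\sum_j\|a_j\|_2\|b_j\|_2$, and suppose that the rows of $S$ are i.i.d., equal to $\frac1{\sqrt{tp_l}}e_l$ with probability $p_l$, and that $(\|A\|_F\|B\|_F)^{2/3}(\log d)^5\le Ct$. Then, with probability at least $1-\frac1t-\frac1{dd'}$, $$d_{\mathrm{LP}}\big(\mathcal L(Z),\mathcal L(Z_t^\star\mid S)\big)\le\frac{c\,(\|A\|_F\|B\|_F)^{1/2}\sqrt{\log d}}{t^{1/8}} .$$ (c) (SRHT.) Suppose that $n$ is a power of $2$ and $S=P\,(\frac1{\sqrt n}H_n)\,D_n^\circ$, where $H_n$ is the Walsh–Hadamard matrix, $D_n^\circ$ is diagonal with independent Rademacher signs, and $P$ is independent of $D_n^\circ$ with rows drawn independently and uniformly from $\{\frac1{\sqrt{t/n}}e_1,\dots,\frac1{\sqrt{t/n}}e_n\}$.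 Suppose also that $\nu(A,B)^{2/3}(\log n)^2(\log d)^5\le Ct$. Then, with probability at least $1-\frac1t-\frac1{dd'}-\frac cn$, $$d_{\mathrm{LP}}\big(\mathcal L(\tilde Z\mid D_n^\circ),\mathcal L(Z_t^\star\mid S)\big)\le\frac{c\,\nu(A,B)^{1/2}(\log n)^{1/2}\sqrt{\log d}}{t^{1/8}} .$$ -/

import Mathlib

open MeasureTheory ProbabilityTheory Matrix
open scoped ENNReal

noncomputable section

namespace SketchBootstrap

/-! ### Matrix quantities -/

/-- The entrywise maximum norm `max_{i,j} |M i j|` (equal to `0` for an empty matrix). -/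
def entryMax {m n : Type*} (M : Matrix m n ℝ) : ℝ :=
  ⨆ p : m × n, |M p.1 p.2|

/-- The scale parameter `ν(A, B) = √(‖AᵀA‖_∞ ‖BᵀB‖_∞)`, with the entrywise maximum norm. -/
def nu {n d d' : ℕ} (A : Matrix (Fin n) (Fin d) ℝ) (B : Matrix (Fin n) (Fin d') ℝ) : ℝ :=
  √(entryMax (Aᵀ * A) * entryMax (Bᵀ * B))

/-- The Frobenius norm. -/
def frob {n d : ℕ} (A : Matrix (Fin n) (Fin d) ℝ) : ℝ :=
  √(∑ i, ∑ j, A i j ^ 2)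

/-- The Euclidean norm of a vector. -/
def euclNorm {d : ℕ} (v : Fin d → ℝ) : ℝ :=
  √(∑ j, v j ^ 2)

/-- The length-sampling probabilities `p_l = ‖A_l‖ ‖B_l‖ / ∑_i ‖A_i‖ ‖B_i‖`, where `A_l` and `B_l`
are the `l`-th rows. -/
def lengthProb {n d d' : ℕ} (A : Matrix (Fin n) (Fin d) ℝ) (B : Matrix (Fin n) (Fin d') ℝ)
    (l : Fin n) : ℝ :=
  euclNorm (A l) * euclNorm (B l) / ∑ i, euclNorm (A i) * euclNorm (B i)

/-- The Walsh-Hadamard matrix of size `2 ^ m`: a block of size `2 ^ (m + 1)` is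
`[[H, H], [H, -H]]`, and the `1 × 1` matrix is `[1]` (so that the `2 × 2` matrix is
`[[1, 1], [1, -1]]`). -/
def walshHadamard : (m : ℕ) → Matrix (Fin (2 ^ m)) (Fin (2 ^ m)) ℝ
  | 0 => Matrix.of fun _ _ => 1
  | m + 1 =>
    let H := walshHadamard m
    let e : Fin (2 ^ m) ⊕ Fin (2 ^ m) ≃ Fin (2 ^ (m + 1)) :=
      finSumFinEquiv.trans (finCongr (by rw [pow_succ, mul_two]))
    Matrix.reindex e e (Matrix.fromBlocks H H H (-H))

/-- Real matrices carry the product (equivalently, Borel) σ-algebra of their entries. -/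
instance instMeasurableSpaceMatrix {m n : Type*} : MeasurableSpace (Matrix m n ℝ) :=
  inferInstanceAs (MeasurableSpace (m → n → ℝ))

/-! ### The sketched dyads and the bootstrap statistic -/

/-- The rescaled row `s_i`, the `i`-th row of `√t S`. -/
def scaledRow {t n : ℕ} (S : Matrix (Fin t) (Fin n) ℝ) (i : Fin t) : Fin n → ℝ :=
  fun l => √(t : ℝ) * S i l

/-- The dyad `D_i = Aᵀ s_i s_iᵀ B`. -/
def dyad {t n d d' : ℕ} (A : Matrix (Fin n) (Fin d) ℝ) (B : Matrix (Fin n) (Fin d') ℝ)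
    (S : Matrix (Fin t) (Fin n) ℝ) (i : Fin t) : Matrix (Fin d) (Fin d') ℝ :=
  Aᵀ * vecMulVec (scaledRow S i) (scaledRow S i) * B

/-- The rescaled bootstrap error
`Z_t^⋆ = √t ‖(1/t) ∑_i ξ_i (D_i - Aᵀ Sᵀ S B)‖_∞`. -/
def bootStat {t n d d' : ℕ} (A : Matrix (Fin n) (Fin d) ℝ) (B : Matrix (Fin n) (Fin d') ℝ)
    (S : Matrix (Fin t) (Fin n) ℝ) (ξ : Fin t → ℝ) : ℝ :=
  √(t : ℝ) * entryMax ((1 / (t : ℝ)) • ∑ i, ξ i • (dyad A B S i - Aᵀ * Sᵀ * S * B))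

/-- The triples `j = (j₁, j₂, s)` with a sign `s ∈ {1, -1}`. -/
abbrev Triple (d d' : ℕ) : Type := Fin d × Fin d' × ℤˣ

/-- The linear function `f_j`: it picks out the `(j₁, j₂)` entry and multiplies it by `s`. -/
def signedEntry {d d' : ℕ} (j : Triple d d') (W : Matrix (Fin d) (Fin d') ℝ) : ℝ :=
  ((j.2.2 : ℤ) : ℝ) * W j.1 j.2.1

section Random

variable {Ω : Type*} [MeasurableSpace Ω]

/-- The covariance matrix `(cov(f_j(D_1), f_k(D_1)))_{j,k}` under the probability measure `P`. -/
def dyadCov {t n d d' : ℕ} [NeZero t] (P : Measure Ω)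
    (A : Matrix (Fin n) (Fin d) ℝ) (B : Matrix (Fin n) (Fin d') ℝ)
    (S : Ω → Matrix (Fin t) (Fin n) ℝ) : Matrix (Triple d d') (Triple d d') ℝ :=
  Matrix.of fun j k =>
    covariance (fun ω => signedEntry j (dyad A B (S ω) 0))
      (fun ω => signedEntry k (dyad A B (S ω) 0)) P

/-- The law of `max_j G(f_j)` for the centred Gaussian process `G` with covariance matrix `K`. -/
def gaussianMaxLaw {ι : Type*} [Fintype ι] [DecidableEq ι] (K : Matrix ι ι ℝ) : Measure ℝ :=
  (multivariateGaussian 0 K).map fun x => ⨆ j, x j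

/-- The law `ℒ(Z)` of the Gaussian maximum. -/
def lawZ {t n d d' : ℕ} [NeZero t] (P : Measure Ω)
    (A : Matrix (Fin n) (Fin d) ℝ) (B : Matrix (Fin n) (Fin d') ℝ)
    (S : Ω → Matrix (Fin t) (Fin n) ℝ) : Measure ℝ :=
  gaussianMaxLaw (dyadCov P A B S)

/-- The conditional law `ℒ(Z̃ | D)` of the Gaussian maximum at the outcome `ω`, for a random matrix
`D` with finitely many values: the covariance matrix is the conditional one given `D = D ω`. -/
def condLawZ {t n d d' : ℕ} [NeZero t] (P : Measure Ω)
    (A : Matrix (Fin n) (Fin d) ℝ) (B : Matrix (Fin n) (Fin d') ℝ)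
    (S : Ω → Matrix (Fin t) (Fin n) ℝ) (D : Ω → Matrix (Fin n) (Fin n) ℝ) (ω : Ω) : Measure ℝ :=
  gaussianMaxLaw (dyadCov (cond P (D ⁻¹' {D ω})) A B S)

/-- The conditional law `ℒ(Z_t^⋆ | S)` at the outcome `ω` (a regular conditional distribution). -/
def condLawBoot {t n d d' : ℕ} (P : Measure Ω) [IsFiniteMeasure P]
    (A : Matrix (Fin n) (Fin d) ℝ) (B : Matrix (Fin n) (Fin d') ℝ)
    (S : Ω → Matrix (Fin t) (Fin n) ℝ) (ξ : Ω → Fin t → ℝ) (ω : Ω) : Measure ℝ :=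
  condDistrib (fun ω' => bootStat A B (S ω') (ξ ω')) S P (S ω)

/-- The `ψ`-Orlicz norm `inf {r > 0 | E[ψ(|X| / r)] ≤ 1}`, equal to `∞` if there is no such `r`. -/
def orliczNorm (ψ : ℝ → ℝ) (X : Ω → ℝ) (P : Measure Ω) : ℝ≥0∞ :=
  ⨅ (r : ℝ) (_ : 0 < r) (_ : ∫⁻ ω, ENNReal.ofReal (ψ (|X ω| / r)) ∂P ≤ 1), ENNReal.ofReal r

/-- `ψ₂(x) = exp(x²) - 1`. -/
def psiTwo (x : ℝ) : ℝ := Real.exp (x ^ 2) - 1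

/-! ### The multipliers and the three kinds of sketching matrices -/

/-- `ξ_1, …, ξ_t` are i.i.d. standard Gaussian and independent of `S`. -/
structure IsGaussianMultiplier {t n : ℕ} (P : Measure Ω) (S : Ω → Matrix (Fin t) (Fin n) ℝ)
    (ξ : Ω → Fin t → ℝ) : Prop where
  measurable : Measurable ξ
  iIndep : iIndepFun (fun i ω => ξ ω i) P
  law : ∀ i, P.map (fun ω => ξ ω i) = gaussianReal 0 1
  indep : IndepFun ξ S P

/-- The entries of `S` are i.i.d. with mean zero and variance `1 / t`, and
`max_{i,j} ‖√t S_{i,j}‖_{ψ₂} ≤ C`. -/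
structure IsSubGaussianSketch {t n : ℕ} (P : Measure Ω) (C : ℝ)
    (S : Ω → Matrix (Fin t) (Fin n) ℝ) : Prop where
  measurable : Measurable S
  iIndep : iIndepFun (fun (p : Fin t × Fin n) ω => S ω p.1 p.2) P
  identDistrib : ∀ p q : Fin t × Fin n,
    IdentDistrib (fun ω => S ω p.1 p.2) (fun ω => S ω q.1 q.2) P P
  mean : ∀ i l, ∫ ω, S ω i l ∂P = 0
  second_moment : ∀ i l, ∫ ω, S ω i l ^ 2 ∂P = 1 / (t : ℝ)
  orlicz : ∀ i l, orliczNorm psiTwo (fun ω => √(t : ℝ) * S ω i l) P ≤ ENNReal.ofReal C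

/-- The rows of `S` are i.i.d., and each of them equals `e_l / √(t p_l)` with probability `p_l`,
where `p_l` are the length-sampling probabilities. -/
structure IsLengthSampling {t n d d' : ℕ} (P : Measure Ω)
    (A : Matrix (Fin n) (Fin d) ℝ) (B : Matrix (Fin n) (Fin d') ℝ)
    (S : Ω → Matrix (Fin t) (Fin n) ℝ) : Prop where
  measurable : Measurable S
  sum_pos : 0 < ∑ l, euclNorm (A l) * euclNorm (B l)
  iIndep : iIndepFun (fun i ω => S ω i) P
  law : ∀ i, P.map (fun ω => S ω i) =
    ∑ l, ENNReal.ofReal (lengthProb A B l) •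
      Measure.dirac (Pi.single l (1 / √((t : ℝ) * lengthProb A B l)) : Fin n → ℝ)

/-- The data of an SRHT matrix `S = Q (H_n / √n) D` with `n = 2 ^ m`: the matrix `D` is diagonal
with independent Rademacher signs `ε` on its diagonal, and, independently of `D`, the rows of `Q`
are drawn independently and uniformly from `{e_l / √(t / n)}`. -/
structure IsSRHT {t m : ℕ} (P : Measure Ω) (D : Ω → Matrix (Fin (2 ^ m)) (Fin (2 ^ m)) ℝ)
    (ε : Ω → Fin (2 ^ m) → ℝ) (Q S : Ω → Matrix (Fin t) (Fin (2 ^ m)) ℝ) : Prop where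
  measurable_sign : Measurable ε
  measurable_sample : Measurable Q
  iIndep_sign : iIndepFun (fun l ω => ε ω l) P
  law_sign : ∀ l, P.map (fun ω => ε ω l) =
    (1 / 2 : ℝ≥0∞) • Measure.dirac (1 : ℝ) + (1 / 2 : ℝ≥0∞) • Measure.dirac (-1 : ℝ)
  iIndep_sample : iIndepFun (fun i ω => Q ω i) P
  law_sample : ∀ i, P.map (fun ω => Q ω i) =
    ∑ l, ENNReal.ofReal (1 / (2 : ℝ) ^ m) •
      Measure.dirac (Pi.single l (1 / √((t : ℝ) / (2 : ℝ) ^ m)) : Fin (2 ^ m) → ℝ)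
  indep : IndepFun ε Q P
  diag_eq : ∀ ω, D ω = Matrix.diagonal (ε ω)
  sketch_eq : ∀ ω, S ω = Q ω * ((1 / √((2 : ℝ) ^ m)) • walshHadamard m) * D ω

end Random

/-- `d ≍ d'` and `d^(1/κ) ≲ t ≲ d^κ`, where all implied constants are `C`. -/
structure GrowthCondition (C κ : ℝ) (d d' t : ℕ) : Prop where
  d_le : (d : ℝ) ≤ C * d'
  d'_le : (d' : ℝ) ≤ C * d
  le_t : (d : ℝ) ^ (1 / κ) ≤ C * t
  t_le : (t : ℝ) ≤ C * (d : ℝ) ^ κ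

end SketchBootstrap

end

/-! Conditionally on `S`, the bootstrap statistic is the maximum of a centred Gaussian vector
indexed by the triples: it is linear in the multipliers, the sign in a triple turns the absolute
value into a maximum of linear forms, and the centring `AᵀSᵀSB` is the empirical mean of the dyads.
Its covariance is therefore the empirical covariance `empCov`. Both laws in the theorem are thus
laws of Gaussian maxima, and everything reduces to comparing two covariance matrices.

If the entries of the matrices differ by at most `Δ` and there are `N` coordinates, replace the
maximum by the log-sum-exp function and an indicator by a smooth function at scale `δ`. The sum of
the absolute second derivatives is then of order `log N / δ²`, whatever the dimension, because the
Gibbs weights sum to one. Gaussian interpolation yields a Lévy–Prohorov distance of at most `max (11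
* δ) (2 * Δ * L / δ ^ 2)` for any `L ≥ max 1 (log N)` (`levyProkhorovDist_gaussianMaxLaw_le`).

The bound `Δ ≲ ν² log d / √t` comes from truncation at level `t^{1/4}` and Bernstein's inequality
(`exists_measure_empCov_sub_dyadCov_le`). It needs only a moment of fixed order, depending on `κ`,
because `d` is at most polynomial in `t`. With `L ≍ log d`, the product `Δ L` is of order `b⁴`,
where `b` is the target rate, so `δ = b` suffices when `b ≤ 1`; otherwise the claim is trivial. This
gives `exists_measure_levyProkhorovDist_empCov_le`, whose only input is a moment bound for one dyad
at scale `ν`.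

In the sub-Gaussian case the moment bound holds because a dyad entry is a product of two
sub-Gaussian linear forms. Under length sampling the sampling probability cancels the row norms, and
dyads are bounded by the product of Frobenius norms.

For the SRHT one conditions on the signs. If `t ≤ n^32`, Hoeffding's inequality and a union bound
over the `n (d + d')` linear forms show that, up to probability `c / n`, the signs make all dyads
bounded by a multiple of `ν log n`. If `t ≥ n^32`, the dimension `d` need not be polynomial in `n`
and that union bound is unavailable. Instead all `n` sampling frequencies are nearly uniform. Both
covariances are sums over the same `n²` rank-one matrices, with nearly proportional weights, so one
Gaussian law is dominated by a multiple close to one of the other, with no dependence on `d`. This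
relative bound falls below the rate unless `ν` is tiny, and then both maxima are themselves
negligible. -/

namespace SketchBootstrap

/-! ### Gaussian interpolation between two covariance matrices. -/

section GaussianInterpolation

variable {ι : Type*} [Fintype ι] [DecidableEq ι]

lemma multivariateGaussian_conv {K₁ K₂ : Matrix ι ι ℝ} (h₁ : K₁.PosSemidef) (h₂ : K₂.PosSemidef) :
    (multivariateGaussian (0 : EuclideanSpace ℝ ι) K₁).conv (multivariateGaussian 0 K₂) =
      multivariateGaussian 0 (K₁ + K₂) := by
  apply Measure.ext_of_charFun
  ext x
  rw [charFun_conv, charFun_multivariateGaussian h₁, charFun_multivariateGaussian h₂,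
    charFun_multivariateGaussian (h₁.add h₂), ← Complex.exp_add]
  congr 1
  simp [add_mulVec, dotProduct_add]
  ring

lemma multivariateGaussian_map_smul {K : Matrix ι ι ℝ} (h : K.PosSemidef) (c : ℝ) :
    (multivariateGaussian (0 : EuclideanSpace ℝ ι) K).map (fun x => c • x) =
      multivariateGaussian 0 (c ^ 2 • K) := by
  apply Measure.ext_of_charFun
  ext x
  rw [charFun_map_smul, charFun_multivariateGaussian h,
    charFun_multivariateGaussian (h.smul (sq_nonneg c))]
  congr 1
  simp [mulVec_smul, smul_mulVec, dotProduct_smul]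
  ring

lemma integrable_norm_pow_multivariateGaussian (K : Matrix ι ι ℝ) (p : ℕ) :
    Integrable (fun x => ‖x‖ ^ p) (multivariateGaussian (0 : EuclideanSpace ℝ ι) K) := by
  have h := IsGaussian.memLp_id (multivariateGaussian (0 : EuclideanSpace ℝ ι) K) p (by simp)
  exact h.integrable_norm_pow'

lemma integral_eval_multivariateGaussian (K : Matrix ι ι ℝ) (j : ι) :
    ∫ x, x j ∂(multivariateGaussian (0 : EuclideanSpace ℝ ι) K) = 0 := by
  have h := (EuclideanSpace.proj (𝕜 := ℝ) j : EuclideanSpace ℝ ι →L[ℝ] ℝ).integral_comp_id_comm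
    (μ := multivariateGaussian (0 : EuclideanSpace ℝ ι) K) IsGaussian.integrable_id
  simpa using h

lemma memLp_eval_multivariateGaussian (K : Matrix ι ι ℝ) (j : ι) :
    MemLp (fun x : EuclideanSpace ℝ ι => x j) 2 (multivariateGaussian 0 K) := by
  refine (IsGaussian.memLp_two_id (μ := multivariateGaussian (0 : EuclideanSpace ℝ ι) K)).mono
    (by fun_prop) (.of_forall fun x => ?_)
  exact PiLp.norm_apply_le x j

lemma integral_eval_mul_eval_multivariateGaussian {K : Matrix ι ι ℝ} (h : K.PosSemidef) (j k : ι) :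
    ∫ x, x j * x k ∂(multivariateGaussian (0 : EuclideanSpace ℝ ι) K) = K j k := by
  rw [← covariance_eval_multivariateGaussian (μ := 0) h, covariance_eq_sub
    (memLp_eval_multivariateGaussian K j) (memLp_eval_multivariateGaussian K k)]
  simp [integral_eval_multivariateGaussian]

/-- The expectations of `φ (w + x)` under two centred Gaussian laws differ by the second-order
Taylor term up to third moments. -/
lemma abs_integral_gaussian_sub_le_of_taylor {K₁ K₂ : Matrix ι ι ℝ} (h₁ : K₁.PosSemidef)
    (h₂ : K₂.PosSemidef) {φ : EuclideanSpace ℝ ι → ℝ} (hφ : Continuous φ) {b : ℝ}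
    (hb : ∀ x, |φ x| ≤ b) {C M Δ : ℝ} (hΔ : ∀ j k, |K₁ j k - K₂ j k| ≤ Δ) (w : EuclideanSpace ℝ ι)
    (l : ι → ℝ) (q : ι → ι → ℝ)
    (htaylor : ∀ x, |φ (w + x) - φ w - ∑ j, l j * x j - (∑ j, ∑ k, q j k * (x j * x k)) / 2| ≤
      C * ‖x‖ ^ 3) (hq : ∑ j, ∑ k, |q j k| ≤ M) (hΔ0 : 0 ≤ Δ) :
    |∫ x, φ (w + x) ∂(multivariateGaussian 0 K₁) - ∫ x, φ (w + x) ∂(multivariateGaussian 0 K₂)| ≤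
      M * Δ / 2 + C * (∫ x, ‖x‖ ^ 3 ∂(multivariateGaussian (0 : EuclideanSpace ℝ ι) K₁) +
        ∫ x, ‖x‖ ^ 3 ∂(multivariateGaussian (0 : EuclideanSpace ℝ ι) K₂)) := by
  -- Integrating the expansion against one law kills the linear term and turns the quadratic term
  -- into the pairing of `q` with `K`; only this pairing distinguishes the two laws.
  have key : ∀ K : Matrix ι ι ℝ, K.PosSemidef →
      |∫ x, φ (w + x) ∂(multivariateGaussian 0 K) - φ w - (∑ j, ∑ k, q j k * K j k) / 2| ≤
        C * ∫ x, ‖x‖ ^ 3 ∂(multivariateGaussian (0 : EuclideanSpace ℝ ι) K) := by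
    intro K hK
    have i1 : Integrable (fun x => φ (w + x)) (multivariateGaussian 0 K) :=
      Integrable.of_bound (by fun_prop) b (.of_forall fun x => hb _)
    have i2 : ∀ j, Integrable (fun x : EuclideanSpace ℝ ι => l j * x j)
        (multivariateGaussian 0 K) := fun j =>
      ((memLp_eval_multivariateGaussian K j).integrable one_le_two).const_mul _
    have i3 : ∀ j k, Integrable (fun x : EuclideanSpace ℝ ι => q j k * (x j * x k))
        (multivariateGaussian 0 K) := fun j k =>
      ((memLp_eval_multivariateGaussian K j).integrable_mul
        (memLp_eval_multivariateGaussian K k)).const_mul _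
    have i4 : Integrable (fun x : EuclideanSpace ℝ ι => (∑ j, ∑ k, q j k * (x j * x k)) / 2)
        (multivariateGaussian 0 K) :=
      (integrable_finsetSum _ fun j _ => integrable_finsetSum _ fun k _ => i3 j k).div_const _
    have i5 : Integrable (fun x : EuclideanSpace ℝ ι => ∑ j, l j * x j)
        (multivariateGaussian 0 K) := integrable_finsetSum _ fun j _ => i2 j
    have e : ∫ x, φ (w + x) ∂(multivariateGaussian 0 K) - φ w - (∑ j, ∑ k, q j k * K j k) / 2 =
        ∫ x, (φ (w + x) - φ w - ∑ j, l j * x j - (∑ j, ∑ k, q j k * (x j * x k)) / 2)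
          ∂(multivariateGaussian 0 K) := by
      have i6 : Integrable (fun x => φ (w + x) - φ w) (multivariateGaussian 0 K) :=
        i1.sub (integrable_const _)
      have i7 : Integrable (fun x => φ (w + x) - φ w - ∑ j, l j * x j)
        (multivariateGaussian 0 K) := i6.sub i5
      rw [integral_sub i7 i4, integral_sub i6 i5, integral_sub i1 (integrable_const _),
        integral_finsetSum _ fun j _ => i2 j, integral_div, integral_finsetSum _ fun j _ =>
          integrable_finsetSum _ fun k _ => i3 j k]
      simp_rw [integral_finsetSum _ fun k _ => i3 _ k, integral_const_mul,
        integral_eval_multivariateGaussian, integral_eval_mul_eval_multivariateGaussian hK]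
      simp
    rw [e, ← integral_const_mul]
    refine (abs_integral_le_integral_abs).trans (integral_mono_of_nonneg
      (.of_forall fun x => abs_nonneg _)
      ((integrable_norm_pow_multivariateGaussian K 3).const_mul C) (.of_forall fun x => htaylor x))
  have hQ : |∑ j, ∑ k, q j k * K₁ j k - ∑ j, ∑ k, q j k * K₂ j k| ≤ M * Δ := by
    simp_rw [← Finset.sum_sub_distrib, ← mul_sub]
    calc _ ≤ ∑ j, ∑ k, |q j k * (K₁ j k - K₂ j k)| :=
          (Finset.abs_sum_le_sum_abs _ _).trans
            (Finset.sum_le_sum fun j _ => Finset.abs_sum_le_sum_abs _ _)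
      _ ≤ ∑ j, ∑ k, |q j k| * Δ := by
          gcongr with j _ k _
          rw [abs_mul]
          exact mul_le_mul_of_nonneg_left (hΔ j k) (abs_nonneg _)
      _ = (∑ j, ∑ k, |q j k|) * Δ := by simp_rw [Finset.sum_mul]
      _ ≤ M * Δ := by gcongr
  have a := abs_le.1 (key K₁ h₁)
  have b := abs_le.1 (key K₂ h₂)
  have c := abs_le.1 hQ
  rw [abs_le]
  constructor <;> linarith [a.1, a.2, b.1, b.2, c.1, c.2]

lemma integral_norm_cube_smul {K : Matrix ι ι ℝ} (h : K.PosSemidef) {c : ℝ} (hc : 0 ≤ c) :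
    ∫ x, ‖x‖ ^ 3 ∂(multivariateGaussian (0 : EuclideanSpace ℝ ι) (c ^ 2 • K)) =
      c ^ 3 * ∫ x, ‖x‖ ^ 3 ∂(multivariateGaussian (0 : EuclideanSpace ℝ ι) K) := by
  rw [← multivariateGaussian_map_smul h, integral_map (by fun_prop) (by fun_prop),
    ← integral_const_mul]
  simp [norm_smul, mul_pow, abs_of_nonneg hc]

/-- Gaussian interpolation: a smooth function with `∑ |∂ⱼₖ φ| ≤ M` has close expectations under two
centred Gaussian laws with entrywise close covariance matrices. -/
lemma abs_integral_gaussian_sub_le {K₁ K₂ : Matrix ι ι ℝ} (h₁ : K₁.PosSemidef)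
    (h₂ : K₂.PosSemidef) {φ : EuclideanSpace ℝ ι → ℝ} (hφ : Continuous φ) {b : ℝ}
    (hb : ∀ x, |φ x| ≤ b) {C M Δ : ℝ} (hΔ : ∀ j k, |K₁ j k - K₂ j k| ≤ Δ)
    (l : EuclideanSpace ℝ ι → ι → ℝ) (q : EuclideanSpace ℝ ι → ι → ι → ℝ)
    (htaylor : ∀ w x, |φ (w + x) - φ w - ∑ j, l w j * x j
      - (∑ j, ∑ k, q w j k * (x j * x k)) / 2| ≤ C * ‖x‖ ^ 3)
    (hq : ∀ w, ∑ j, ∑ k, |q w j k| ≤ M) (hΔ0 : 0 ≤ Δ) :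
    |∫ x, φ x ∂(multivariateGaussian 0 K₁) - ∫ x, φ x ∂(multivariateGaussian 0 K₂)| ≤
      M * Δ / 2 := by
  set T := ∫ x, ‖x‖ ^ 3 ∂(multivariateGaussian (0 : EuclideanSpace ℝ ι) K₁) +
        ∫ x, ‖x‖ ^ 3 ∂(multivariateGaussian (0 : EuclideanSpace ℝ ι) K₂) with hT
  -- A discrete interpolation with `m` steps replaces differentiation along the path. Each step
  -- costs `MΔ / (2m)` plus a third moment of order `m^{-3/2}`, so the remainders add up to order
  -- `m^{-1/2}` and vanish in the limit. Hence `C` is absent from the conclusion.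
  have step : ∀ m : ℕ, 0 < m →
      |∫ x, φ x ∂(multivariateGaussian 0 K₁) - ∫ x, φ x ∂(multivariateGaussian 0 K₂)| ≤
        M * Δ / 2 + C * T * (1 / √(m : ℝ)) := by
    intro m hm
    have hm' : (0 : ℝ) < m := by exact_mod_cast hm
    have hs : (1 / √(m : ℝ)) ^ 2 = 1 / m := by rw [div_pow, Real.sq_sqrt hm'.le, one_pow]
    let G : ℕ → ℝ := fun i => ∫ x, φ x ∂(multivariateGaussian 0
      ((i / m : ℝ) • K₁ + ((m - i) / m : ℝ) • K₂))
    have hG : ∀ i ∈ Finset.range m, |G (i + 1) - G i| ≤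
        M * (Δ / m) / 2 + C * ((1 / √(m : ℝ)) ^ 3 * T) := by
      intro i hi
      have hi' : (i : ℝ) + 1 ≤ m := by exact_mod_cast Finset.mem_range.1 hi
      -- The part of the covariance common to steps `i` and `i + 1`; the two laws are its
      -- convolutions with `K₁ / m` and `K₂ / m`.
      let Kb := (i / m : ℝ) • K₁ + ((m - (i + 1)) / m : ℝ) • K₂
      have hKb : Kb.PosSemidef := (h₁.smul (by positivity)).add
        (h₂.smul (div_nonneg (by linarith) hm'.le))
      have p1 : ((1 / √(m : ℝ)) ^ 2 • K₁).PosSemidef := h₁.smul (by positivity)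
      have p2 : ((1 / √(m : ℝ)) ^ 2 • K₂).PosSemidef := h₂.smul (by positivity)
      have e1 : G (i + 1) = ∫ w, ∫ x, φ (w + x)
          ∂(multivariateGaussian 0 ((1 / √(m : ℝ)) ^ 2 • K₁)) ∂(multivariateGaussian 0 Kb) := by
        rw [← integral_conv, multivariateGaussian_conv hKb p1]
        · simp only [G, Kb, hs]
          congr 2
          rw [add_right_comm, ← add_smul]
          push_cast
          congr 2
          ring
        · exact Integrable.of_bound (by fun_prop) b (.of_forall fun x => hb _)
      have e2 : G i = ∫ w, ∫ x, φ (w + x)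
          ∂(multivariateGaussian 0 ((1 / √(m : ℝ)) ^ 2 • K₂)) ∂(multivariateGaussian 0 Kb) := by
        rw [← integral_conv, multivariateGaussian_conv hKb p2]
        · simp only [G, Kb, hs]
          congr 2
          rw [add_assoc, ← add_smul]
          congr 2
          ring
        · exact Integrable.of_bound (by fun_prop) b (.of_forall fun x => hb _)
      have ii : ∀ K : Matrix ι ι ℝ, Integrable (fun w => ∫ x, φ (w + x)
          ∂(multivariateGaussian 0 K)) (multivariateGaussian 0 Kb) := by
        intro K
        refine Integrable.of_bound (C := b) ?_ (.of_forall fun w => ?_)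
        · refine (StronglyMeasurable.integral_prod_right
            (f := fun w x => φ (w + x)) ?_).aestronglyMeasurable
          have hc : Continuous fun p : EuclideanSpace ℝ ι × EuclideanSpace ℝ ι => φ (p.1 + p.2) := by
            fun_prop
          exact hc.stronglyMeasurable
        · have := norm_integral_le_of_norm_le_const (μ := multivariateGaussian 0 K)
            (f := fun x => φ (w + x)) (.of_forall fun x => hb (w + x))
          simpa using this
      rw [e1, e2, ← integral_sub (ii _) (ii _)]
      have := norm_integral_le_of_norm_le_const (μ := multivariateGaussian 0 Kb)
        (C := M * (Δ / m) / 2 + C * ((1 / √(m : ℝ)) ^ 3 * T)) (f := fun w =>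
          ∫ x, φ (w + x) ∂(multivariateGaussian 0 ((1 / √(m : ℝ)) ^ 2 • K₁)) -
          ∫ x, φ (w + x) ∂(multivariateGaussian 0 ((1 / √(m : ℝ)) ^ 2 • K₂)))
        (.of_forall fun w => by
          have hd : ∀ j k, |((1 / √(m : ℝ)) ^ 2 • K₁) j k - ((1 / √(m : ℝ)) ^ 2 • K₂) j k| ≤
              Δ / m := by
            intro j k
            simp only [Matrix.smul_apply, smul_eq_mul, hs]
            rw [← mul_sub, abs_mul, abs_of_pos (by positivity : (0 : ℝ) < 1 / m), div_mul_eq_mul_div,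
              one_mul]
            gcongr
            exact hΔ j k
          have := abs_integral_gaussian_sub_le_of_taylor p1 p2 hφ hb hd w (l w) (q w)
            (htaylor w) (hq w) (by positivity)
          rw [integral_norm_cube_smul h₁ (by positivity),
            integral_norm_cube_smul h₂ (by positivity), ← mul_add] at this
          exact this)
      simpa using this
    have hsum : G m - G 0 = ∑ i ∈ Finset.range m, (G (i + 1) - G i) :=
      (Finset.sum_range_sub G m).symm
    have g0 : G 0 = ∫ x, φ x ∂(multivariateGaussian 0 K₂) := by
      simp [G, div_self hm'.ne']
    have gm : G m = ∫ x, φ x ∂(multivariateGaussian 0 K₁) := by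
      simp [G, div_self hm'.ne']
    rw [← g0, ← gm, hsum]
    refine (Finset.abs_sum_le_sum_abs _ _).trans ((Finset.sum_le_sum hG).trans (le_of_eq ?_))
    rw [Finset.sum_const, Finset.card_range, nsmul_eq_mul]
    have : (1 / √(m : ℝ)) ^ 3 = 1 / m * (1 / √(m : ℝ)) := by rw [pow_succ, hs]
    rw [this]
    field_simp
  have lim : Filter.Tendsto (fun m : ℕ => M * Δ / 2 + C * T * (1 / √(m : ℝ))) Filter.atTop
      (nhds (M * Δ / 2 + C * T * 0)) := by
    refine tendsto_const_nhds.add (tendsto_const_nhds.mul ?_)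
    simp_rw [one_div]
    exact tendsto_inv_atTop_zero.comp
      (Real.tendsto_sqrt_atTop.comp tendsto_natCast_atTop_atTop)
  rw [mul_zero, add_zero] at lim
  exact ge_of_tendsto lim (Filter.eventually_atTop.2 ⟨1, fun m hm => step m hm⟩)

end GaussianInterpolation

/-! ### Smooth approximation of indicators on the line. -/

section SmoothIndicator

/-- The average of `h` over the interval `[x - δ, x + δ]`. -/
noncomputable def boxAverage (δ : ℝ) (h : ℝ → ℝ) (x : ℝ) : ℝ :=
  (2 * δ)⁻¹ * ∫ y in (x - δ)..(x + δ), h y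

lemma hasDerivAt_boxAverage {δ : ℝ} {h : ℝ → ℝ} (hc : Continuous h) (x : ℝ) :
    HasDerivAt (boxAverage δ h) ((2 * δ)⁻¹ * (h (x + δ) - h (x - δ))) x := by
  have e : boxAverage δ h = fun x => (2 * δ)⁻¹ * ((∫ y in (0 : ℝ)..(x + δ), h y) -
      ∫ y in (0 : ℝ)..(x - δ), h y) := by
    funext x
    rw [boxAverage, intervalIntegral.integral_interval_sub_left] <;>
      exact hc.intervalIntegrable _ _
  rw [e]
  refine HasDerivAt.const_mul _ (HasDerivAt.sub ?_ ?_)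
  · exact HasDerivAt.comp_add_const (f := fun u => ∫ y in (0 : ℝ)..u, h y) x δ
      (hc.integral_hasStrictDerivAt 0 (x + δ)).hasDerivAt
  · exact HasDerivAt.comp_sub_const (f := fun u => ∫ y in (0 : ℝ)..u, h y) x δ
      (hc.integral_hasStrictDerivAt 0 (x - δ)).hasDerivAt

lemma continuous_boxAverage {δ : ℝ} {h : ℝ → ℝ} (hc : Continuous h) :
    Continuous (boxAverage δ h) :=
  continuous_iff_continuousAt.2 fun x => (hasDerivAt_boxAverage hc x).continuousAt

lemma boxAverage_const {δ : ℝ} (hδ : 0 < δ) (a x : ℝ) : boxAverage δ (fun _ => a) x = a := by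
  simp only [boxAverage, intervalIntegral.integral_const, smul_eq_mul]
  field_simp
  ring

lemma boxAverage_congr {δ : ℝ} (hδ : 0 < δ) {h k : ℝ → ℝ} {x : ℝ}
    (H : ∀ y, |y - x| ≤ δ → h y = k y) : boxAverage δ h x = boxAverage δ k x := by
  rw [boxAverage, boxAverage]
  congr 1
  refine intervalIntegral.integral_congr fun y hy => H y ?_
  rw [Set.uIcc_of_le (by linarith)] at hy
  rw [abs_le]
  constructor <;> linarith [hy.1, hy.2]

lemma boxAverage_mono {δ : ℝ} (hδ : 0 < δ) {h k : ℝ → ℝ} (hc : Continuous h) (kc : Continuous k)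
    (H : ∀ y, h y ≤ k y) (x : ℝ) : boxAverage δ h x ≤ boxAverage δ k x := by
  refine mul_le_mul_of_nonneg_left ?_ (by positivity)
  exact intervalIntegral.integral_mono_on (by linarith) (hc.intervalIntegrable _ _)
    (kc.intervalIntegrable _ _) fun y _ => H y

lemma boxAverage_mem_Icc {δ : ℝ} (hδ : 0 < δ) {h : ℝ → ℝ} (hc : Continuous h)
    (H : ∀ y, h y ∈ Set.Icc (0 : ℝ) 1) (x : ℝ) : boxAverage δ h x ∈ Set.Icc (0 : ℝ) 1 := by
  have h0 := boxAverage_mono hδ continuous_const hc (fun y => (H y).1) x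
  have h1 := boxAverage_mono hδ hc continuous_const (fun y => (H y).2) x
  rw [boxAverage_const hδ] at h0 h1
  exact ⟨h0, h1⟩

lemma exists_ne_zero_of_boxAverage_ne_zero {δ : ℝ} (hδ : 0 < δ) {h : ℝ → ℝ} {x : ℝ}
    (H : boxAverage δ h x ≠ 0) : ∃ y, |y - x| ≤ δ ∧ h y ≠ 0 := by
  by_contra! hh
  exact H ((boxAverage_congr hδ hh).trans (boxAverage_const hδ 0 x))

lemma boxAverage_eq_one {δ : ℝ} (hδ : 0 < δ) {h : ℝ → ℝ} {x : ℝ}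
    (H : ∀ y, |y - x| ≤ δ → h y = 1) : boxAverage δ h x = 1 :=
  (boxAverage_congr hδ H).trans (boxAverage_const hδ 1 x)

/-- A smooth approximation of the indicator of `B` at scale `δ`. -/
lemma exists_smooth_indicator (B : Set ℝ) {δ : ℝ} (hδ : 0 < δ) :
    ∃ g g₁ g₂ g₃ : ℝ → ℝ, (∀ x, HasDerivAt g (g₁ x) x) ∧ (∀ x, HasDerivAt g₁ (g₂ x) x) ∧
      (∀ x, HasDerivAt g₂ (g₃ x) x) ∧ (∀ x, g x ∈ Set.Icc (0 : ℝ) 1) ∧ (∀ x, |g₁ x| ≤ 1 / δ) ∧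
      (∀ x, |g₂ x| ≤ 1 / δ ^ 2) ∧ (∀ x, |g₃ x| ≤ 1 / δ ^ 3) ∧ (∀ x ∈ B, g x = 1) ∧
      ∀ x, g x ≠ 0 → x ∈ Metric.thickening (8 * δ) B := by
  -- Three box averages of a continuous function with values in `[0, 1]`: each average supplies one
  -- derivative at the price of a factor `1 / δ`. An average looks at most `δ` away, so starting
  -- from the `3 * δ` thickening keeps the value one on `B`, and the support stays within `4 * δ + δ
  -- + 3 * δ = 8 * δ` of `B`.
  let h₀ : ℝ → ℝ := fun x => (thickenedIndicator hδ (Metric.cthickening (3 * δ) B) x : ℝ)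
  have c₀ : Continuous h₀ := by fun_prop
  have b₀ : ∀ y, h₀ y ∈ Set.Icc (0 : ℝ) 1 := fun y =>
    ⟨NNReal.coe_nonneg _, by exact_mod_cast thickenedIndicator_le_one hδ _ y⟩
  let h₁ := boxAverage δ h₀
  let h₂ := boxAverage δ h₁
  have c₁ : Continuous h₁ := continuous_boxAverage c₀
  have c₂ : Continuous h₂ := continuous_boxAverage c₁
  have b₁ := boxAverage_mem_Icc hδ c₀ b₀
  have b₂ := boxAverage_mem_Icc hδ c₁ b₁
  have b₃ := boxAverage_mem_Icc hδ c₂ b₂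
  have d₂ : ∀ x, HasDerivAt h₂ _ x := hasDerivAt_boxAverage (δ := δ) c₁
  have d₁ : ∀ x, HasDerivAt h₁ _ x := hasDerivAt_boxAverage (δ := δ) c₀
  refine ⟨boxAverage δ h₂, _, fun x => (2 * δ)⁻¹ * ((2 * δ)⁻¹ * (h₁ (x + δ + δ) - h₁ (x + δ - δ)) -
      (2 * δ)⁻¹ * (h₁ (x - δ + δ) - h₁ (x - δ - δ))),
    fun x => (2 * δ)⁻¹ * ((2 * δ)⁻¹ * ((2 * δ)⁻¹ * (h₀ (x + δ + δ + δ) - h₀ (x + δ + δ - δ)) -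
        (2 * δ)⁻¹ * (h₀ (x + δ - δ + δ) - h₀ (x + δ - δ - δ))) -
      (2 * δ)⁻¹ * ((2 * δ)⁻¹ * (h₀ (x - δ + δ + δ) - h₀ (x - δ + δ - δ)) -
        (2 * δ)⁻¹ * (h₀ (x - δ - δ + δ) - h₀ (x - δ - δ - δ)))),
    hasDerivAt_boxAverage (δ := δ) c₂, fun x => ?_, fun x => ?_, b₃, fun x => ?_, fun x => ?_,
    fun x => ?_, fun x hx => ?_, fun x hx => ?_⟩
  · exact HasDerivAt.const_mul _ (((d₂ (x + δ)).comp_add_const x δ).sub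
      ((d₂ (x - δ)).comp_sub_const x δ))
  · refine HasDerivAt.const_mul _ (HasDerivAt.sub (HasDerivAt.const_mul _ (HasDerivAt.sub ?_ ?_))
      (HasDerivAt.const_mul _ (HasDerivAt.sub ?_ ?_)))
    · exact HasDerivAt.comp_add_const (f := fun x => h₁ (x + δ)) x δ
        ((d₁ (x + δ + δ)).comp_add_const (x + δ) δ)
    · exact HasDerivAt.comp_add_const (f := fun x => h₁ (x - δ)) x δ
        ((d₁ (x + δ - δ)).comp_sub_const (x + δ) δ)
    · exact HasDerivAt.comp_sub_const (f := fun x => h₁ (x + δ)) x δ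
        ((d₁ (x - δ + δ)).comp_add_const (x - δ) δ)
    · exact HasDerivAt.comp_sub_const (f := fun x => h₁ (x - δ)) x δ
        ((d₁ (x - δ - δ)).comp_sub_const (x - δ) δ)
  · have e1 := b₂ (x + δ)
    have e2 := b₂ (x - δ)
    rw [abs_mul, abs_of_pos (by positivity), one_div, mul_inv]
    have : |h₂ (x + δ) - h₂ (x - δ)| ≤ 1 := by
      rw [abs_le]; constructor <;> linarith [e1.1, e1.2, e2.1, e2.2]
    nlinarith [inv_pos.2 hδ]
  · have e1 := b₁ (x + δ + δ)
    have e2 := b₁ (x + δ - δ)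
    have e3 := b₁ (x - δ + δ)
    have e4 := b₁ (x - δ - δ)
    have : (2 * δ)⁻¹ * ((2 * δ)⁻¹ * (h₁ (x + δ + δ) - h₁ (x + δ - δ)) -
      (2 * δ)⁻¹ * (h₁ (x - δ + δ) - h₁ (x - δ - δ))) = (1 / δ ^ 2) *
      (((h₁ (x + δ + δ) - h₁ (x + δ - δ)) - (h₁ (x - δ + δ) - h₁ (x - δ - δ))) / 4) := by
      field_simp; ring
    refine (congrArg abs this).trans_le ?_
    rw [abs_mul, abs_of_pos (by positivity : 0 < 1 / δ ^ 2)]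
    refine mul_le_of_le_one_right (by positivity) ?_
    rw [abs_le]; constructor <;> linarith [e1.1, e1.2, e2.1, e2.2, e3.1, e3.2, e4.1, e4.2]
  · have e1 := b₀ (x + δ + δ + δ)
    have e2 := b₀ (x + δ + δ - δ)
    have e3 := b₀ (x + δ - δ + δ)
    have e4 := b₀ (x + δ - δ - δ)
    have e5 := b₀ (x - δ + δ + δ)
    have e6 := b₀ (x - δ + δ - δ)
    have e7 := b₀ (x - δ - δ + δ)
    have e8 := b₀ (x - δ - δ - δ)
    beta_reduce
    generalize h₀ (x + δ + δ + δ) = z1 at *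
    generalize h₀ (x + δ + δ - δ) = z2 at *
    generalize h₀ (x + δ - δ + δ) = z3 at *
    generalize h₀ (x + δ - δ - δ) = z4 at *
    generalize h₀ (x - δ + δ + δ) = z5 at *
    generalize h₀ (x - δ + δ - δ) = z6 at *
    generalize h₀ (x - δ - δ + δ) = z7 at *
    generalize h₀ (x - δ - δ - δ) = z8 at *
    have : (2 * δ)⁻¹ * ((2 * δ)⁻¹ * ((2 * δ)⁻¹ * (z1 - z2) - (2 * δ)⁻¹ * (z3 - z4)) -
        (2 * δ)⁻¹ * ((2 * δ)⁻¹ * (z5 - z6) - (2 * δ)⁻¹ * (z7 - z8))) = (1 / δ ^ 3) *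
      ((((z1 - z2) - (z3 - z4)) - ((z5 - z6) - (z7 - z8))) / 8) := by
      field_simp; ring
    refine (congrArg abs this).trans_le ?_
    rw [abs_mul, abs_of_pos (by positivity : 0 < 1 / δ ^ 3)]
    refine mul_le_of_le_one_right (by positivity) ?_
    rw [abs_le]
    constructor <;> linarith [e1.1, e1.2, e2.1, e2.2, e3.1, e3.2, e4.1, e4.2, e5.1, e5.2, e6.1,
      e6.2, e7.1, e7.2, e8.1, e8.2]
  · refine boxAverage_eq_one hδ fun y hy => boxAverage_eq_one hδ fun z hz =>
      boxAverage_eq_one hδ fun u hu => ?_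
    have : u ∈ Metric.cthickening (3 * δ) B := by
      refine Metric.mem_cthickening_of_dist_le u x _ _ hx ?_
      rw [Real.dist_eq]
      rw [abs_le] at *
      constructor <;> linarith [hy.1, hy.2, hz.1, hz.2, hu.1, hu.2]
    exact congrArg NNReal.toReal (thickenedIndicator_one hδ _ this)
  · obtain ⟨y, hy, hy'⟩ := exists_ne_zero_of_boxAverage_ne_zero hδ hx
    obtain ⟨z, hz, hz'⟩ := exists_ne_zero_of_boxAverage_ne_zero hδ hy'
    obtain ⟨u, hu, hu'⟩ := exists_ne_zero_of_boxAverage_ne_zero hδ hz'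
    have hu2 : u ∈ Metric.thickening δ (Metric.cthickening (3 * δ) B) := by
      by_contra hcon
      exact hu' (congrArg NNReal.toReal (thickenedIndicator_zero hδ _ hcon))
    obtain ⟨v, hv, hv'⟩ := Metric.mem_thickening_iff.1 hu2
    have hv2 := Metric.cthickening_subset_thickening' (by linarith) (by linarith : 3 * δ < 4 * δ) B hv
    obtain ⟨a, ha, ha'⟩ := Metric.mem_thickening_iff.1 hv2
    refine Metric.mem_thickening_iff.2 ⟨a, ha, ?_⟩
    rw [Real.dist_eq] at *
    rw [abs_lt] at *
    rw [abs_le] at *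
    constructor <;> linarith [hy.1, hy.2, hz.1, hz.2, hu.1, hu.2, hv'.1, hv'.2, ha'.1, ha'.2]

end SmoothIndicator

/-! ### The log-sum-exp function and its Taylor expansion. -/

section SoftMax

/-- The mean value inequality is applied three times. The missing factor `1 / 6` is harmless, since
the third-order remainder disappears in the interpolation limit. -/
lemma abs_taylor_two_le {h h₁ h₂ h₃ : ℝ → ℝ} (d₁ : ∀ x, HasDerivAt h (h₁ x) x)
    (d₂ : ∀ x, HasDerivAt h₁ (h₂ x) x) (d₃ : ∀ x, HasDerivAt h₂ (h₃ x) x) {C : ℝ}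
    (hC : ∀ x, |h₃ x| ≤ C) : |h 1 - h 0 - h₁ 0 - h₂ 0 / 2| ≤ C := by
  have C0 : 0 ≤ C := (abs_nonneg _).trans (hC 0)
  have s2 : ∀ x ∈ Set.Icc (0 : ℝ) 1, |h₂ x - h₂ 0| ≤ C := fun x hx => by
    have := norm_image_sub_le_of_norm_deriv_le_segment' (a := 0) (b := 1) (C := C)
      (fun x _ => (d₃ x).hasDerivWithinAt) (fun x _ => hC x) x hx
    exact this.trans (by nlinarith [hx.1, hx.2])
  have s1 : ∀ x ∈ Set.Icc (0 : ℝ) 1, |h₁ x - h₁ 0 - x * h₂ 0| ≤ C := fun x hx => by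
    have := norm_image_sub_le_of_norm_deriv_le_segment' (a := 0) (b := 1) (C := C)
      (f := fun x => h₁ x - x * h₂ 0) (f' := fun x => h₂ x - 1 * h₂ 0)
      (fun x _ => ((d₂ x).sub ((hasDerivAt_id x).mul_const _)).hasDerivWithinAt)
      (fun x hx => by simpa using s2 x ⟨hx.1, hx.2.le⟩) x hx
    refine le_trans (le_of_eq ?_) (this.trans (by nlinarith [hx.1, hx.2]))
    rw [Real.norm_eq_abs]; congr 1; ring
  have := norm_image_sub_le_of_norm_deriv_le_segment' (a := 0) (b := 1) (C := C)
      (f := fun x => h x - x * h₁ 0 - x ^ 2 / 2 * h₂ 0)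
      (f' := fun x => h₁ x - 1 * h₁ 0 - x * h₂ 0)
      (fun x _ => by
        have hsq : HasDerivAt (fun x : ℝ => x ^ 2 / 2) x x := by
          have := ((hasDerivAt_id x).pow 2).div_const 2
          simpa using this
        exact (((d₁ x).sub ((hasDerivAt_id x).mul_const _)).sub
          (hsq.mul_const _)).hasDerivWithinAt)
      (fun x hx => by simpa using s1 x ⟨hx.1, hx.2.le⟩) 1 (by simp)
  refine le_trans (le_of_eq ?_) (this.trans (by simp))
  rw [Real.norm_eq_abs]; congr 1; ring

variable {ι : Type*} [Fintype ι]

/-- The log-sum-exp approximation of the maximum. -/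
noncomputable def softMax (β : ℝ) (w : ι → ℝ) : ℝ := β⁻¹ * Real.log (∑ j, Real.exp (β * w j))

/-- The Gibbs weights. -/
noncomputable def gibbs (β : ℝ) (w : ι → ℝ) (j : ι) : ℝ :=
  Real.exp (β * w j) / ∑ k, Real.exp (β * w k)

lemma gibbs_nonneg (β : ℝ) (w : ι → ℝ) (j : ι) : 0 ≤ gibbs β w j := by
  unfold gibbs; positivity

lemma sum_exp_pos [Nonempty ι] (β : ℝ) (w : ι → ℝ) : 0 < ∑ k, Real.exp (β * w k) :=
  Finset.sum_pos (fun _ _ => Real.exp_pos _) Finset.univ_nonempty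

lemma sum_gibbs [Nonempty ι] (β : ℝ) (w : ι → ℝ) : ∑ j, gibbs β w j = 1 := by
  simp only [gibbs, ← Finset.sum_div]
  exact div_self (sum_exp_pos β w).ne'

lemma le_iSup_apply (w : ι → ℝ) (j : ι) : w j ≤ ⨆ j, w j :=
  le_ciSup (Set.finite_range w).bddAbove j

lemma iSup_le_softMax [Nonempty ι] {β : ℝ} (hβ : 0 < β) (w : ι → ℝ) : ⨆ j, w j ≤ softMax β w := by
  refine ciSup_le fun j => ?_
  rw [softMax, ← div_eq_inv_mul, le_div_iff₀ hβ, Real.le_log_iff_exp_le (sum_exp_pos β w),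
    mul_comm]
  exact Finset.single_le_sum (f := fun j => Real.exp (β * w j)) (fun _ _ => (Real.exp_pos _).le)
    (Finset.mem_univ j)

lemma softMax_le_iSup_add [Nonempty ι] {β : ℝ} (hβ : 0 < β) (w : ι → ℝ) :
    softMax β w ≤ (⨆ j, w j) + Real.log (Fintype.card ι) / β := by
  have hN : (0 : ℝ) < Fintype.card ι := by exact_mod_cast Fintype.card_pos
  rw [softMax, ← div_eq_inv_mul, div_le_iff₀ hβ, add_mul, div_mul_cancel₀ _ hβ.ne',
    Real.log_le_iff_le_exp (sum_exp_pos β w), Real.exp_add, Real.exp_log hN]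
  calc ∑ j, Real.exp (β * w j) ≤ ∑ _j : ι, Real.exp ((⨆ j, w j) * β) := by
        refine Finset.sum_le_sum fun j _ => Real.exp_le_exp.2 ?_
        rw [mul_comm]
        exact mul_le_mul_of_nonneg_right (le_iSup_apply w j) hβ.le
    _ = _ := by simp [mul_comm]

lemma continuous_softMax [Nonempty ι] (β : ℝ) : Continuous (softMax (ι := ι) β) := by
  unfold softMax
  exact continuous_const.mul (Continuous.log (by fun_prop) fun w => (sum_exp_pos β w).ne')

lemma abs_sum_pow_mul_exp_le {X : ℝ} (β : ℝ) (w x : ι → ℝ) (hx : ∀ j, |x j| ≤ X) (k : ℕ) :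
    |∑ j, x j ^ k * Real.exp (β * w j)| ≤ X ^ k * ∑ j, Real.exp (β * w j) := by
  rw [Finset.mul_sum]
  refine (Finset.abs_sum_le_sum_abs _ _).trans (Finset.sum_le_sum fun j _ => ?_)
  rw [abs_mul, abs_of_pos (Real.exp_pos _), abs_pow]
  gcongr
  exact hx j

/-- Third-order Taylor expansion of a smooth function of the soft maximum. -/
lemma abs_taylor_softMax_le [Nonempty ι] {g g₁ g₂ g₃ : ℝ → ℝ} (d₁ : ∀ x, HasDerivAt g (g₁ x) x)
    (d₂ : ∀ x, HasDerivAt g₁ (g₂ x) x) (d₃ : ∀ x, HasDerivAt g₂ (g₃ x) x) {G₁ G₂ G₃ : ℝ}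
    (b₁ : ∀ x, |g₁ x| ≤ G₁) (b₂ : ∀ x, |g₂ x| ≤ G₂) (b₃ : ∀ x, |g₃ x| ≤ G₃) {β : ℝ} (hβ : 0 < β)
    (w x : ι → ℝ) {X : ℝ} (hX : ∀ j, |x j| ≤ X) :
    |g (softMax β (w + x)) - g (softMax β w) - g₁ (softMax β w) * (∑ j, gibbs β w j * x j) -
      (g₂ (softMax β w) * (∑ j, gibbs β w j * x j) ^ 2 + g₁ (softMax β w) * β *
        (∑ j, gibbs β w j * x j ^ 2 - (∑ j, gibbs β w j * x j) ^ 2)) / 2| ≤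
      (G₃ + 6 * β * G₂ + 6 * β ^ 2 * G₁) * X ^ 3 := by
  have X0 : 0 ≤ X := (abs_nonneg _).trans (hX (Classical.arbitrary ι))
  have G10 : 0 ≤ G₁ := (abs_nonneg _).trans (b₁ 0)
  have G20 : 0 ≤ G₂ := (abs_nonneg _).trans (b₂ 0)
  -- Exponential moments along the segment from `w` to `w + x`. Differentiation raises the order by
  -- one and multiplies by `β`, and each ratio `m k s / m 0 s` is a Gibbs average of `x j ^ k`,
  -- hence at most `X ^ k`. All derivatives of the soft maximum are polynomials in these ratios.
  let m : ℕ → ℝ → ℝ := fun k s => ∑ j, x j ^ k * Real.exp (β * (w j + s * x j))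
  have hm : ∀ k s, HasDerivAt (m k) (β * m (k + 1) s) s := by
    intro k s
    have : ∀ j ∈ Finset.univ, HasDerivAt (fun s => x j ^ k * Real.exp (β * (w j + s * x j)))
        (x j ^ k * (Real.exp (β * (w j + s * x j)) * (β * (1 * x j)))) s := fun j _ =>
      (((((hasDerivAt_id s).mul_const (x j)).const_add (w j)).const_mul β).exp).const_mul _
    refine (HasDerivAt.fun_sum this).congr_deriv ?_
    simp only [m, Finset.mul_sum]
    exact Finset.sum_congr rfl fun j _ => by ring
  have m0 : ∀ s, 0 < m 0 s := fun s => by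
    simpa [m] using sum_exp_pos β (fun j => w j + s * x j)
  have hmb : ∀ k s, |m k s / m 0 s| ≤ X ^ k := fun k s => by
    rw [abs_div, abs_of_pos (m0 s), div_le_iff₀ (m0 s)]
    simpa [m] using abs_sum_pow_mul_exp_le β (fun j => w j + s * x j) x hX k
  let a : ℝ → ℝ := fun s => m 1 s / m 0 s
  let b : ℝ → ℝ := fun s => m 2 s / m 0 s
  let c : ℝ → ℝ := fun s => m 3 s / m 0 s
  have ha : ∀ s, HasDerivAt a (β * (b s - a s ^ 2)) s := fun s => by
    refine ((hm 1 s).div (hm 0 s) (m0 s).ne').congr_deriv ?_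
    have := (m0 s).ne'
    simp only [a, b]
    field_simp
  have hb : ∀ s, HasDerivAt b (β * (c s - a s * b s)) s := fun s => by
    refine ((hm 2 s).div (hm 0 s) (m0 s).ne').congr_deriv ?_
    have := (m0 s).ne'
    simp only [a, b, c]
    field_simp
  let F : ℝ → ℝ := fun s => β⁻¹ * Real.log (m 0 s)
  have hF : ∀ s, HasDerivAt F (a s) s := fun s => by
    refine (((hm 0 s).log (m0 s).ne').const_mul β⁻¹).congr_deriv ?_
    have := (m0 s).ne'
    simp only [a]
    field_simp
  have D1 : ∀ s, HasDerivAt (fun s => g (F s)) (g₁ (F s) * a s) s := fun s =>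
    (d₁ (F s)).comp s (hF s)
  have Dg1 : ∀ s, HasDerivAt (fun s => g₁ (F s)) (g₂ (F s) * a s) s := fun s =>
    (d₂ (F s)).comp s (hF s)
  have Dg2 : ∀ s, HasDerivAt (fun s => g₂ (F s)) (g₃ (F s) * a s) s := fun s =>
    (d₃ (F s)).comp s (hF s)
  have D2 : ∀ s, HasDerivAt (fun s => g₁ (F s) * a s)
      (g₂ (F s) * a s ^ 2 + g₁ (F s) * β * (b s - a s ^ 2)) s := fun s => by
    refine ((Dg1 s).mul (ha s)).congr_deriv ?_
    ring
  have D3 : ∀ s, HasDerivAt (fun s => g₂ (F s) * a s ^ 2 + g₁ (F s) * β * (b s - a s ^ 2))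
      (g₃ (F s) * a s ^ 3 + 3 * g₂ (F s) * β * a s * (b s - a s ^ 2) +
        g₁ (F s) * β ^ 2 * (c s - 3 * a s * b s + 2 * a s ^ 3)) s := fun s => by
    refine (((Dg2 s).mul ((ha s).pow 2)).add (((Dg1 s).mul_const β).mul
      ((hb s).sub ((ha s).pow 2)))).congr_deriv ?_
    simp only [Nat.cast_ofNat, Nat.add_one_sub_one, pow_one, Pi.pow_apply, Pi.sub_apply]
    ring
  have bnd : ∀ s, |g₃ (F s) * a s ^ 3 + 3 * g₂ (F s) * β * a s * (b s - a s ^ 2) +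
        g₁ (F s) * β ^ 2 * (c s - 3 * a s * b s + 2 * a s ^ 3)| ≤
      (G₃ + 6 * β * G₂ + 6 * β ^ 2 * G₁) * X ^ 3 := fun s => by
    have A : |a s| ≤ X := by simpa using hmb 1 s
    have B : |b s| ≤ X ^ 2 := hmb 2 s
    have C : |c s| ≤ X ^ 3 := hmb 3 s
    have A2 : |a s ^ 2| ≤ X ^ 2 := by rw [abs_pow]; gcongr
    have A3 : |a s ^ 3| ≤ X ^ 3 := by rw [abs_pow]; gcongr
    have BA : |b s - a s ^ 2| ≤ 2 * X ^ 2 := (abs_sub _ _).trans (by linarith)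
    have AB : |a s * b s| ≤ X ^ 3 := by
      rw [abs_mul, pow_succ']; gcongr
    have ABA : |a s * (b s - a s ^ 2)| ≤ 2 * X ^ 3 := by
      rw [abs_mul]
      calc |a s| * |b s - a s ^ 2| ≤ X * (2 * X ^ 2) := by gcongr
        _ = _ := by ring
    have CC : |c s - 3 * (a s * b s) + 2 * a s ^ 3| ≤ 6 * X ^ 3 := by
      rw [abs_le] at *
      constructor <;> linarith [C.1, C.2, AB.1, AB.2, A3.1, A3.2]
    have t1 : |g₃ (F s) * a s ^ 3| ≤ G₃ * X ^ 3 := by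
      rw [abs_mul]; exact mul_le_mul (b₃ _) A3 (abs_nonneg _) ((abs_nonneg _).trans (b₃ 0))
    have t2 : |3 * β * (g₂ (F s) * (a s * (b s - a s ^ 2)))| ≤ 3 * β * (G₂ * (2 * X ^ 3)) := by
      rw [abs_mul, abs_of_pos (by positivity : 0 < 3 * β), abs_mul]
      have := b₂ (F s)
      gcongr
    have t3 : |β ^ 2 * (g₁ (F s) * (c s - 3 * (a s * b s) + 2 * a s ^ 3))| ≤
        β ^ 2 * (G₁ * (6 * X ^ 3)) := by
      rw [abs_mul, abs_of_pos (by positivity : 0 < β ^ 2), abs_mul]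
      have := b₁ (F s)
      gcongr
    have e : g₃ (F s) * a s ^ 3 + 3 * g₂ (F s) * β * a s * (b s - a s ^ 2) +
        g₁ (F s) * β ^ 2 * (c s - 3 * a s * b s + 2 * a s ^ 3) = g₃ (F s) * a s ^ 3 +
        3 * β * (g₂ (F s) * (a s * (b s - a s ^ 2))) +
        β ^ 2 * (g₁ (F s) * (c s - 3 * (a s * b s) + 2 * a s ^ 3)) := by ring
    rw [e]
    refine (abs_add_three _ _ _).trans ?_
    linarith
  have T := abs_taylor_two_le D1 D2 D3 bnd
  have F1 : F 1 = softMax β (w + x) := by simp [F, m, softMax]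
  have F0 : F 0 = softMax β w := by simp [F, m, softMax]
  have a0 : a 0 = ∑ j, gibbs β w j * x j := by
    simp only [a, m, gibbs, Finset.sum_div]
    exact Finset.sum_congr rfl fun j _ => by simp; ring
  have b0 : b 0 = ∑ j, gibbs β w j * x j ^ 2 := by
    simp only [b, m, gibbs, Finset.sum_div]
    exact Finset.sum_congr rfl fun j _ => by simp; ring
  rw [F1, F0, a0, b0] at T
  exact T

end SoftMax

/-! ### Lévy–Prohorov comparison of Gaussian maxima. -/

section GaussianMaximum

variable {ι : Type*} [Fintype ι]

lemma continuous_iSup_apply : Continuous fun x : EuclideanSpace ℝ ι => ⨆ j, x j := by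
  classical
  rcases isEmpty_or_nonempty ι with h | h
  · simp only [Real.iSup_of_isEmpty]
    exact continuous_const
  · have : (fun x : EuclideanSpace ℝ ι => ⨆ j, x j) =
        fun x => Finset.univ.sup' Finset.univ_nonempty fun j => x j := by
      funext x
      rw [Finset.sup'_univ_eq_ciSup]
    rw [this]
    exact Continuous.finset_sup'_apply _ fun j _ => by fun_prop

variable [DecidableEq ι]

instance (K : Matrix ι ι ℝ) : IsProbabilityMeasure (gaussianMaxLaw K) :=
  Measure.isProbabilityMeasure_map continuous_iSup_apply.measurable.aemeasurable

/-- The Hessian of `g ∘ softMax` is a combination of `gibbs j * gibbs k` and a diagonal part with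
entries `gibbs j`. As the weights sum to one, its entries have absolute sum at most `G₂ + 2 * β *
G₁`, independently of the number of coordinates. -/
lemma abs_integral_softMax_sub_le [Nonempty ι] {g g₁ g₂ g₃ : ℝ → ℝ} (d₁ : ∀ x, HasDerivAt g (g₁ x) x)
    (d₂ : ∀ x, HasDerivAt g₁ (g₂ x) x) (d₃ : ∀ x, HasDerivAt g₂ (g₃ x) x) {G₁ G₂ G₃ : ℝ}
    (b₀ : ∀ x, |g x| ≤ 1)
    (b₁ : ∀ x, |g₁ x| ≤ G₁) (b₂ : ∀ x, |g₂ x| ≤ G₂) (b₃ : ∀ x, |g₃ x| ≤ G₃) {β : ℝ} (hβ : 0 < β)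
    {K₁ K₂ : Matrix ι ι ℝ} (h₁ : K₁.PosSemidef) (h₂ : K₂.PosSemidef) {Δ : ℝ} (hΔ0 : 0 ≤ Δ)
    (hΔ : ∀ j k, |K₁ j k - K₂ j k| ≤ Δ) :
    |∫ x : EuclideanSpace ℝ ι, g (softMax β x) ∂(multivariateGaussian 0 K₁) -
      ∫ x : EuclideanSpace ℝ ι, g (softMax β x) ∂(multivariateGaussian 0 K₂)| ≤
      (G₂ + 2 * β * G₁) * Δ / 2 := by
  have gc : Continuous g := continuous_iff_continuousAt.2 fun x => (d₁ x).continuousAt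
  have cont : Continuous fun x : EuclideanSpace ℝ ι => g (softMax β x) := by
    have := continuous_softMax (ι := ι) β
    fun_prop
  refine abs_integral_gaussian_sub_le h₁ h₂ cont (b := 1) (fun x => b₀ _)
    (C := G₃ + 6 * β * G₂ + 6 * β ^ 2 * G₁) hΔ
    (fun w j => g₁ (softMax β w) * gibbs β w j)
    (fun w j k => (g₂ (softMax β w) - g₁ (softMax β w) * β) * (gibbs β w j * gibbs β w k) +
      if j = k then g₁ (softMax β w) * β * gibbs β w j else 0) (fun w x => ?_) (fun w => ?_) hΔ0
  · have := abs_taylor_softMax_le d₁ d₂ d₃ b₁ b₂ b₃ hβ w.ofLp x.ofLp (X := ‖x‖)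
      (fun j => PiLp.norm_apply_le x j)
    refine le_trans (le_of_eq ?_) this
    congr 1
    have e1 : ∑ j, g₁ (softMax β w.ofLp) * gibbs β w.ofLp j * x j =
        g₁ (softMax β w.ofLp) * ∑ j, gibbs β w.ofLp j * x j := by
      rw [Finset.mul_sum]
      exact Finset.sum_congr rfl fun j _ => by ring
    have e2 : (∑ j, ∑ k, ((g₂ (softMax β w) - g₁ (softMax β w) * β) *
        (gibbs β w j * gibbs β w k) + if j = k then g₁ (softMax β w) * β * gibbs β w j else 0) *
          (x j * x k)) =
        (g₂ (softMax β w.ofLp) - g₁ (softMax β w.ofLp) * β) * (∑ j, gibbs β w.ofLp j * x j) ^ 2 +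
        g₁ (softMax β w.ofLp) * β * ∑ j, gibbs β w.ofLp j * x j ^ 2 := by
      simp_rw [add_mul, Finset.sum_add_distrib, ite_mul, zero_mul, Finset.sum_ite_eq,
        Finset.mem_univ, if_true]
      rw [sq, Finset.sum_mul_sum, Finset.mul_sum, Finset.mul_sum]
      congr 1
      · refine Finset.sum_congr rfl fun j _ => ?_
        rw [Finset.mul_sum]
        exact Finset.sum_congr rfl fun k _ => by ring
      · exact Finset.sum_congr rfl fun k _ => by ring
    rw [e1, e2, WithLp.ofLp_add]
    ring
  · have p0 := gibbs_nonneg β w.ofLp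
    have p1 := sum_gibbs β w.ofLp
    have B1 := b₁ (softMax β w.ofLp)
    have B2 := b₂ (softMax β w.ofLp)
    calc _ ≤ ∑ j, ∑ k, ((G₂ + G₁ * β) * (gibbs β w.ofLp j * gibbs β w.ofLp k) +
          if j = k then G₁ * β * gibbs β w.ofLp j else 0) := by
          refine Finset.sum_le_sum fun j _ => Finset.sum_le_sum fun k _ => ?_
          refine (abs_add_le _ _).trans (add_le_add ?_ ?_)
          · rw [abs_mul, abs_of_nonneg (mul_nonneg (p0 j) (p0 k))]
            refine mul_le_mul_of_nonneg_right ?_ (mul_nonneg (p0 j) (p0 k))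
            refine (abs_sub _ _).trans ?_
            rw [abs_mul, abs_of_pos hβ]
            gcongr
          · split_ifs
            · rw [abs_mul, abs_mul, abs_of_pos hβ, abs_of_nonneg (p0 j)]
              have := p0 j
              gcongr
            · simp
      _ = (G₂ + G₁ * β) * ((∑ j, gibbs β w.ofLp j) * ∑ j, gibbs β w.ofLp j) +
          G₁ * β * ∑ j, gibbs β w.ofLp j := by
          simp_rw [Finset.sum_add_distrib, Finset.sum_ite_eq, Finset.mem_univ, if_true,
            ← Finset.mul_sum, ← Finset.sum_mul]
      _ ≤ _ := by rw [p1]; linarith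

lemma gaussianMaxLaw_apply (K : Matrix ι ι ℝ) {B : Set ℝ} (hB : MeasurableSet B) :
    gaussianMaxLaw K B =
      multivariateGaussian 0 K {x : EuclideanSpace ℝ ι | (⨆ j, x j) ∈ B} := by
  rw [gaussianMaxLaw, Measure.map_apply continuous_iSup_apply.measurable hB]
  rfl

/-- With `β = L / δ` the soft maximum exceeds the maximum by at most `δ`. Smoothing the indicator of
the `2 * δ` thickening absorbs this on the left; on the right the enlargements `2 * δ`, `8 * δ` and
`δ` add up to `11 * δ`. The derivative bounds `1 / δ` and `1 / δ ^ 2` then give the error term. -/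
lemma gaussianMaxLaw_le_thickening [Nonempty ι] {K₁ K₂ : Matrix ι ι ℝ} (h₁ : K₁.PosSemidef)
    (h₂ : K₂.PosSemidef) {Δ : ℝ} (hΔ0 : 0 ≤ Δ) (hΔ : ∀ j k, |K₁ j k - K₂ j k| ≤ Δ) {L : ℝ}
    (hL1 : 1 ≤ L) (hL : Real.log (Fintype.card ι) ≤ L) {δ : ℝ} (hδ : 0 < δ) {B : Set ℝ}
    (hB : MeasurableSet B) :
    gaussianMaxLaw K₁ B ≤ gaussianMaxLaw K₂ (Metric.thickening (11 * δ) B) +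
      ENNReal.ofReal (2 * Δ * L / δ ^ 2) := by
  have hβ : 0 < L / δ := by positivity
  have up : ∀ x : EuclideanSpace ℝ ι, ⨆ j, x j ≤ softMax (L / δ) x.ofLp := fun x =>
    iSup_le_softMax hβ x.ofLp
  have lo : ∀ x : EuclideanSpace ℝ ι, softMax (L / δ) x.ofLp ≤ (⨆ j, x j) + δ := fun x => by
    refine (softMax_le_iSup_add hβ x.ofLp).trans ?_
    gcongr
    rw [div_le_iff₀ hβ, mul_div_cancel₀ _ hδ.ne']
    exact hL
  obtain ⟨g, g₁, g₂, g₃, d₁, d₂, d₃, b₀, b₁, b₂, b₃, hone, hzero⟩ :=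
    exists_smooth_indicator (Metric.thickening (2 * δ) B) hδ
  have key := abs_integral_softMax_sub_le d₁ d₂ d₃
    (fun x => abs_le.2 ⟨by linarith [(b₀ x).1], (b₀ x).2⟩) b₁ b₂ b₃ hβ h₁ h₂ hΔ0 hΔ
  have gc : Continuous g := continuous_iff_continuousAt.2 fun x => (d₁ x).continuousAt
  have cont : Continuous fun x : EuclideanSpace ℝ ι => g (softMax (L / δ) x) := by
    have := continuous_softMax (ι := ι) (L / δ)
    fun_prop
  have int : ∀ K : Matrix ι ι ℝ, Integrable
      (fun x : EuclideanSpace ℝ ι => g (softMax (L / δ) x)) (multivariateGaussian 0 K) := fun K =>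
    Integrable.of_bound cont.aestronglyMeasurable 1 (.of_forall fun x => by
      rw [Real.norm_eq_abs]; exact abs_le.2 ⟨by linarith [(b₀ (softMax (L / δ) x)).1], (b₀ _).2⟩)
  have m1 : MeasurableSet {x : EuclideanSpace ℝ ι | (⨆ j, x j) ∈ B} :=
    continuous_iSup_apply.measurable hB
  have m2 : MeasurableSet {x : EuclideanSpace ℝ ι | (⨆ j, x j) ∈ Metric.thickening (11 * δ) B} :=
    continuous_iSup_apply.measurable Metric.isOpen_thickening.measurableSet
  have lower : (multivariateGaussian 0 K₁).real {x : EuclideanSpace ℝ ι | (⨆ j, x j) ∈ B} ≤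
      ∫ x : EuclideanSpace ℝ ι, g (softMax (L / δ) x) ∂(multivariateGaussian 0 K₁) := by
    rw [← integral_indicator_one m1]
    refine integral_mono ((integrable_const 1).indicator m1) (int K₁) fun x => ?_
    by_cases hx : x ∈ {x : EuclideanSpace ℝ ι | (⨆ j, x j) ∈ B}
    · rw [Set.indicator_of_mem hx, hone _ ?_]
      · rfl
      · refine Metric.mem_thickening_iff.2 ⟨_, hx, ?_⟩
        rw [Real.dist_eq, abs_lt]
        constructor <;> linarith [up x, lo x]
    · rw [Set.indicator_of_notMem hx]
      exact (b₀ _).1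
  have upper : ∫ x : EuclideanSpace ℝ ι, g (softMax (L / δ) x) ∂(multivariateGaussian 0 K₂) ≤
      (multivariateGaussian 0 K₂).real
        {x : EuclideanSpace ℝ ι | (⨆ j, x j) ∈ Metric.thickening (11 * δ) B} := by
    rw [← integral_indicator_one m2]
    refine integral_mono (int K₂) ((integrable_const 1).indicator m2) fun x => ?_
    by_cases hx : g (softMax (L / δ) x) = 0
    · simp only [hx]
      exact Set.indicator_nonneg (fun _ _ => zero_le_one) _
    · obtain ⟨y, hy, hxy⟩ := Metric.mem_thickening_iff.1 (hzero _ hx)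
      obtain ⟨z, hz, hyz⟩ := Metric.mem_thickening_iff.1 hy
      have : x ∈ {x : EuclideanSpace ℝ ι | (⨆ j, x j) ∈ Metric.thickening (11 * δ) B} := by
        refine Metric.mem_thickening_iff.2 ⟨z, hz, ?_⟩
        rw [Real.dist_eq, abs_lt] at *
        constructor <;> linarith [up x, lo x]
      rw [Set.indicator_of_mem this]
      exact (b₀ _).2
  have bound : (1 / δ ^ 2 + 2 * (L / δ) * (1 / δ)) * Δ / 2 ≤ 2 * Δ * L / δ ^ 2 := by
    have : (1 / δ ^ 2 + 2 * (L / δ) * (1 / δ)) * Δ / 2 = (1 / 2 + L) * Δ / δ ^ 2 := by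
      field_simp
    rw [this]
    gcongr ?_ / _
    nlinarith
  rw [gaussianMaxLaw_apply K₁ hB, gaussianMaxLaw_apply K₂ Metric.isOpen_thickening.measurableSet,
    ← ofReal_measureReal, ← ofReal_measureReal (s := {x : EuclideanSpace ℝ ι | _ ∈ _}),
    ← ENNReal.ofReal_add (by positivity) (by positivity)]
  refine ENNReal.ofReal_le_ofReal ?_
  linarith [(abs_le.1 key).2]

/-- Comparison of Gaussian maxima through the entrywise distance of the covariance matrices. -/
theorem levyProkhorovDist_gaussianMaxLaw_le [Nonempty ι] {K₁ K₂ : Matrix ι ι ℝ} (h₁ : K₁.PosSemidef)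
    (h₂ : K₂.PosSemidef) {Δ : ℝ} (hΔ0 : 0 ≤ Δ) (hΔ : ∀ j k, |K₁ j k - K₂ j k| ≤ Δ) {L : ℝ}
    (hL1 : 1 ≤ L) (hL : Real.log (Fintype.card ι) ≤ L) {δ : ℝ} (hδ : 0 < δ) :
    levyProkhorovDist (gaussianMaxLaw K₁) (gaussianMaxLaw K₂) ≤
      max (11 * δ) (2 * Δ * L / δ ^ 2) := by
  refine levyProkhorovDist_le_of_forall_le _ _ (le_max_of_le_left (by positivity))
    fun ε B hε hB => ?_
  refine (gaussianMaxLaw_le_thickening h₁ h₂ hΔ0 hΔ hL1 hL hδ hB).trans ?_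
  gcongr
  · exact (le_max_left _ _).trans hε.le
  · exact (le_max_right _ _).trans hε.le

lemma hasSubgaussianMGF_eval_multivariateGaussian {R : Matrix ι ι ℝ} (hR : R.PosSemidef) (j : ι) :
    HasSubgaussianMGF (fun x : EuclideanSpace ℝ ι => x j) (R j j).toNNReal
      (multivariateGaussian 0 R) := by
  have h := measurePreserving_eval_multivariateGaussian (μ := 0) hR (i := j)
  refine HasSubgaussianMGF.of_map (X := id) (Y := fun x : EuclideanSpace ℝ ι => x j)
    h.measurable.aemeasurable ?_
  rw [h.map_eq]
  refine ⟨fun t => ?_, fun t => ?_⟩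
  · exact integrable_exp_mul_gaussianReal t
  · rw [mgf_id_gaussianReal]
    simp

lemma multivariateGaussian_exists_le_abs [Nonempty ι] {R : Matrix ι ι ℝ} (hR : R.PosSemidef) {τ r : ℝ}
    (hr : 0 ≤ r) (hτ : ∀ j, R j j ≤ τ) :
    multivariateGaussian 0 R {x : EuclideanSpace ℝ ι | ∃ j, r ≤ |x j|} ≤
      ENNReal.ofReal (2 * Fintype.card ι * Real.exp (-r ^ 2 / (2 * τ))) := by
  have h1 : ∀ j, multivariateGaussian 0 R {x : EuclideanSpace ℝ ι | r ≤ |x j|} ≤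
      ENNReal.ofReal (2 * Real.exp (-r ^ 2 / (2 * τ))) := by
    intro j
    -- A coordinate of variance zero vanishes almost surely. It is treated apart because division by
    -- zero would make its own exponential bound trivial, so that comparison with `τ` fails.
    rcases eq_or_lt_of_le (hR.diag_nonneg (i := j)) with h0 | h0
    · have h := measurePreserving_eval_multivariateGaussian (μ := 0) hR (i := j)
      rcases eq_or_lt_of_le hr with hr0 | hr0
      · subst hr0
        refine prob_le_one.trans ?_
        simp
      · have : multivariateGaussian 0 R {x : EuclideanSpace ℝ ι | r ≤ |x j|} = 0 := by
          have m : MeasurableSet {y : ℝ | r ≤ |y|} := measurableSet_le (by fun_prop) (by fun_prop)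
          have := h.measure_preimage m.nullMeasurableSet
          rw [← h0] at this
          simpa [gaussianReal_zero_var, m, hr0] using this
        rw [this]
        exact zero_le
    have sg := hasSubgaussianMGF_eval_multivariateGaussian hR j
    have e1 := sg.measure_ge_le hr
    have e2 := sg.neg.measure_ge_le hr
    rw [Real.coe_toNNReal _ hR.diag_nonneg] at e1 e2
    have hmono : Real.exp (-r ^ 2 / (2 * R j j)) ≤ Real.exp (-r ^ 2 / (2 * τ)) := by
      rw [Real.exp_le_exp, neg_div, neg_div, neg_le_neg_iff]
      exact div_le_div_of_nonneg_left (by positivity) (by positivity) (by linarith [hτ j])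
    have sub : {x : EuclideanSpace ℝ ι | r ≤ |x j|} ⊆
        {x : EuclideanSpace ℝ ι | r ≤ x j} ∪ {x | r ≤ (-fun x : EuclideanSpace ℝ ι => x j) x} := by
      intro x hx
      rcases le_abs.1 (show r ≤ |x j| from hx) with h | h
      · exact Or.inl h
      · exact Or.inr h
    refine (measure_mono sub).trans ((measure_union_le _ _).trans ?_)
    rw [← ofReal_measureReal, ← ofReal_measureReal (s := {x | r ≤ (-fun _ => _) x}),
      ← ENNReal.ofReal_add (by positivity) (by positivity)]
    exact ENNReal.ofReal_le_ofReal (by linarith)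
  have : {x : EuclideanSpace ℝ ι | ∃ j, r ≤ |x j|} = ⋃ j, {x | r ≤ |x j|} := by ext; simp
  rw [this]
  refine (measure_iUnion_fintype_le _ _).trans ((Finset.sum_le_sum fun j _ => h1 j).trans ?_)
  rw [Finset.sum_const, Finset.card_univ, nsmul_eq_mul, ← ENNReal.ofReal_natCast,
    ← ENNReal.ofReal_mul (by positivity)]
  exact ENNReal.ofReal_le_ofReal (by linarith)

lemma abs_iSup_add_sub_iSup_lt [Nonempty ι] {x y : EuclideanSpace ℝ ι} {r : ℝ} (h : ∀ j, |y j| < r) :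
    |(⨆ j, (x + y) j) - ⨆ j, x j| < r := by
  obtain ⟨a, ha⟩ := exists_eq_ciSup_of_finite (f := fun j => (x + y) j)
  obtain ⟨b, hb⟩ := exists_eq_ciSup_of_finite (f := fun j => x j)
  have h1 := le_iSup_apply (fun j => (x + y) j) b
  have h2 := le_iSup_apply (fun j => x j) a
  have h3 := abs_lt.1 (h a)
  have h4 := abs_lt.1 (h b)
  simp only [PiLp.add_apply] at *
  rw [abs_lt]
  constructor <;> linarith [h3.1, h3.2, h4.1, h4.2]

/-- Adding an independent Gaussian perturbation with small variances moves the maximum little. -/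
theorem levyProkhorovDist_gaussianMaxLaw_add_le [Nonempty ι] {K R : Matrix ι ι ℝ} (hK : K.PosSemidef)
    (hR : R.PosSemidef) {τ r : ℝ} (hr : 0 < r) (hτ : ∀ j, R j j ≤ τ)
    (h : 2 * Fintype.card ι * Real.exp (-r ^ 2 / (2 * τ)) ≤ r) :
    levyProkhorovDist (gaussianMaxLaw (K + R)) (gaussianMaxLaw K) ≤ r := by
  refine levyProkhorovDist_le_of_forall_le _ _ hr.le fun ε B hε hB => ?_
  have m2 : MeasurableSet {x : EuclideanSpace ℝ ι | (⨆ j, x j) ∈ Metric.thickening r B} :=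
    continuous_iSup_apply.measurable Metric.isOpen_thickening.measurableSet
  have step : gaussianMaxLaw (K + R) B ≤
      gaussianMaxLaw K (Metric.thickening r B) + ENNReal.ofReal r := by
    have m1 : MeasurableSet {x : EuclideanSpace ℝ ι | (⨆ j, x j) ∈ B} :=
      continuous_iSup_apply.measurable hB
    rw [gaussianMaxLaw_apply _ hB, gaussianMaxLaw_apply _ Metric.isOpen_thickening.measurableSet,
      ← multivariateGaussian_conv hK hR, Measure.conv, Measure.map_apply (by fun_prop) m1]
    have sub : (fun p : EuclideanSpace ℝ ι × EuclideanSpace ℝ ι => p.1 + p.2) ⁻¹'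
        {x : EuclideanSpace ℝ ι | (⨆ j, x j) ∈ B} ⊆
        ({x : EuclideanSpace ℝ ι | (⨆ j, x j) ∈ Metric.thickening r B} ×ˢ Set.univ) ∪
        (Set.univ ×ˢ {x : EuclideanSpace ℝ ι | ∃ j, r ≤ |x j|}) := by
      rintro ⟨x, y⟩ hxy
      by_cases hy : ∃ j, r ≤ |y j|
      · exact Or.inr ⟨trivial, hy⟩
      · push Not at hy
        refine Or.inl ⟨Metric.mem_thickening_iff.2 ⟨_, hxy, ?_⟩, trivial⟩
        rw [dist_comm, Real.dist_eq]
        exact abs_iSup_add_sub_iSup_lt hy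
    refine (measure_mono sub).trans ((measure_union_le _ _).trans ?_)
    rw [Measure.prod_prod, Measure.prod_prod, measure_univ, measure_univ, mul_one, one_mul]
    gcongr
    exact (multivariateGaussian_exists_le_abs hR hr.le hτ).trans (ENNReal.ofReal_le_ofReal h)
  refine step.trans ?_
  gcongr

lemma levyProkhorovDist_le_one {μ ν : Measure ℝ} [IsProbabilityMeasure μ]
    [IsProbabilityMeasure ν] : levyProkhorovDist μ ν ≤ 1 := by
  have := levyProkhorovEDist_le_max_measure_univ μ ν
  rw [measure_univ, measure_univ, max_self] at this
  exact ENNReal.toReal_le_of_le_ofReal zero_le_one (by simpa using this)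

end GaussianMaximum

/-! ### The bootstrap statistic as a Gaussian maximum. -/

section BootstrapLaw

lemma map_mulVec_pi_gaussianReal {ι κ : Type*} [Fintype ι] [DecidableEq ι] [Fintype κ]
    (W : Matrix ι κ ℝ) :
    (Measure.pi fun _ : κ => gaussianReal 0 1).map (fun ξ => WithLp.toLp 2 (W *ᵥ ξ)) =
      multivariateGaussian 0 (W * Wᵀ) := by
  have hmeas : Measurable fun ξ : κ → ℝ => (WithLp.toLp 2 (W *ᵥ ξ) : EuclideanSpace ℝ ι) := by
    have : Measurable fun ξ : κ → ℝ => W *ᵥ ξ := by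
      refine measurable_pi_lambda _ fun i => ?_
      simp only [mulVec, dotProduct]
      fun_prop
    fun_prop
  have : IsProbabilityMeasure ((Measure.pi fun _ : κ => gaussianReal 0 1).map
      (fun ξ => (WithLp.toLp 2 (W *ᵥ ξ) : EuclideanSpace ℝ ι))) :=
    Measure.isProbabilityMeasure_map hmeas.aemeasurable
  have hpsd : (W * Wᵀ).PosSemidef := by
    simpa [conjTranspose_eq_transpose_of_trivial] using posSemidef_self_mul_conjTranspose W
  apply Measure.ext_of_charFun
  ext x
  rw [charFun_multivariateGaussian hpsd, charFun_apply, integral_map hmeas.aemeasurable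
    (by fun_prop)]
  have e : ∀ ξ : κ → ℝ, inner ℝ (WithLp.toLp 2 (W *ᵥ ξ) : EuclideanSpace ℝ ι) x =
      inner ℝ (WithLp.toLp 2 ξ : EuclideanSpace ℝ κ) (WithLp.toLp 2 (Wᵀ *ᵥ x.ofLp)) := by
    intro ξ
    rw [EuclideanSpace.inner_eq_star_dotProduct, EuclideanSpace.inner_eq_star_dotProduct]
    simp only [star_trivial]
    rw [dotProduct_mulVec, ← mulVec_transpose]
  simp_rw [e]
  have h2 := charFun_stdGaussian (E := EuclideanSpace ℝ κ) (WithLp.toLp 2 (Wᵀ *ᵥ x.ofLp))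
  rw [← map_pi_eq_stdGaussian, charFun_apply, integral_map (by fun_prop) (by fun_prop)] at h2
  rw [h2]
  congr 1
  rw [← Complex.ofReal_pow, EuclideanSpace.real_norm_sq_eq]
  have : x.ofLp ⬝ᵥ (W * Wᵀ) *ᵥ x.ofLp = ∑ i, (Wᵀ *ᵥ x.ofLp) i ^ 2 := by
    rw [← mulVec_mulVec, dotProduct_mulVec, ← mulVec_transpose, dotProduct]
    exact Finset.sum_congr rfl fun i _ => (sq _).symm
  rw [this]
  simp
  ring

variable {t n d d' : ℕ}

/-- The value of the linear form `a_jᵀ s`, where `a_j` is the `j`-th column of `A`. -/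
noncomputable def columnForm {n d : ℕ} (A : Matrix (Fin n) (Fin d) ℝ) (s : Fin n → ℝ) (j : Fin d) : ℝ :=
  ∑ l, A l j * s l

lemma dyad_apply (A : Matrix (Fin n) (Fin d) ℝ) (B : Matrix (Fin n) (Fin d') ℝ)
    (S : Matrix (Fin t) (Fin n) ℝ) (i : Fin t) (j : Fin d) (k : Fin d') :
    dyad A B S i j k = columnForm A (scaledRow S i) j * columnForm B (scaledRow S i) k := by
  simp only [dyad, columnForm, mul_apply, vecMulVec_apply, transpose_apply, Finset.sum_mul]
  rw [Finset.sum_comm]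
  refine Finset.sum_congr rfl fun l _ => ?_
  rw [Finset.mul_sum]
  exact Finset.sum_congr rfl fun m _ => by ring

/-- The centring in the bootstrap statistic is the empirical mean of the dyads, since `AᵀSᵀSB =
(SA)ᵀ(SB)` and the factors `√t` of the two scaled rows cancel `1 / t`. This is what makes `empCov`
an empirical covariance. -/
lemma sketch_apply [NeZero t] (A : Matrix (Fin n) (Fin d) ℝ) (B : Matrix (Fin n) (Fin d') ℝ)
    (S : Matrix (Fin t) (Fin n) ℝ) (j : Fin d) (k : Fin d') :
    (Aᵀ * Sᵀ * S * B) j k = (1 / (t : ℝ)) * ∑ i, dyad A B S i j k := by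
  have ht : (0 : ℝ) < t := by exact_mod_cast Nat.pos_of_ne_zero (NeZero.ne t)
  have e : (Aᵀ * Sᵀ * S * B) = (S * A)ᵀ * (S * B) := by
    rw [transpose_mul, Matrix.mul_assoc (Aᵀ * Sᵀ)]
  rw [e, mul_apply, Finset.mul_sum]
  refine Finset.sum_congr rfl fun i _ => ?_
  have h : ∀ {m : ℕ} (M : Matrix (Fin n) (Fin m) ℝ) (j : Fin m),
      columnForm M (scaledRow S i) j = √(t : ℝ) * (S * M) i j := by
    intro m M j
    rw [columnForm, mul_apply, Finset.mul_sum]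
    exact Finset.sum_congr rfl fun l _ => by simp only [scaledRow]; ring
  rw [dyad_apply, h, h, transpose_apply]
  have := Real.mul_self_sqrt ht.le
  field_simp
  rw [Real.sq_sqrt ht.le]

/-- The empirical covariance matrix of the sketched dyads. -/
noncomputable def empCov (A : Matrix (Fin n) (Fin d) ℝ) (B : Matrix (Fin n) (Fin d') ℝ)
    (S : Matrix (Fin t) (Fin n) ℝ) : Matrix (Triple d d') (Triple d d') ℝ :=
  Matrix.of fun j k => (1 / (t : ℝ)) * ∑ i, signedEntry j (dyad A B S i - Aᵀ * Sᵀ * S * B) *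
    signedEntry k (dyad A B S i - Aᵀ * Sᵀ * S * B)

/-- The matrix that maps the multipliers to the Gaussian process of the bootstrap statistic. -/
noncomputable def bootMatrix (A : Matrix (Fin n) (Fin d) ℝ) (B : Matrix (Fin n) (Fin d') ℝ)
    (S : Matrix (Fin t) (Fin n) ℝ) : Matrix (Triple d d') (Fin t) ℝ :=
  Matrix.of fun j i => (1 / √(t : ℝ)) * signedEntry j (dyad A B S i - Aᵀ * Sᵀ * S * B)

lemma empCov_eq (A : Matrix (Fin n) (Fin d) ℝ) (B : Matrix (Fin n) (Fin d') ℝ)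
    (S : Matrix (Fin t) (Fin n) ℝ) : empCov A B S = bootMatrix A B S * (bootMatrix A B S)ᵀ := by
  ext j k
  simp only [empCov, bootMatrix, mul_apply, of_apply, transpose_apply, Finset.mul_sum]
  refine Finset.sum_congr rfl fun i _ => ?_
  have : (1 : ℝ) / t = (1 / √(t : ℝ)) * (1 / √(t : ℝ)) := by
    rw [div_mul_div_comm, one_mul, Real.mul_self_sqrt (Nat.cast_nonneg _)]
  rw [this]
  ring

lemma posSemidef_empCov (A : Matrix (Fin n) (Fin d) ℝ) (B : Matrix (Fin n) (Fin d') ℝ)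
    (S : Matrix (Fin t) (Fin n) ℝ) : (empCov A B S).PosSemidef := by
  rw [empCov_eq]
  simpa [conjTranspose_eq_transpose_of_trivial] using
    posSemidef_self_mul_conjTranspose (bootMatrix A B S)

lemma abs_signedEntry (j : Triple d d') (M : Matrix (Fin d) (Fin d') ℝ) :
    |signedEntry j M| = |M j.1 j.2.1| := by
  rcases Int.units_eq_one_or j.2.2 with h | h <;> simp [signedEntry, h]

/-- The sign in a triple replaces the absolute value by a maximum of linear forms, which is what a
Gaussian maximum requires. -/
lemma entryMax_eq_iSup [NeZero d] [NeZero d'] (M : Matrix (Fin d) (Fin d') ℝ) :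
    entryMax M = ⨆ j : Triple d d', signedEntry j M := by
  have bdd : BddAbove (Set.range fun p : Fin d × Fin d' => |M p.1 p.2|) :=
    (Set.finite_range _).bddAbove
  have bdd' : BddAbove (Set.range fun j : Triple d d' => signedEntry j M) :=
    (Set.finite_range _).bddAbove
  apply le_antisymm
  · refine ciSup_le fun p => ?_
    rcases abs_choice (M p.1 p.2) with h | h
    · rw [h]
      exact le_ciSup_of_le bdd' (p.1, p.2, 1) (by simp [signedEntry])
    · rw [h]
      exact le_ciSup_of_le bdd' (p.1, p.2, -1) (by simp [signedEntry])
  · refine ciSup_le fun j => (le_abs_self _).trans ?_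
    rw [abs_signedEntry]
    exact le_ciSup bdd (j.1, j.2.1)

lemma bootStat_eq_iSup [NeZero t] [NeZero d] [NeZero d'] (A : Matrix (Fin n) (Fin d) ℝ)
    (B : Matrix (Fin n) (Fin d') ℝ) (S : Matrix (Fin t) (Fin n) ℝ) (ξ : Fin t → ℝ) :
    bootStat A B S ξ = ⨆ j, (bootMatrix A B S *ᵥ ξ) j := by
  have ht : (0 : ℝ) < t := by exact_mod_cast Nat.pos_of_ne_zero (NeZero.ne t)
  rw [bootStat, entryMax_eq_iSup, Real.mul_iSup_of_nonneg (Real.sqrt_nonneg _)]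
  refine iSup_congr fun j => ?_
  simp only [signedEntry, mulVec, dotProduct, bootMatrix, of_apply, Matrix.smul_apply, smul_eq_mul,
    Matrix.sum_apply, Finset.mul_sum]
  refine Finset.sum_congr rfl fun i _ => ?_
  have : √(t : ℝ) * (1 / t) = 1 / √(t : ℝ) := by
    rw [mul_one_div, Real.sqrt_div_self']
  rw [← this]
  ring

lemma map_bootStat [NeZero t] [NeZero d] [NeZero d'] (A : Matrix (Fin n) (Fin d) ℝ)
    (B : Matrix (Fin n) (Fin d') ℝ) (S : Matrix (Fin t) (Fin n) ℝ) :
    (Measure.pi fun _ : Fin t => gaussianReal 0 1).map (bootStat A B S) =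
      gaussianMaxLaw (empCov A B S) := by
  have hmeas : Measurable fun ξ : Fin t → ℝ =>
      (WithLp.toLp 2 (bootMatrix A B S *ᵥ ξ) : EuclideanSpace ℝ (Triple d d')) := by
    have : Measurable fun ξ : Fin t → ℝ => bootMatrix A B S *ᵥ ξ := by
      refine measurable_pi_lambda _ fun i => ?_
      simp only [mulVec, dotProduct]
      fun_prop
    fun_prop
  rw [gaussianMaxLaw, empCov_eq, ← map_mulVec_pi_gaussianReal,
    Measure.map_map continuous_iSup_apply.measurable hmeas]
  congr 1
  funext ξ
  exact bootStat_eq_iSup A B S ξ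

lemma measurable_entry {m n : Type*} (i : m) (j : n) :
    Measurable fun M : Matrix m n ℝ => M i j :=
  (measurable_pi_apply (X := fun _ : n => ℝ) j).comp
    (measurable_pi_apply (X := fun _ : m => n → ℝ) i)

lemma measurable_scaledRow (i : Fin t) :
    Measurable fun S : Matrix (Fin t) (Fin n) ℝ => scaledRow S i :=
  measurable_pi_lambda _ fun l => (measurable_entry i l).const_mul _

lemma measurable_dyad (A : Matrix (Fin n) (Fin d) ℝ) (B : Matrix (Fin n) (Fin d') ℝ) (i : Fin t)
    (j : Fin d) (k : Fin d') :
    Measurable fun S : Matrix (Fin t) (Fin n) ℝ => dyad A B S i j k := by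
  simp only [dyad_apply, columnForm]
  have h := fun l => (measurable_pi_apply (X := fun _ : Fin n => ℝ) l).comp
    (measurable_scaledRow (n := n) i)
  exact (Finset.measurable_fun_sum _ fun l _ => (h l).const_mul _).mul
    (Finset.measurable_fun_sum _ fun l _ => (h l).const_mul _)

lemma measurable_bootStat [NeZero t] [NeZero d] [NeZero d'] (A : Matrix (Fin n) (Fin d) ℝ)
    (B : Matrix (Fin n) (Fin d') ℝ) :
    Measurable fun p : Matrix (Fin t) (Fin n) ℝ × (Fin t → ℝ) => bootStat A B p.1 p.2 := by
  simp only [bootStat_eq_iSup]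
  refine Measurable.iSup fun j => ?_
  simp only [mulVec, dotProduct, bootMatrix, of_apply, signedEntry, Matrix.sub_apply, sketch_apply]
  refine Finset.measurable_fun_sum _ fun i _ => ?_
  have h : ∀ i, Measurable fun p : Matrix (Fin t) (Fin n) ℝ × (Fin t → ℝ) =>
      dyad A B p.1 i j.1 j.2.1 := fun i => (measurable_dyad A B i j.1 j.2.1).comp measurable_fst
  have h' : Measurable fun p : Matrix (Fin t) (Fin n) ℝ × (Fin t → ℝ) => p.2 i :=
    (measurable_pi_apply i).comp measurable_snd
  exact ((((h i).sub ((Finset.measurable_fun_sum _ fun i _ => h i).const_mul _)).const_mul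
    _).const_mul _).mul h'

lemma measurable_bootStat_right [NeZero t] [NeZero d] [NeZero d'] (A : Matrix (Fin n) (Fin d) ℝ)
    (B : Matrix (Fin n) (Fin d') ℝ) (S : Matrix (Fin t) (Fin n) ℝ) :
    Measurable (bootStat A B S) := by
  have e : bootStat A B S = fun ξ => ⨆ j, (bootMatrix A B S *ᵥ ξ) j :=
    funext fun ξ => bootStat_eq_iSup A B S ξ
  rw [e]
  refine Measurable.iSup fun j => ?_
  simp only [mulVec, dotProduct]
  fun_prop

/-- The conditional law of the bootstrap statistic is the law of a Gaussian maximum with the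
empirical covariance matrix. -/
theorem condLawBoot_ae_eq {Ω : Type*} [MeasurableSpace Ω] {P : Measure Ω} [IsProbabilityMeasure P]
    [NeZero t] [NeZero d] [NeZero d'] (A : Matrix (Fin n) (Fin d) ℝ)
    (B : Matrix (Fin n) (Fin d') ℝ) {S : Ω → Matrix (Fin t) (Fin n) ℝ} {ξ : Ω → Fin t → ℝ}
    (hS : Measurable S) (hξ : IsGaussianMultiplier P S ξ) :
    ∀ᵐ ω ∂P, condLawBoot P A B S ξ ω = gaussianMaxLaw (empCov A B (S ω)) := by
  set γ := Measure.pi fun _ : Fin t => gaussianReal 0 1 with hγ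
  have hlaw : P.map ξ = γ := by
    have := hξ.iIndep.map_fun_eq_pi_map
      (fun i => ((measurable_pi_apply i).comp hξ.measurable).aemeasurable)
    exact this.trans (congrArg Measure.pi (funext fun i => hξ.law i))
  -- The candidate for the conditional law freezes the sketch and averages over fresh multipliers.
  -- By independence it disintegrates the joint law, and regular conditional distributions are
  -- almost surely unique.
  let κ : Kernel (Matrix (Fin t) (Fin n) ℝ) ℝ :=
    (Kernel.id ×ₖ Kernel.const _ γ).map (fun p => bootStat A B p.1 p.2)
  have hκ : ∀ s, κ s = γ.map (bootStat A B s) := by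
    intro s
    rw [Kernel.map_apply _ (measurable_bootStat A B), Kernel.prod_apply, Kernel.id_apply,
      Kernel.const_apply, Measure.dirac_prod, Measure.map_map (measurable_bootStat A B) (by fun_prop)]
    rfl
  have hκm : IsMarkovKernel κ := Kernel.IsMarkovKernel.map _ (measurable_bootStat A B)
  have hprod : P.map (fun ω => (S ω, ξ ω)) = (P.map S).prod γ := by
    rw [← hlaw]
    exact (indepFun_iff_map_prod_eq_prod_map_map hS.aemeasurable hξ.measurable.aemeasurable).1
      hξ.indep.symm
  have hpair : Measurable fun p : Matrix (Fin t) (Fin n) ℝ × (Fin t → ℝ) =>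
      (p.1, bootStat A B p.1 p.2) := measurable_fst.prodMk (measurable_bootStat A B)
  have hprob : IsProbabilityMeasure (P.map S) := Measure.isProbabilityMeasure_map hS.aemeasurable
  have hjoint : P.map (fun ω => (S ω, bootStat A B (S ω) (ξ ω))) = (P.map S) ⊗ₘ κ := by
    have : (fun ω => (S ω, bootStat A B (S ω) (ξ ω))) =
        (fun p : Matrix (Fin t) (Fin n) ℝ × (Fin t → ℝ) => (p.1, bootStat A B p.1 p.2)) ∘
          fun ω => (S ω, ξ ω) := rfl
    rw [this, ← Measure.map_map hpair (hS.prodMk hξ.measurable), hprod]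
    ext U hU
    rw [Measure.map_apply hpair hU, Measure.compProd_apply hU, Measure.prod_apply (hpair hU)]
    refine lintegral_congr fun s => ?_
    rw [hκ, Measure.map_apply (measurable_bootStat_right A B s) (measurable_prodMk_left hU)]
    rfl
  have h := condDistrib_ae_eq_of_measure_eq_compProd (μ := P)
    (Y := fun ω => bootStat A B (S ω) (ξ ω)) S
    ((measurable_bootStat A B).comp (hS.prodMk hξ.measurable)).aemeasurable hjoint
  filter_upwards [ae_of_ae_map hS.aemeasurable h] with ω hω
  rw [condLawBoot, hω, hκ, map_bootStat]

lemma empCov_apply [NeZero t] (A : Matrix (Fin n) (Fin d) ℝ) (B : Matrix (Fin n) (Fin d') ℝ)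
    (S : Matrix (Fin t) (Fin n) ℝ) (j k : Triple d d') :
    empCov A B S j k = ((j.2.2 : ℤ) : ℝ) * ((k.2.2 : ℤ) : ℝ) *
      ((1 / (t : ℝ)) * ∑ i, dyad A B S i j.1 j.2.1 * dyad A B S i k.1 k.2.1 -
        ((1 / (t : ℝ)) * ∑ i, dyad A B S i j.1 j.2.1) *
        ((1 / (t : ℝ)) * ∑ i, dyad A B S i k.1 k.2.1)) := by
  have ht : (0 : ℝ) < t := by exact_mod_cast Nat.pos_of_ne_zero (NeZero.ne t)
  simp only [empCov, of_apply, signedEntry, Matrix.sub_apply, sketch_apply]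
  generalize ha : ∑ i, dyad A B S i j.1 j.2.1 = a
  generalize hb : ∑ i, dyad A B S i k.1 k.2.1 = b
  have : ∀ i : Fin t, ((j.2.2 : ℤ) : ℝ) * (dyad A B S i j.1 j.2.1 - 1 / (t : ℝ) * a) *
      (((k.2.2 : ℤ) : ℝ) * (dyad A B S i k.1 k.2.1 - 1 / (t : ℝ) * b)) =
      ((j.2.2 : ℤ) : ℝ) * ((k.2.2 : ℤ) : ℝ) * (dyad A B S i j.1 j.2.1 * dyad A B S i k.1 k.2.1 -
        1 / (t : ℝ) * b * dyad A B S i j.1 j.2.1 - 1 / (t : ℝ) * a * dyad A B S i k.1 k.2.1 +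
        1 / (t : ℝ) * a * (1 / (t : ℝ) * b)) := fun i => by ring
  simp_rw [this]
  rw [← Finset.mul_sum, Finset.sum_add_distrib, Finset.sum_sub_distrib, Finset.sum_sub_distrib,
    ← Finset.mul_sum, ← Finset.mul_sum, ha, hb]
  simp only [Finset.sum_const, Finset.card_univ, Fintype.card_fin, nsmul_eq_mul]
  field_simp
  ring

variable {Ω : Type*} [MeasurableSpace Ω] {P : Measure Ω}

lemma dyadCov_apply [NeZero t] (A : Matrix (Fin n) (Fin d) ℝ) (B : Matrix (Fin n) (Fin d') ℝ)
    (S : Ω → Matrix (Fin t) (Fin n) ℝ) (j k : Triple d d') :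
    dyadCov P A B S j k = ((j.2.2 : ℤ) : ℝ) * ((k.2.2 : ℤ) : ℝ) *
      cov[fun ω => dyad A B (S ω) 0 j.1 j.2.1, fun ω => dyad A B (S ω) 0 k.1 k.2.1; P] := by
  simp only [dyadCov, of_apply, signedEntry]
  rw [covariance_const_mul_left, covariance_const_mul_right, mul_assoc]

/-- The quadratic form at `x` is the variance of the linear combination with coefficients `x`. -/
lemma posSemidef_covariance [IsProbabilityMeasure P] {ι : Type*} [Fintype ι] {f : ι → Ω → ℝ}
    (hf : ∀ j, MemLp (f j) 2 P) : (Matrix.of fun j k => cov[f j, f k; P]).PosSemidef := by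
  refine PosSemidef.of_dotProduct_mulVec_nonneg (by ext j k; simp [covariance_comm]) fun x => ?_
  have h := covariance_fun_sum_fun_sum (X := fun j ω => x j * f j ω) (Y := fun j ω => x j * f j ω)
    (fun j => (hf j).const_mul _) (fun j => (hf j).const_mul _)
  rw [covariance_self (by
    exact (Finset.aemeasurable_fun_sum _ fun j _ => ((hf j).const_mul (x j)).aemeasurable))] at h
  have e : star x ⬝ᵥ (Matrix.of fun j k => cov[f j, f k; P]) *ᵥ x =
      ∑ i, ∑ j, cov[fun ω => x i * f i ω, fun ω => x j * f j ω; P] := by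
    simp only [dotProduct, mulVec, star_trivial, of_apply, covariance_const_mul_left,
      covariance_const_mul_right, Finset.mul_sum]
    exact Finset.sum_congr rfl fun i _ => Finset.sum_congr rfl fun j _ => by ring
  rw [e, ← h]
  exact variance_nonneg _ _

lemma posSemidef_dyadCov [IsProbabilityMeasure P] [NeZero t] (A : Matrix (Fin n) (Fin d) ℝ)
    (B : Matrix (Fin n) (Fin d') ℝ) (S : Ω → Matrix (Fin t) (Fin n) ℝ)
    (h : ∀ j k, MemLp (fun ω => dyad A B (S ω) 0 j k) 2 P) : (dyadCov P A B S).PosSemidef :=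
  posSemidef_covariance (f := fun j ω => signedEntry j (dyad A B (S ω) 0))
    fun j => (h j.1 j.2.1).const_mul _

end BootstrapLaw

/-! ### Truncation and Bernstein's inequality for empirical second moments. -/

section Concentration

variable {Ω : Type*} [MeasurableSpace Ω] {P : Measure Ω} [IsProbabilityMeasure P]

/-- The centred variable is bounded by `2 * R`, so in the allowed range of `l` the inequality `exp x
≤ 1 + x + x ^ 2` for `|x| ≤ 1` applies pointwise; the linear term integrates to zero. -/
lemma mgf_sub_integral_le {Y : Ω → ℝ} (hY : Measurable Y) {R σ : ℝ}
    (hb : ∀ ω, |Y ω| ≤ R) (hσ : ∫ ω, Y ω ^ 2 ∂P ≤ σ) {l : ℝ} (hl : |l| * (2 * R) ≤ 1) :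
    mgf (fun ω => Y ω - ∫ ω, Y ω ∂P) P l ≤ Real.exp (l ^ 2 * σ) := by
  have hbm : |∫ ω, Y ω ∂P| ≤ R := by
    have := norm_integral_le_of_norm_le_const (μ := P) (f := Y) (.of_forall hb)
    simpa using this
  have iY : Integrable Y P := Integrable.of_bound hY.aestronglyMeasurable R (.of_forall hb)
  have iY2 : Integrable (fun ω => Y ω ^ 2) P :=
    Integrable.of_bound (hY.pow_const 2).aestronglyMeasurable (R ^ 2) (.of_forall fun ω => by
      rw [Real.norm_eq_abs, abs_pow]; exact pow_le_pow_left₀ (abs_nonneg _) (hb ω) 2)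
  set μ := ∫ ω, Y ω ∂P with hμ
  have iX : Integrable (fun ω => Y ω - μ) P := iY.sub (integrable_const _)
  have iX2 : Integrable (fun ω => (Y ω - μ) ^ 2) P := by
    have : (fun ω => (Y ω - μ) ^ 2) = fun ω => Y ω ^ 2 - 2 * μ * Y ω + μ ^ 2 := by
      funext ω; ring
    rw [this]
    exact (iY2.sub (iY.const_mul _)).add (integrable_const _)
  have hpt : ∀ ω, Real.exp (l * (Y ω - μ)) ≤ 1 + l * (Y ω - μ) + l ^ 2 * (Y ω - μ) ^ 2 := by
    intro ω
    have h1 : |l * (Y ω - μ)| ≤ 1 := by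
      rw [abs_mul]
      refine le_trans (mul_le_mul_of_nonneg_left ?_ (abs_nonneg _)) hl
      exact (abs_sub _ _).trans (by linarith [hb ω])
    have := (abs_le.1 (Real.abs_exp_sub_one_sub_id_le h1)).2
    nlinarith
  have hint : ∫ ω, (1 + l * (Y ω - μ) + l ^ 2 * (Y ω - μ) ^ 2) ∂P = 1 + l ^ 2 * Var[Y; P] := by
    have i1 : Integrable (fun ω => 1 + l * (Y ω - μ)) P :=
      (integrable_const _).add (iX.const_mul _)
    rw [integral_add i1 (iX2.const_mul _), integral_add (integrable_const _) (iX.const_mul _),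
      integral_const_mul, integral_const_mul, integral_sub iY (integrable_const _),
      variance_eq_integral hY.aemeasurable]
    simp [← hμ]
  have hvar : Var[Y; P] ≤ σ := (variance_le_expectation_sq hY.aestronglyMeasurable).trans hσ
  calc mgf (fun ω => Y ω - μ) P l ≤ ∫ ω, (1 + l * (Y ω - μ) + l ^ 2 * (Y ω - μ) ^ 2) ∂P := by
        refine integral_mono_of_nonneg (.of_forall fun ω => (Real.exp_pos _).le) ?_
          (.of_forall hpt)
        exact ((integrable_const _).add (iX.const_mul _)).add (iX2.const_mul _)
    _ = 1 + l ^ 2 * Var[Y; P] := hint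
    _ ≤ l ^ 2 * σ + 1 := by nlinarith [sq_nonneg l]
    _ ≤ _ := Real.add_one_le_exp _

/-- Bernstein's inequality at the largest admissible exponential scale. -/
lemma measure_le_abs_sum_sub_integral_le {t : ℕ} {Y : Fin t → Ω → ℝ} (hY : ∀ i, Measurable (Y i))
    (hind : iIndepFun Y P) {R σ u : ℝ} (hR : 0 < R) (hb : ∀ i ω, |Y i ω| ≤ R)
    (hσ : ∀ i, ∫ ω, Y i ω ^ 2 ∂P ≤ σ) :
    P {ω | u ≤ |∑ i, (Y i ω - ∫ ω, Y i ω ∂P)|} ≤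
      ENNReal.ofReal (2 * Real.exp (-(u / (2 * R)) + t * σ / (4 * R ^ 2))) := by
  let X : Fin t → Ω → ℝ := fun i ω => Y i ω - ∫ ω, Y i ω ∂P
  have hX : ∀ i, Measurable (X i) := fun i => (hY i).sub_const _
  have hXind : iIndepFun X P :=
    hind.comp (fun i y => y - ∫ ω, Y i ω ∂P) fun i => measurable_id.sub_const _
  have hl : |1 / (2 * R)| * (2 * R) ≤ 1 := by
    rw [abs_of_pos (by positivity)]
    exact (div_mul_cancel₀ 1 (by positivity)).le
  have hl2 : |-(1 / (2 * R))| * (2 * R) ≤ 1 := by rwa [abs_neg]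
  have hXb : ∀ i ω, |X i ω| ≤ 2 * R := fun i ω => by
    have := norm_integral_le_of_norm_le_const (μ := P) (f := Y i) (.of_forall (hb i))
    have h2 : |∫ ω, Y i ω ∂P| ≤ R := by simpa using this
    exact (abs_sub _ _).trans (by linarith [hb i ω])
  have hm : ∀ l : ℝ, |l| * (2 * R) ≤ 1 → mgf (∑ i, X i) P l ≤ Real.exp (l ^ 2 * (t * σ)) := by
    intro l hl
    rw [hXind.mgf_sum hX]
    calc ∏ i, mgf (X i) P l ≤ ∏ _i : Fin t, Real.exp (l ^ 2 * σ) :=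
          Finset.prod_le_prod (fun i _ => mgf_nonneg) fun i _ =>
            mgf_sub_integral_le (hY i) (hb i) (hσ i) hl
      _ = _ := by
          rw [Finset.prod_const, Finset.card_univ, Fintype.card_fin, ← Real.exp_nat_mul]
          congr 1; ring
  have hint : ∀ l : ℝ, Integrable (fun ω => Real.exp (l * (∑ i, X i) ω)) P := by
    intro l
    refine Integrable.of_bound (C := Real.exp (|l| * (t * (2 * R)))) ?_ (.of_forall fun ω => ?_)
    · have : Measurable fun ω => (∑ i, X i) ω := by
        simp only [Finset.sum_apply]
        exact Finset.measurable_sum _ fun i _ => hX i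
      exact (this.const_mul l).exp.aestronglyMeasurable
    · rw [Real.norm_eq_abs, abs_of_pos (Real.exp_pos _), Real.exp_le_exp]
      refine (le_abs_self _).trans ?_
      rw [abs_mul, Finset.sum_apply]
      refine mul_le_mul_of_nonneg_left ((Finset.abs_sum_le_sum_abs _ _).trans
        ((Finset.sum_le_sum fun i _ => hXb i ω).trans ?_)) (abs_nonneg _)
      simp
  have e1 := measure_ge_le_exp_mul_mgf (μ := P) (X := ∑ i, X i) u
    (by positivity : 0 ≤ 1 / (2 * R)) (hint _)
  have e2 := measure_le_le_exp_mul_mgf (μ := P) (X := ∑ i, X i) (-u)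
    (by rw [neg_nonpos]; positivity : -(1 / (2 * R)) ≤ 0) (hint _)
  have s1 : ∀ l : ℝ, l ^ 2 = (1 / (2 * R)) ^ 2 → |l| * (2 * R) ≤ 1 →
      Real.exp (-(1 / (2 * R)) * u) * mgf (∑ i, X i) P l ≤
      Real.exp (-(u / (2 * R)) + t * σ / (4 * R ^ 2)) := by
    intro l hl hl'
    rw [Real.exp_add]
    refine mul_le_mul (le_of_eq ?_) ((hm l hl').trans (le_of_eq ?_)) mgf_nonneg (Real.exp_pos _).le
    · congr 1; ring
    · rw [hl]; congr 1; field_simp; ring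
  have f1 := e1.trans (s1 _ rfl hl)
  have f2 : P.real {ω | (∑ i, X i) ω ≤ -u} ≤ _ :=
    (e2.trans (le_of_eq (by ring_nf))).trans (s1 (-(1 / (2 * R))) (by ring) hl2)
  have sub : {ω | u ≤ |∑ i, (Y i ω - ∫ ω, Y i ω ∂P)|} ⊆
      {ω | u ≤ (∑ i, X i) ω} ∪ {ω | (∑ i, X i) ω ≤ -u} := by
    intro ω hω
    have hω' : u ≤ |(∑ i, X i) ω| := by rw [Finset.sum_apply]; exact hω
    rcases le_abs.1 hω' with h | h
    · exact Or.inl h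
    · exact Or.inr (show (∑ i, X i) ω ≤ -u by linarith)
  refine (measure_mono sub).trans ((measure_union_le _ _).trans ?_)
  rw [← ofReal_measureReal, ← ofReal_measureReal (s := {ω | (∑ i, X i) ω ≤ -u}),
    ← ENNReal.ofReal_add (by positivity) (by positivity)]
  exact ENNReal.ofReal_le_ofReal (by linarith)

/-- Truncation at level `T`. -/
def clip (T x : ℝ) : ℝ := max (-T) (min x T)

lemma abs_clip_le {T : ℝ} (hT : 0 ≤ T) (x : ℝ) : |clip T x| ≤ T := by
  rw [clip, abs_le]
  exact ⟨le_max_left _ _, max_le (by linarith) (min_le_right _ _)⟩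

lemma clip_of_abs_le {T x : ℝ} (h : |x| ≤ T) : clip T x = x := by
  rw [clip, min_eq_left (abs_le.1 h).2, max_eq_right (abs_le.1 h).1]

/-- Clipping is multiplication by a factor in `[0, 1]`, so clipped products never exceed the
original ones in absolute value. -/
lemma exists_clip_eq {T : ℝ} (hT : 0 < T) (x : ℝ) : ∃ c ∈ Set.Icc (0 : ℝ) 1, clip T x = c * x := by
  rcases le_or_gt |x| T with h | h
  · exact ⟨1, by simp, by rw [clip_of_abs_le h, one_mul]⟩
  · have hx : 0 < |x| := hT.trans h
    refine ⟨T / |x|, ⟨by positivity, (div_le_one hx).2 h.le⟩, ?_⟩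
    rcases abs_cases x with ⟨h1, h2⟩ | ⟨h1, h2⟩
    · rw [h1] at h hx ⊢
      rw [clip, min_eq_right h.le, max_eq_right (by linarith), div_mul_cancel₀ _ hx.ne']
    · rw [h1] at h hx ⊢
      rw [clip, min_eq_left (by linarith), max_eq_left (by linarith), div_mul_eq_mul_div, eq_div_iff hx.ne']
      ring

/-- The left side vanishes unless one of the factors exceeds `T`, and then `T ^ 2 ≤ x ^ 2 + y ^ 2`,
which trades the second-order product for fourth powers. This makes the truncation bias of order `T
^ (-2)`. -/
lemma abs_mul_sub_clip_mul_clip_le {T : ℝ} (hT : 0 < T) (x y : ℝ) :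
    |x * y - clip T x * clip T y| ≤ (x ^ 4 + y ^ 4) / T ^ 2 := by
  by_cases h : |x| ≤ T ∧ |y| ≤ T
  · rw [clip_of_abs_le h.1, clip_of_abs_le h.2, sub_self, abs_zero]
    positivity
  obtain ⟨a, ha, hxa⟩ := exists_clip_eq hT x
  obtain ⟨b, hb, hyb⟩ := exists_clip_eq hT y
  have h1 : |x * y - clip T x * clip T y| ≤ |x * y| := by
    rw [hxa, hyb, show x * y - a * x * (b * y) = (1 - a * b) * (x * y) by ring, abs_mul]
    refine mul_le_of_le_one_left (abs_nonneg _) ?_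
    have : a * b ≤ 1 := mul_le_one₀ ha.2 hb.1 hb.2
    rw [abs_of_nonneg (by linarith)]
    linarith [mul_nonneg ha.1 hb.1]
  refine h1.trans ?_
  rw [le_div_iff₀ (by positivity)]
  have h2 : T ^ 2 ≤ x ^ 2 + y ^ 2 := by
    rw [not_and_or] at h
    rcases h with h | h
    · have : T ^ 2 ≤ x ^ 2 := by
        rw [← sq_abs x]; exact pow_le_pow_left₀ hT.le (not_le.1 h).le 2
      nlinarith [sq_nonneg y]
    · have : T ^ 2 ≤ y ^ 2 := by
        rw [← sq_abs y]; exact pow_le_pow_left₀ hT.le (not_le.1 h).le 2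
      nlinarith [sq_nonneg x]
  have h3 : |x * y| ≤ (x ^ 2 + y ^ 2) / 2 := by
    rw [abs_le]; constructor <;> nlinarith [sq_nonneg (x + y), sq_nonneg (x - y)]
  calc |x * y| * T ^ 2 ≤ (x ^ 2 + y ^ 2) / 2 * (x ^ 2 + y ^ 2) :=
        mul_le_mul h3 h2 (by positivity) (by positivity)
    _ ≤ _ := by nlinarith [sq_nonneg (x ^ 2 - y ^ 2)]

lemma measurable_clip (T : ℝ) : Measurable (clip T) :=
  measurable_const.max (measurable_id.min measurable_const)

/-- Uniform concentration of the empirical second moments of independent vectors. -/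
theorem measure_exists_lt_abs_sum_mul_sub_le {t : ℕ} (ht : 0 < t) {J : Type*} [Fintype J]
    {V : Fin t → J → Ω → ℝ} (hV : ∀ i j, Measurable (V i j))
    (hind : iIndepFun (fun i ω j => V i j ω) P) {m : J → J → ℝ}
    (hm : ∀ i j k, ∫ ω, V i j ω * V i k ω ∂P = m j k) {M T u : ℝ} {q : ℕ} (hT : 0 < T)
    (i4 : ∀ i j, Integrable (fun ω => V i j ω ^ 4) P)
    (h4 : ∀ i j, ∫ ω, V i j ω ^ 4 ∂P ≤ M)
    (iq : ∀ i j, Integrable (fun ω => |V i j ω| ^ q) P)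
    (hq : ∀ i j, ∫ ω, |V i j ω| ^ q ∂P ≤ M) :
    P {ω | ∃ j k, u + t * (2 * M / T ^ 2) < |∑ i, (V i j ω * V i k ω - m j k)|} ≤
      ENNReal.ofReal (t * Fintype.card J * (M / T ^ q) +
        2 * Fintype.card J ^ 2 * Real.exp (-(u / (2 * T ^ 2)) + t * M / (4 * T ^ 4))) := by
  -- The truncated products are bounded by `T ^ 2` and have second moment at most `M`, as
  -- Bernstein's inequality requires. The fourth moments control their bias and the moments of order
  -- `q` the probability that truncation acts at all.
  let Y : J → J → Fin t → Ω → ℝ := fun j k i ω => clip T (V i j ω) * clip T (V i k ω)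
  have hYm : ∀ j k i, Measurable (Y j k i) := fun j k i =>
    ((measurable_clip T).comp (hV i j)).mul ((measurable_clip T).comp (hV i k))
  have hYind : ∀ j k, iIndepFun (Y j k) P := fun j k =>
    hind.comp (fun _ v => clip T (v j) * clip T (v k)) fun _ =>
      ((measurable_clip T).comp (measurable_pi_apply j)).mul
        ((measurable_clip T).comp (measurable_pi_apply k))
  have hYb : ∀ j k i ω, |Y j k i ω| ≤ T ^ 2 := fun j k i ω => by
    rw [abs_mul, sq]
    exact mul_le_mul (abs_clip_le hT.le _) (abs_clip_le hT.le _) (abs_nonneg _) hT.le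
  have iY : ∀ j k i, Integrable (Y j k i) P := fun j k i =>
    Integrable.of_bound (hYm j k i).aestronglyMeasurable (T ^ 2) (.of_forall (hYb j k i))
  have iVV : ∀ j k i, Integrable (fun ω => V i j ω * V i k ω) P := fun j k i => by
    refine Integrable.mono' (g := fun ω => 1 + (V i j ω ^ 4 + V i k ω ^ 4))
      ((integrable_const _).add ((i4 i j).add (i4 i k)))
      ((hV i j).mul (hV i k)).aestronglyMeasurable (.of_forall fun ω => ?_)
    rw [Real.norm_eq_abs, abs_le]
    constructor <;> nlinarith [sq_nonneg (V i j ω + V i k ω), sq_nonneg (V i j ω - V i k ω),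
      sq_nonneg (V i j ω ^ 2 - 1), sq_nonneg (V i k ω ^ 2 - 1)]
  have hYσ : ∀ j k i, ∫ ω, Y j k i ω ^ 2 ∂P ≤ M := fun j k i => by
    have hpt : ∀ ω, Y j k i ω ^ 2 ≤ (V i j ω ^ 4 + V i k ω ^ 4) / 2 := fun ω => by
      obtain ⟨a, ha, hxa⟩ := exists_clip_eq hT (V i j ω)
      obtain ⟨b, hb, hyb⟩ := exists_clip_eq hT (V i k ω)
      simp only [Y]
      rw [hxa, hyb]
      have hab : (a * b) ^ 2 ≤ 1 := pow_le_one₀ (mul_nonneg ha.1 hb.1) (mul_le_one₀ ha.2 hb.1 hb.2)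
      have : (a * V i j ω * (b * V i k ω)) ^ 2 = (a * b) ^ 2 * (V i j ω ^ 2 * V i k ω ^ 2) := by
        ring
      rw [this]
      refine (mul_le_of_le_one_left (by positivity) hab).trans ?_
      nlinarith [sq_nonneg (V i j ω ^ 2 - V i k ω ^ 2)]
    refine (integral_mono_of_nonneg (.of_forall fun ω => sq_nonneg _)
      (((i4 i j).add (i4 i k)).div_const 2) (.of_forall hpt)).trans ?_
    simp only [Pi.add_apply]
    rw [integral_div, integral_add (i4 i j) (i4 i k)]
    linarith [h4 i j, h4 i k]
  have hbias : ∀ j k i, |∫ ω, Y j k i ω ∂P - m j k| ≤ 2 * M / T ^ 2 := fun j k i => by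
    rw [← hm i j k, abs_sub_comm, ← integral_sub (iVV j k i) (iY j k i)]
    refine abs_integral_le_integral_abs.trans ((integral_mono_of_nonneg
      (.of_forall fun ω => abs_nonneg _) (((i4 i j).add (i4 i k)).div_const (T ^ 2))
      (.of_forall fun ω => abs_mul_sub_clip_mul_clip_le hT _ _)).trans ?_)
    simp only [Pi.add_apply]
    rw [integral_div, integral_add (i4 i j) (i4 i k)]
    gcongr
    linarith [h4 i j, h4 i k]
  have hlarge : ∀ i j, P {ω | T < |V i j ω|} ≤ ENNReal.ofReal (M / T ^ q) := fun i j => by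
    have h := mul_meas_ge_le_integral_of_nonneg (μ := P) (f := fun ω => |V i j ω| ^ q)
      (.of_forall fun ω => by positivity) (iq i j) (T ^ q)
    have h2 : P.real {ω | T ^ q ≤ |V i j ω| ^ q} ≤ M / T ^ q := by
      rw [le_div_iff₀ (by positivity), mul_comm]
      exact h.trans (hq i j)
    refine (measure_mono (t := {ω | T ^ q ≤ |V i j ω| ^ q}) fun ω hω => ?_).trans ?_
    · exact pow_le_pow_left₀ hT.le (le_of_lt hω) q
    · rw [← ofReal_measureReal]; exact ENNReal.ofReal_le_ofReal h2
  have hdev := fun j k => measure_le_abs_sum_sub_integral_le (u := u) (hYm j k) (hYind j k)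
    (by positivity : 0 < T ^ 2) (hYb j k) (hYσ j k)
  have sub : {ω | ∃ j k, u + t * (2 * M / T ^ 2) < |∑ i, (V i j ω * V i k ω - m j k)|} ⊆
      (⋃ p : Fin t × J, {ω | T < |V p.1 p.2 ω|}) ∪
      ⋃ p : J × J, {ω | u ≤ |∑ i, (Y p.1 p.2 i ω - ∫ ω, Y p.1 p.2 i ω ∂P)|} := by
    rintro ω ⟨j, k, hjk⟩
    by_contra hcon
    simp only [Set.mem_union, Set.mem_iUnion, Set.mem_ofPred_eq, not_or, not_exists, not_lt,
      not_le, Prod.forall] at hcon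
    obtain ⟨hc1, hc2⟩ := hcon
    have e : ∀ i, V i j ω * V i k ω - m j k = (Y j k i ω - ∫ ω, Y j k i ω ∂P) +
        (∫ ω, Y j k i ω ∂P - m j k) := fun i => by
      simp only [Y]
      rw [clip_of_abs_le (hc1 i j), clip_of_abs_le (hc1 i k)]
      ring
    simp_rw [e, Finset.sum_add_distrib] at hjk
    have h1 := abs_add_le (∑ i, (Y j k i ω - ∫ ω, Y j k i ω ∂P))
      (∑ i, (∫ ω, Y j k i ω ∂P - m j k))
    have h2 : |∑ i, (∫ ω, Y j k i ω ∂P - m j k)| ≤ t * (2 * M / T ^ 2) := by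
      refine (Finset.abs_sum_le_sum_abs _ _).trans ((Finset.sum_le_sum fun i _ =>
        hbias j k i).trans ?_)
      simp
    linarith [hc2 j k]
  have M0 : ∀ j : J, 0 ≤ M := fun j =>
    (integral_nonneg fun ω => by positivity : 0 ≤ ∫ ω, V ⟨0, ht⟩ j ω ^ 4 ∂P).trans (h4 ⟨0, ht⟩ j)
  -- Nonnegativity of `M` is read off from a fourth moment, which needs an index in `J`.
  rcases isEmpty_or_nonempty J with hJ | ⟨⟨j₀⟩⟩
  · have : {ω | ∃ j k, u + t * (2 * M / T ^ 2) < |∑ i, (V i j ω * V i k ω - m j k)|} = ∅ := by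
      ext ω; simp
    rw [this]; simp
  have M0 := M0 j₀
  refine (measure_mono sub).trans ((measure_union_le _ _).trans ?_)
  rw [ENNReal.ofReal_add (by positivity) (by positivity)]
  refine add_le_add ((measure_iUnion_fintype_le _ _).trans
    ((Finset.sum_le_sum fun p _ => hlarge p.1 p.2).trans ?_))
    ((measure_iUnion_fintype_le _ _).trans ((Finset.sum_le_sum fun p _ => hdev p.1 p.2).trans ?_))
  · rw [Finset.sum_const, Finset.card_univ, nsmul_eq_mul, ← ENNReal.ofReal_natCast,
      ← ENNReal.ofReal_mul (by positivity), Fintype.card_prod, Fintype.card_fin]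
    push_cast
    exact le_rfl
  · rw [Finset.sum_const, Finset.card_univ, nsmul_eq_mul, ← ENNReal.ofReal_natCast,
      ← ENNReal.ofReal_mul (by positivity), Fintype.card_prod]
    refine ENNReal.ofReal_le_ofReal (le_of_eq ?_)
    push_cast
    ring_nf

end Concentration

/-! ### Consequences of the growth condition. -/

section Growth

/-- With this lower bound, additive constants can be absorbed into multiples of `log d`. -/
lemma half_le_log {d : ℕ} (hd : 2 ≤ d) : 1 / 2 ≤ Real.log d := by
  have h := Real.log_two_gt_d9
  have : Real.log 2 ≤ Real.log d :=
    Real.log_le_log (by norm_num) (by exact_mod_cast hd)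
  linarith

variable {C κ : ℝ} {d d' t : ℕ}

lemma GrowthCondition.pos_right (h : GrowthCondition C κ d d' t) (hd : 2 ≤ d) : 0 < d' := by
  rcases Nat.eq_zero_or_pos d' with h0 | h0
  · have := h.d_le
    subst h0
    have hd' : (2 : ℝ) ≤ d := by exact_mod_cast hd
    simp only [Nat.cast_zero, mul_zero] at this
    linarith
  · exact h0

lemma GrowthCondition.le_rpow (h : GrowthCondition C κ d d' t) (hκ : 1 ≤ κ) :
    (d : ℝ) ≤ (max C 1 * t) ^ κ := by
  have h1 : (d : ℝ) ^ (1 / κ) ≤ max C 1 * t :=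
    h.le_t.trans (mul_le_mul_of_nonneg_right (le_max_left _ _) (Nat.cast_nonneg _))
  have h2 := Real.rpow_le_rpow (by positivity) h1 (by linarith : 0 ≤ κ)
  rwa [← Real.rpow_mul (Nat.cast_nonneg _), one_div, inv_mul_cancel₀ (by linarith),
    Real.rpow_one] at h2

/-- As `d` is polynomial in `t` and `log x ≤ 2 √x`, the concentration rate `log d / √t` stays
bounded; this is needed to linearise its square. -/
lemma GrowthCondition.log_le (h : GrowthCondition C κ d d' t) (hκ : 1 ≤ κ) (hd : 2 ≤ d)
    (ht : 0 < t) : Real.log d ≤ 2 * κ * √(max C 1) * √t := by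
  have hd' : (0 : ℝ) < d := by exact_mod_cast (by omega : 0 < d)
  have ht' : (0 : ℝ) < t := by exact_mod_cast ht
  have hx : 0 < max C 1 * (t : ℝ) := mul_pos (lt_max_of_lt_right one_pos) ht'
  have h1 := Real.log_le_log hd' (h.le_rpow hκ)
  rw [Real.log_rpow hx] at h1
  have h2 : Real.log (max C 1 * t) ≤ 2 * √(max C 1 * t) := by
    have := Real.log_le_sub_one_of_pos (Real.sqrt_pos.2 hx)
    rw [Real.log_sqrt hx.le] at this
    linarith
  rw [Real.sqrt_mul (by positivity)] at h2
  nlinarith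

lemma GrowthCondition.mul_le (h : GrowthCondition C κ d d' t) :
    (d : ℝ) * d' ≤ max C 1 * (d : ℝ) ^ 2 := by
  have : (d' : ℝ) ≤ max C 1 * d :=
    h.d'_le.trans (mul_le_mul_of_nonneg_right (le_max_left _ _) (Nat.cast_nonneg _))
  nlinarith [(Nat.cast_nonneg d : (0 : ℝ) ≤ d)]

lemma GrowthCondition.mul_add_one_le (h : GrowthCondition C κ d d' t) (hd : 2 ≤ d) :
    (d : ℝ) * d' + 1 ≤ 2 * max C 1 * (d : ℝ) ^ 2 := by
  have h1 := h.mul_le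
  have hd' : (2 : ℝ) ≤ d := by exact_mod_cast hd
  have h2 : 1 ≤ max C 1 := le_max_right _ _
  nlinarith [mul_le_mul h2 (by nlinarith : (1 : ℝ) ≤ (d : ℝ) ^ 2) zero_le_one (by positivity)]

/-- A union bound over pairs of columns costs a fixed power of `t`, which a moment of high enough
order can pay for. -/
lemma GrowthCondition.sq_le_pow (h : GrowthCondition C κ d d' t) (hκ : 1 ≤ κ) (ht : 0 < t) :
    (d : ℝ) ^ 2 ≤ (max C 1 * t) ^ ⌈2 * κ⌉₊ := by
  have ht' : (1 : ℝ) ≤ t := by exact_mod_cast ht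
  have hx : 1 ≤ max C 1 * (t : ℝ) := one_le_mul_of_one_le_of_one_le (le_max_right _ _) ht'
  calc (d : ℝ) ^ 2 ≤ ((max C 1 * t) ^ κ) ^ 2 := by
        gcongr; exact h.le_rpow hκ
    _ = (max C 1 * t) ^ (2 * κ) := by
        rw [← Real.rpow_natCast, ← Real.rpow_mul (by positivity)]
        congr 1; push_cast; ring
    _ ≤ (max C 1 * t) ^ ((⌈2 * κ⌉₊ : ℕ) : ℝ) :=
        Real.rpow_le_rpow_of_exponent_le hx (Nat.le_ceil _)
    _ = _ := Real.rpow_natCast _ _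

lemma mul_pow_le_exp_mul_log {a : ℝ} (ha : 1 ≤ a) {d : ℕ} (hd : 2 ≤ d) (m : ℕ) :
    a * (d : ℝ) ^ m ≤ Real.exp ((m + 2 * Real.log a) * Real.log d) := by
  have hd' : (0 : ℝ) < d := by exact_mod_cast (by omega : 0 < d)
  rw [add_mul, Real.exp_add, mul_comm a]
  have e : Real.exp (m * Real.log d) = (d : ℝ) ^ m := by
    rw [← Real.log_pow, Real.exp_log (by positivity)]
  rw [e]
  gcongr
  rw [← Real.log_le_iff_le_exp (by linarith)]
  nlinarith [half_le_log hd, Real.log_nonneg ha]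

lemma GrowthCondition.log_card_triple_le (h : GrowthCondition C κ d d' t) (hd : 2 ≤ d) :
    Real.log (Fintype.card (Triple d d')) + 1 ≤
      (4 + 2 * Real.log (2 * max C 1)) * Real.log d := by
  have hd0 : (0 : ℝ) < d := by exact_mod_cast (by omega : 0 < d)
  have hd'0 : (0 : ℝ) < d' := by exact_mod_cast h.pos_right hd
  have hC : 1 ≤ max C 1 := le_max_right _ _
  have hcard : (Fintype.card (Triple d d') : ℝ) = d * d' * 2 := by
    simp [Triple]
    ring
  have h1 : (Fintype.card (Triple d d') : ℝ) ≤ (2 * max C 1) * (d : ℝ) ^ 2 := by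
    rw [hcard]; linarith [h.mul_le]
  have h2 := Real.log_le_log (by rw [hcard]; positivity)
    (h1.trans (mul_pow_le_exp_mul_log (by linarith) hd 2))
  rw [Real.log_exp] at h2
  push_cast at h2
  nlinarith [half_le_log hd]

end Growth

/-! ### Concentration of the empirical covariance at rate `log d / √t`. -/

section CovarianceConcentration

lemma abs_pow_le_one_add_pow (x : ℝ) {p q : ℕ} (h : p ≤ q) : |x| ^ p ≤ 1 + |x| ^ q := by
  rcases le_or_gt |x| 1 with h1 | h1
  · exact (pow_le_one₀ (abs_nonneg _) h1).trans (by linarith [pow_nonneg (abs_nonneg x) q])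
  · exact (pow_le_pow_right₀ h1.le h).trans (by linarith)

/-- The order of the moments that control the empirical covariance matrix. -/
noncomputable def momentOrder (κ : ℝ) : ℕ := 4 * (⌈2 * κ⌉₊ + 2)

/-- The product of means is expanded around `a' * b'`. Everything is measured in units of `ν`, so
that the result scales as `ν ^ 2` and the bracket is a pure number. -/
lemma abs_covariance_sub_le {a b a' b' x x' e m ν : ℝ} (hx : |x - x'| ≤ ν ^ 2 * e)
    (ha : |a - a'| ≤ ν * e) (hb : |b - b'| ≤ ν * e) (ha' : |a'| ≤ ν * m) (hb' : |b'| ≤ ν * m) :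
    |(x - a * b) - (x' - a' * b')| ≤ ν ^ 2 * (e * (1 + 2 * m + e)) := by
  have e0 : 0 ≤ ν * e := (abs_nonneg _).trans ha
  have : (x - a * b) - (x' - a' * b') = (x - x') - (a - a') * (b - b') - (a - a') * b' -
      a' * (b - b') := by ring
  rw [this]
  have h1 : |(a - a') * (b - b')| ≤ ν * e * (ν * e) := by
    rw [abs_mul]; exact mul_le_mul ha hb (abs_nonneg _) e0
  have h2 : |(a - a') * b'| ≤ ν * e * (ν * m) := by
    rw [abs_mul]; exact mul_le_mul ha hb' (abs_nonneg _) e0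
  have h3 : |a' * (b - b')| ≤ ν * m * (ν * e) := by
    rw [abs_mul]; exact mul_le_mul ha' hb (abs_nonneg _) ((abs_nonneg _).trans ha')
  rw [abs_le] at *
  constructor <;> nlinarith [hx.1, hx.2, h1.1, h1.2, h2.1, h2.2, h3.1, h3.2]

lemma abs_intUnit_mul (a b : ℤˣ) (x : ℝ) : |((a : ℤ) : ℝ) * ((b : ℤ) : ℝ) * x| = |x| := by
  rcases Int.units_eq_one_or a with h | h <;> rcases Int.units_eq_one_or b with h' | h' <;>
    simp [h, h']

lemma abs_dyadCov_sub_empCov_le {t n d d' : ℕ} [NeZero t] {A : Matrix (Fin n) (Fin d) ℝ}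
    {B : Matrix (Fin n) (Fin d') ℝ} {Ω : Type*} [MeasurableSpace Ω] {P : Measure Ω}
    [IsProbabilityMeasure P] {S : Ω → Matrix (Fin t) (Fin n) ℝ} {ω : Ω} {ν e m : ℝ}
    (hL : ∀ p : Fin d × Fin d', MemLp (fun ω => dyad A B (S ω) 0 p.1 p.2) 2 P)
    (h2 : ∀ p q : Fin d × Fin d', |(1 / (t : ℝ)) * ∑ i, dyad A B (S ω) i p.1 p.2 *
      dyad A B (S ω) i q.1 q.2 - ∫ ω, dyad A B (S ω) 0 p.1 p.2 * dyad A B (S ω) 0 q.1 q.2 ∂P| ≤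
        ν ^ 2 * e)
    (h1 : ∀ p : Fin d × Fin d', |(1 / (t : ℝ)) * ∑ i, dyad A B (S ω) i p.1 p.2 -
      ∫ ω, dyad A B (S ω) 0 p.1 p.2 ∂P| ≤ ν * e)
    (h0 : ∀ p : Fin d × Fin d', |∫ ω, dyad A B (S ω) 0 p.1 p.2 ∂P| ≤ ν * m)
    (j l : Triple d d') :
    |dyadCov P A B S j l - empCov A B (S ω) j l| ≤ ν ^ 2 * (e * (1 + 2 * m + e)) := by
  rw [empCov_apply, dyadCov_apply, ← mul_sub, abs_intUnit_mul,
    covariance_eq_sub (hL (j.1, j.2.1)) (hL (l.1, l.2.1)), abs_sub_comm]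
  exact abs_covariance_sub_le (h2 (j.1, j.2.1) (l.1, l.2.1)) (h1 (j.1, j.2.1)) (h1 (l.1, l.2.1))
    (h0 (j.1, j.2.1)) (h0 (l.1, l.2.1))

/-- Uniform concentration of empirical second moments at the rate `log d / √t`. -/
theorem exists_measure_secondMoment_sub_le (C κ : ℝ) (hκ : 1 ≤ κ) {M : ℝ} (hM1 : 1 ≤ M) :
    ∃ c : ℝ, 0 < c ∧ ∀ (t d d' : ℕ), 0 < t → 2 ≤ d → GrowthCondition C κ d d' t →
      ∀ {Ω : Type*} [MeasurableSpace Ω] (P : Measure Ω) [IsProbabilityMeasure P]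
        (V : Fin t → Option (Fin d × Fin d') → Ω → ℝ) (m : _ → _ → ℝ),
        (∀ i o, Measurable (V i o)) → iIndepFun (fun i ω o => V i o ω) P →
        (∀ i o p, ∫ ω, V i o ω * V i p ω ∂P = m o p) →
        (∀ i o, Integrable (fun ω => V i o ω ^ 4) P) → (∀ i o, ∫ ω, V i o ω ^ 4 ∂P ≤ M) →
        (∀ i o, Integrable (fun ω => |V i o ω| ^ momentOrder κ) P) →
        (∀ i o, ∫ ω, |V i o ω| ^ momentOrder κ ∂P ≤ M) →
        P {ω | ¬ ∀ o p, |(1 / (t : ℝ)) * ∑ i, V i o ω * V i p ω - m o p| ≤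
          c * Real.log d / √t} ≤ ENNReal.ofReal (1 / t + 1 / (d * d')) := by
  set C₁ := max C 1 with hC₁
  have hC1 : 1 ≤ C₁ := le_max_right _ _
  set k := ⌈2 * κ⌉₊ with hk
  -- Chosen so that the union bound over all truncation events, where `d * d' + 1 ≤ 2 * C₁ * (C₁ *
  -- t) ^ k`, is at most `1 / t`.
  set K := 2 * C₁ ^ (k + 1) * M with hK
  have hCk : 1 ≤ C₁ ^ (k + 1) := one_le_pow₀ hC1
  have hKM : M ≤ K := by rw [hK]; nlinarith
  have hK1 : 1 ≤ K := hM1.trans hKM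
  -- The number `a * d ^ 6` dominates `2 * (d * d' + 1) ^ 2 * 3 * (d * d')`, where `3` replaces `exp
  -- 1`. The exponent `a₀` makes the Bernstein factor at most `3 / (a * d ^ 6)`.
  set a := 24 * C₁ ^ 3 with ha
  have ha1 : 1 ≤ a := by have : 1 ≤ C₁ ^ 3 := one_le_pow₀ hC1; linarith
  set a₀ := 6 + 2 * Real.log a with ha₀
  have ha0 : 0 < a₀ := by have := Real.log_nonneg ha1; linarith
  -- The first summand is the deviation; the second covers the truncation bias `2 * (M / K) ≤ 2`, by
  -- `log d ≥ 1 / 2`.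
  set U := 2 * K * a₀ + 4 with hU
  have hU0 : 0 < U := by positivity
  refine ⟨U, hU0, ?_⟩
  intro t d d' ht hd hg Ω _ P _ V m hV hVind hm i4 h4 iq hqb
  have ht' : (0 : ℝ) < t := by exact_mod_cast ht
  have hd0 : (0 : ℝ) < d := by exact_mod_cast (by omega : 0 < d)
  have hd'0 : (0 : ℝ) < d' := by exact_mod_cast hg.pos_right hd
  have hlog := half_le_log hd
  set q := momentOrder κ with hq
  -- With `T ^ 4` of order `t`, the truncation bias `M / T ^ 2` is of order `1 / √t`, the deviation
  -- `T ^ 2 * log d / t` is of order `log d / √t`, and the variance term in the exponent is at most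
  -- one.
  set T := √(K * √t) with hT
  have hKt : 0 < K * √(t : ℝ) := by positivity
  have hT0 : 0 < T := Real.sqrt_pos.2 hKt
  have hT2 : T ^ 2 = K * √t := Real.sq_sqrt hKt.le
  have hT4 : T ^ 4 = K ^ 2 * t := by
    rw [show T ^ 4 = (T ^ 2) ^ 2 by ring, hT2, mul_pow, Real.sq_sqrt ht'.le]
  -- The order of the moment is designed for this identity: `k` powers of `t` pay for the
  -- coordinates, one for the samples, and one is left for the probability `1 / t`.
  have hTq : T ^ q = (K ^ 2 * t) ^ (k + 2) := by
    rw [hq, momentOrder, pow_mul, hT4]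
  set u := 2 * T ^ 2 * (a₀ * Real.log d) with hu
  have key := measure_exists_lt_abs_sum_mul_sub_le ht hV hVind hm (u := u) hT0 i4 h4 iq hqb
  have hcard : (Fintype.card (Option (Fin d × Fin d')) : ℝ) = d * d' + 1 := by simp
  rw [hcard] at key
  have hJ := hg.mul_add_one_le hd
  rw [← hC₁] at hJ
  have prob1 : t * ((d : ℝ) * d' + 1) * (M / T ^ q) ≤ 1 / t := by
    rw [hTq, mul_div_assoc', div_le_div_iff₀ (by positivity) ht', one_mul]
    have hd2 := hg.sq_le_pow hκ ht
    rw [← hC₁, ← hk] at hd2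
    calc t * ((d : ℝ) * d' + 1) * M * t ≤ t * (2 * C₁ * (C₁ * t) ^ k) * M * t := by
          gcongr; exact hJ.trans (by gcongr)
      _ = K * (t : ℝ) ^ (k + 2) := by rw [hK, mul_pow]; ring
      _ ≤ (K ^ 2) ^ (k + 2) * (t : ℝ) ^ (k + 2) := by
          gcongr
          rw [← pow_mul]
          exact le_self_pow₀ hK1 (by omega)
      _ = _ := (mul_pow _ _ _).symm
  have prob2 : 2 * ((d : ℝ) * d' + 1) ^ 2 *
      Real.exp (-(u / (2 * T ^ 2)) + t * M / (4 * T ^ 4)) ≤ 1 / (d * d') := by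
    have h1 : u / (2 * T ^ 2) = a₀ * Real.log d := by rw [hu]; field_simp
    have h2 : t * M / (4 * T ^ 4) ≤ 1 := by
      rw [hT4, div_le_one (by positivity)]
      nlinarith [mul_le_mul hKM hK1 zero_le_one (by linarith)]
    have h3 := mul_pow_le_exp_mul_log ha1 hd 6
    have h4 : Real.exp (-(u / (2 * T ^ 2)) + t * M / (4 * T ^ 4)) ≤ 3 / (a * (d : ℝ) ^ 6) := by
      rw [h1]
      calc Real.exp (-(a₀ * Real.log d) + t * M / (4 * T ^ 4)) ≤
            Real.exp (1 + -(a₀ * Real.log d)) := Real.exp_le_exp.2 (by linarith)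
        _ = Real.exp 1 / Real.exp (a₀ * Real.log d) := by
            rw [Real.exp_add, Real.exp_neg, div_eq_mul_inv]
        _ ≤ 3 / (a * (d : ℝ) ^ 6) := by
            have := Real.exp_one_lt_d9
            refine div_le_div₀ (by norm_num) (by linarith) (by positivity) (h3.trans_eq ?_)
            rw [ha₀]; push_cast; rfl
    refine (mul_le_mul_of_nonneg_left h4 (by positivity)).trans ?_
    rw [mul_div_assoc', div_le_div_iff₀ (by positivity) (by positivity), one_mul]
    have h5 := hg.mul_le
    rw [← hC₁] at h5
    calc 2 * ((d : ℝ) * d' + 1) ^ 2 * 3 * (d * d') ≤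
          2 * (2 * C₁ * (d : ℝ) ^ 2) ^ 2 * 3 * (C₁ * (d : ℝ) ^ 2) := by gcongr
      _ = a * (d : ℝ) ^ 6 := by rw [ha]; ring
  refine (measure_mono ?_).trans (key.trans (ENNReal.ofReal_le_ofReal (add_le_add prob1 prob2)))
  intro ω hω
  by_contra hcon
  refine hω ?_
  simp only [Set.mem_ofPred_eq, not_exists, not_lt] at hcon
  intro o p
  have h1 := hcon o p
  have h2 : (1 / (t : ℝ)) * ∑ i, V i o ω * V i p ω - m o p =
      (1 / (t : ℝ)) * ∑ i, (V i o ω * V i p ω - m o p) := by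
    rw [Finset.sum_sub_distrib, mul_sub]
    simp only [Finset.sum_const, Finset.card_univ, Fintype.card_fin, nsmul_eq_mul]
    field_simp
  rw [h2, abs_mul, abs_of_pos (by positivity)]
  have hst : 0 < √(t : ℝ) := Real.sqrt_pos.2 ht'
  have hss : √(t : ℝ) * √t = t := Real.mul_self_sqrt ht'.le
  refine (mul_le_mul_of_nonneg_left h1 (by positivity)).trans ?_
  rw [hu, hT2, le_div_iff₀ hst]
  have h3 : 1 / (t : ℝ) * (2 * (K * √t) * (a₀ * Real.log d) + t * (2 * M / (K * √t))) * √t =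
      2 * K * a₀ * Real.log d + 2 * (M / K) := by
    rw [show 1 / (t : ℝ) * (2 * (K * √t) * (a₀ * Real.log d) + t * (2 * M / (K * √t))) * √t =
      1 / (t : ℝ) * ((√t * √t) * (2 * K * a₀ * Real.log d) + t * (2 * M / (K * √t) * √t)) by
        ring, hss]
    field_simp
  rw [h3]
  have : M / K ≤ 1 := (div_le_one (by linarith)).2 hKM
  rw [hU]
  nlinarith

/-- Uniform concentration of the empirical covariance matrix of the sketched dyads. -/
theorem exists_measure_empCov_sub_dyadCov_le (C κ : ℝ) (hκ : 1 ≤ κ) {M : ℝ} (hM : 0 ≤ M) :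
    ∃ c : ℝ, 0 < c ∧ ∀ (t n d d' : ℕ) [NeZero t], 2 ≤ d → GrowthCondition C κ d d' t →
      ∀ (A : Matrix (Fin n) (Fin d) ℝ) (B : Matrix (Fin n) (Fin d') ℝ) {Ω : Type*}
        [MeasurableSpace Ω] (P : Measure Ω) [IsProbabilityMeasure P]
        (S : Ω → Matrix (Fin t) (Fin n) ℝ), Measurable S → iIndepFun (fun i ω => S ω i) P →
        (∀ i, IdentDistrib (fun ω => S ω i) (fun ω => S ω 0) P P) →
        ∀ ν : ℝ, 0 < ν →
        (∀ j k, Integrable (fun ω => |dyad A B (S ω) 0 j k| ^ momentOrder κ) P) →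
        (∀ j k, ∫ ω, |dyad A B (S ω) 0 j k| ^ momentOrder κ ∂P ≤ M * ν ^ momentOrder κ) →
        P {ω | ¬ ∀ j k, |dyadCov P A B S j k - empCov A B (S ω) j k| ≤
          c * (ν ^ 2 * Real.log d / √t)} ≤ ENNReal.ofReal (1 / t + 1 / (d * d')) := by
  obtain ⟨U, hU0, hU⟩ := exists_measure_secondMoment_sub_le C κ hκ (M := 2 + M) (by linarith)
  set M' := 2 + M with hM'
  set E := 2 * κ * √(max C 1) with hE
  have hE0 : 0 < E := by positivity
  refine ⟨U * (1 + 2 * (1 + M') + U * E), by positivity, ?_⟩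
  intro t n d d' _ hd hg A B Ω _ P _ S hS hind hid ν hν hint hmom
  have ht : 0 < t := Nat.pos_of_ne_zero (NeZero.ne t)
  have ht' : (0 : ℝ) < t := by exact_mod_cast ht
  have hd0 : (0 : ℝ) < d := by exact_mod_cast (by omega : 0 < d)
  have hd'0 : (0 : ℝ) < d' := by exact_mod_cast hg.pos_right hd
  have hlog := half_le_log hd
  set q := momentOrder κ with hq
  -- The extra coordinate `none` is the constant one: products with it are first moments, so a
  -- single statement about second moments controls both parts of the covariance. Division by `ν`
  -- makes the moments of order one.
  let G : Option (Fin d × Fin d') → (Fin n → ℝ) → ℝ := fun o r =>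
    o.elim 1 fun p => ν⁻¹ * (columnForm A (fun l => √(t : ℝ) * r l) p.1 *
      columnForm B (fun l => √(t : ℝ) * r l) p.2)
  have hG : ∀ o, Measurable (G o) := by
    rintro (_ | p)
    · exact measurable_const
    · simp only [G, columnForm, Option.elim_some]
      fun_prop
  let V : Fin t → Option (Fin d × Fin d') → Ω → ℝ := fun i o ω => G o (S ω i)
  have hrow : ∀ i, Measurable fun ω => S ω i := fun i =>
    (measurable_pi_apply (X := fun _ : Fin t => Fin n → ℝ) i).comp hS
  have hV : ∀ i o, Measurable (V i o) := fun i o => (hG o).comp (hrow i)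
  have hVnone : ∀ i ω, V i none ω = 1 := fun i ω => rfl
  have hVsome : ∀ i p ω, V i (some p) ω = ν⁻¹ * dyad A B (S ω) i p.1 p.2 := fun i p ω => by
    rw [dyad_apply]; rfl
  have hVind : iIndepFun (fun i ω o => V i o ω) P :=
    hind.comp (fun _ r o => G o r) fun _ => measurable_pi_lambda _ hG
  have hVid : ∀ i o, IdentDistrib (V i o) (V 0 o) P P := fun i o => (hid i).comp (hG o)
  have iq : ∀ i o, Integrable (fun ω => |V i o ω| ^ q) P := by
    intro i o
    refine (((hVid i o).comp (measurable_norm.pow_const q)).integrable_iff).2 ?_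
    rcases o with _ | p
    · exact (integrable_const (1 : ℝ)).congr (.of_forall fun ω => by simp [hVnone])
    · refine ((hint p.1 p.2).const_mul (ν⁻¹ ^ q)).congr (.of_forall fun ω => ?_)
      simp only [Function.comp, hVsome, Real.norm_eq_abs, abs_mul, mul_pow,
        abs_of_pos (inv_pos.2 hν)]
  have hqb : ∀ i o, ∫ ω, |V i o ω| ^ q ∂P ≤ 1 + M := by
    intro i o
    have := ((hVid i o).comp (measurable_norm.pow_const q)).integral_eq
    refine (le_of_eq this).trans ?_
    rcases o with _ | p
    · simp [Function.comp, hVnone, hM]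
    · simp only [Function.comp, hVsome, Real.norm_eq_abs, abs_mul, mul_pow,
        abs_of_pos (inv_pos.2 hν)]
      rw [integral_const_mul]
      calc ν⁻¹ ^ q * _ ≤ ν⁻¹ ^ q * (M * ν ^ q) := by gcongr; exact hmom p.1 p.2
        _ = M * (ν⁻¹ * ν) ^ q := by rw [mul_pow]; ring
        _ = M := by rw [inv_mul_cancel₀ hν.ne', one_pow, mul_one]
        _ ≤ 1 + M := by linarith
  have ipow : ∀ i o, ∀ p ≤ q, Integrable (fun ω => |V i o ω| ^ p) P := fun i o p hp =>
    Integrable.mono' ((integrable_const 1).add (iq i o))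
      (((hV i o).norm.pow_const p).aestronglyMeasurable) (.of_forall fun ω => by
        rw [Real.norm_eq_abs, abs_of_nonneg (by positivity)]
        exact abs_pow_le_one_add_pow _ hp)
  have bpow : ∀ i o, ∀ p ≤ q, ∫ ω, |V i o ω| ^ p ∂P ≤ M' := fun i o p hp => by
    refine (integral_mono (ipow i o p hp) ((integrable_const 1).add (iq i o))
      fun ω => abs_pow_le_one_add_pow _ hp).trans ?_
    simp only [Pi.add_apply]
    rw [integral_add (integrable_const _) (iq i o)]
    have := hqb i o
    simp
    linarith
  have hq4 : 4 ≤ q := by rw [hq, momentOrder]; omega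
  have e4 : ∀ x : ℝ, |x| ^ 4 = x ^ 4 := fun x => Even.pow_abs (by decide) x
  have habs : ∀ i o, |∫ ω, V i o ω ∂P| ≤ M' := fun i o => by
    refine abs_integral_le_integral_abs.trans ?_
    simpa using bpow i o 1 (by omega)
  have key := hU t d d' ht hd hg P V (fun o p => ∫ ω, V 0 o ω * V 0 p ω ∂P) hV hVind
    (fun i o p => (((hid i).comp ((hG o).mul (hG p))).integral_eq))
    (fun i o => (ipow i o 4 hq4).congr (.of_forall fun ω => e4 _))
    (fun i o => (integral_congr_ae (.of_forall fun ω => (e4 _).symm)).trans_le (bpow i o 4 hq4))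
    iq (fun i o => (hqb i o).trans (by linarith))
  refine (measure_mono ?_).trans key
  intro ω hω hsum
  refine hω ?_
  set e := U * Real.log d / √t with he
  -- The covariance error is quadratic in `e`; boundedness of `e` makes it linear.
  have heE : e ≤ U * E := by
    have := hg.log_le hκ hd ht
    rw [he, div_le_iff₀ (Real.sqrt_pos.2 ht'), mul_assoc]
    exact mul_le_mul_of_nonneg_left this hU0.le
  have he0 : 0 ≤ e := by positivity
  have hD : ∀ i p ω, dyad A B (S ω) i p.1 p.2 = ν * V i (some p) ω := fun i p ω => by
    rw [hVsome]; field_simp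
  have i2 : ∀ p : Fin d × Fin d', MemLp (fun ω => dyad A B (S ω) 0 p.1 p.2) 2 P := fun p => by
    simp only [hD]
    refine MemLp.const_mul ?_ ν
    rw [memLp_two_iff_integrable_sq (hV 0 (some p)).aestronglyMeasurable]
    simpa only [sq_abs] using ipow 0 (some p) 2 (by omega)
  intro j l
  refine (abs_dyadCov_sub_empCov_le (e := e) (m := M') (ν := ν) i2 (fun p p' => ?_) (fun p => ?_)
    (fun p => ?_) j l).trans ?_
  · have e1 : (1 / (t : ℝ)) * ∑ i, dyad A B (S ω) i p.1 p.2 * dyad A B (S ω) i p'.1 p'.2 =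
        ν ^ 2 * ((1 / (t : ℝ)) * ∑ i, V i (some p) ω * V i (some p') ω) := by
      simp only [Finset.mul_sum]
      exact Finset.sum_congr rfl fun i _ => by rw [hD, hD]; ring
    have e2 : ∫ ω, dyad A B (S ω) 0 p.1 p.2 * dyad A B (S ω) 0 p'.1 p'.2 ∂P =
        ν ^ 2 * ∫ ω, V 0 (some p) ω * V 0 (some p') ω ∂P := by
      rw [← integral_const_mul]
      exact integral_congr_ae (.of_forall fun ω => by simp only [hD]; ring)
    rw [e1, e2, ← mul_sub, abs_mul, abs_of_nonneg (sq_nonneg ν)]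
    exact mul_le_mul_of_nonneg_left (hsum (some p) (some p')) (sq_nonneg ν)
  · have e1 : (1 / (t : ℝ)) * ∑ i, dyad A B (S ω) i p.1 p.2 =
        ν * ((1 / (t : ℝ)) * ∑ i, V i (some p) ω * V i none ω) := by
      simp only [Finset.mul_sum]
      exact Finset.sum_congr rfl fun i _ => by rw [hD, hVnone]; ring
    have e2 : ∫ ω, dyad A B (S ω) 0 p.1 p.2 ∂P =
        ν * ∫ ω, V 0 (some p) ω * V 0 none ω ∂P := by
      rw [← integral_const_mul]
      exact integral_congr_ae (.of_forall fun ω => by simp only [hD, hVnone]; ring)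
    rw [e1, e2, ← mul_sub, abs_mul, abs_of_nonneg hν.le]
    exact mul_le_mul_of_nonneg_left (hsum (some p) none) hν.le
  · simp only [hD]
    rw [integral_const_mul, abs_mul, abs_of_pos hν]
    exact mul_le_mul_of_nonneg_left (habs 0 _) hν.le
  · calc ν ^ 2 * (e * (1 + 2 * M' + e)) ≤ ν ^ 2 * (e * (1 + 2 * (1 + M') + U * E)) := by
          gcongr; linarith
      _ = _ := by rw [he]; ring

end CovarianceConcentration

/-! ### From covariance concentration to the Lévy–Prohorov rate. -/

section Conclusion

/-- The comparison is used at scale `δ = b`. For `b ≤ 1` the term `Δ * L / b ^ 2 ≤ c * b ^ 2` is at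
most `c * b`; for `b > 1` the distance is at most one anyway. -/
lemma levyProkhorovDist_gaussianMaxLaw_le_mul {ι : Type*} [Fintype ι] [DecidableEq ι] [Nonempty ι]
    {K₁ K₂ : Matrix ι ι ℝ} (h₁ : K₁.PosSemidef) (h₂ : K₂.PosSemidef) {Δ L c b : ℝ}
    (hΔ : ∀ j k, |K₁ j k - K₂ j k| ≤ Δ) (hL : Real.log (Fintype.card ι) + 1 ≤ L) (hb : 0 < b)
    (h : Δ * L ≤ c * b ^ 4) :
    levyProkhorovDist (gaussianMaxLaw K₁) (gaussianMaxLaw K₂) ≤ (12 + 2 * c) * b := by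
  have hΔ0 : 0 ≤ Δ := (abs_nonneg _).trans (hΔ (Classical.arbitrary ι) (Classical.arbitrary ι))
  have hlog : 0 ≤ Real.log (Fintype.card ι) := Real.log_natCast_nonneg _
  have hc : 0 ≤ c := nonneg_of_mul_nonneg_left
    ((mul_nonneg hΔ0 (by linarith : 0 ≤ L)).trans h) (by positivity)
  rcases le_or_gt b 1 with hb1 | hb1
  · refine (levyProkhorovDist_gaussianMaxLaw_le h₁ h₂ hΔ0 hΔ (L := L) (by linarith) (by linarith)
      hb).trans (max_le ?_ ?_)
    · nlinarith
    · rw [div_le_iff₀ (by positivity)]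
      have : b ^ 4 ≤ b ^ 3 := pow_le_pow_of_le_one hb.le hb1 (by norm_num)
      have h3 : 0 < b ^ 3 := by positivity
      nlinarith [mul_le_mul_of_nonneg_left this hc]
  · have := levyProkhorovDist_le_one (μ := gaussianMaxLaw K₁) (ν := gaussianMaxLaw K₂)
    nlinarith

/-- The rate `ν^{1/2} √(log d) / t^{1/8}`. -/
noncomputable def bootRate (ν : ℝ) (d t : ℕ) : ℝ :=
  ν ^ (1 / 2 : ℝ) * √(Real.log d) / (t : ℝ) ^ (1 / 8 : ℝ)

lemma bootRate_pos {ν : ℝ} (hν : 0 < ν) {d t : ℕ} (hd : 2 ≤ d) (ht : 0 < t) :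
    0 < bootRate ν d t := by
  have ht' : (0 : ℝ) < t := by exact_mod_cast ht
  have := half_le_log hd
  have : 0 < √(Real.log d) := Real.sqrt_pos.2 (by linarith)
  unfold bootRate
  positivity

/-- Up to a constant, the right side is the covariance error `ν ^ 2 * log d / √t` times the
logarithm of the number of triples, which is the calibration of the rate. -/
lemma bootRate_pow_four {ν : ℝ} (hν : 0 ≤ ν) {d t : ℕ} :
    bootRate ν d t ^ 4 = ν ^ 2 * Real.log d ^ 2 / √t := by
  unfold bootRate
  rw [div_pow, mul_pow]
  have e1 : (ν ^ (1 / 2 : ℝ)) ^ 4 = ν ^ 2 := by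
    rw [← Real.rpow_natCast, ← Real.rpow_mul hν, ← Real.rpow_natCast]; norm_num
  have e2 : ((t : ℝ) ^ (1 / 8 : ℝ)) ^ 4 = √t := by
    rw [← Real.rpow_natCast, ← Real.rpow_mul (Nat.cast_nonneg _), Real.sqrt_eq_rpow]; norm_num
  have e3 : √(Real.log d) ^ 4 = Real.log d ^ 2 := by
    rw [show √(Real.log d) ^ 4 = (√(Real.log d) ^ 2) ^ 2 by ring,
      Real.sq_sqrt (Real.log_natCast_nonneg _)]
  rw [e1, e2, e3]

lemma bootRate_mul {a ν : ℝ} (ha : 0 ≤ a) (hν : 0 ≤ ν) (d t : ℕ) :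
    bootRate (a * ν) d t = a ^ (1 / 2 : ℝ) * bootRate ν d t := by
  rw [bootRate, bootRate, Real.mul_rpow ha hν]; ring

instance instNonemptyTriple {d d' : ℕ} [NeZero d] [NeZero d'] : Nonempty (Triple d d') :=
  ⟨(0, 0, 1)⟩

lemma memLp_two_of_integrable_abs_pow {Ω : Type*} [MeasurableSpace Ω] {P : Measure Ω}
    [IsFiniteMeasure P] {X : Ω → ℝ} (hX : AEStronglyMeasurable X P) {q : ℕ} (hq : 2 ≤ q)
    (h : Integrable (fun ω => |X ω| ^ q) P) : MemLp X 2 P := by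
  rw [memLp_two_iff_integrable_sq hX]
  refine Integrable.mono' ((integrable_const 1).add h) (hX.pow 2) (.of_forall fun ω => ?_)
  rw [Real.norm_eq_abs, abs_of_nonneg (by positivity), ← sq_abs]
  exact abs_pow_le_one_add_pow _ hq

lemma two_le_momentOrder (κ : ℝ) : 2 ≤ momentOrder κ := by unfold momentOrder; omega

/-- Bootstrap approximation under a moment bound for the sketched dyads. -/
theorem exists_measure_levyProkhorovDist_empCov_le (C κ : ℝ) (hκ : 1 ≤ κ) {M : ℝ} (hM : 0 ≤ M) :
    ∃ c : ℝ, 0 < c ∧ ∀ (t n d d' : ℕ) [NeZero t], 2 ≤ d → GrowthCondition C κ d d' t →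
      ∀ (A : Matrix (Fin n) (Fin d) ℝ) (B : Matrix (Fin n) (Fin d') ℝ) {Ω : Type*}
        [MeasurableSpace Ω] (P : Measure Ω) [IsProbabilityMeasure P]
        (S : Ω → Matrix (Fin t) (Fin n) ℝ), Measurable S → iIndepFun (fun i ω => S ω i) P →
        (∀ i, IdentDistrib (fun ω => S ω i) (fun ω => S ω 0) P P) →
        ∀ ν : ℝ, 0 < ν →
        (∀ j k, Integrable (fun ω => |dyad A B (S ω) 0 j k| ^ momentOrder κ) P) →
        (∀ j k, ∫ ω, |dyad A B (S ω) 0 j k| ^ momentOrder κ ∂P ≤ M * ν ^ momentOrder κ) →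
        P {ω | ¬ levyProkhorovDist (lawZ P A B S) (gaussianMaxLaw (empCov A B (S ω))) ≤
          c * bootRate ν d t} ≤ ENNReal.ofReal (1 / t + 1 / (d * d')) := by
  obtain ⟨c, hc, h⟩ := exists_measure_empCov_sub_dyadCov_le C κ hκ hM
  set a := 4 + 2 * Real.log (2 * max C 1) with ha
  have ha0 : 0 < a := by
    have : 0 ≤ Real.log (2 * max C 1) :=
      Real.log_nonneg (by linarith [le_max_right C 1])
    linarith
  refine ⟨12 + 2 * (c * a), by positivity, ?_⟩
  intro t n d d' _ hd hg A B Ω _ P _ S hS hind hid ν hν hint hmom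
  refine (measure_mono ?_).trans (h t n d d' hd hg A B P S hS hind hid ν hν hint hmom)
  intro ω hω hcov
  refine hω ?_
  have ht : 0 < t := Nat.pos_of_ne_zero (NeZero.ne t)
  have : NeZero d := ⟨by omega⟩
  have : NeZero d' := ⟨(hg.pos_right hd).ne'⟩
  refine levyProkhorovDist_gaussianMaxLaw_le_mul (posSemidef_dyadCov A B S fun j k =>
    memLp_two_of_integrable_abs_pow ((measurable_dyad A B 0 j k).comp hS).aestronglyMeasurable
      (two_le_momentOrder κ) (hint j k)) (posSemidef_empCov A B (S ω)) hcov
    (hg.log_card_triple_le hd) (bootRate_pos hν hd ht) ?_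
  rw [bootRate_pow_four hν.le]
  exact le_of_eq (by ring)

lemma measure_levyProkhorovDist_condLawBoot {t n d d' : ℕ} [NeZero t] [NeZero d] [NeZero d']
    (A : Matrix (Fin n) (Fin d) ℝ) (B : Matrix (Fin n) (Fin d') ℝ) {Ω : Type*}
    [MeasurableSpace Ω] {P : Measure Ω} [IsProbabilityMeasure P]
    {S : Ω → Matrix (Fin t) (Fin n) ℝ} {ξ : Ω → Fin t → ℝ} (hS : Measurable S)
    (hξ : IsGaussianMultiplier P S ξ) (μ : Ω → Measure ℝ) (r : ℝ) :
    P {ω | ¬ levyProkhorovDist (μ ω) (condLawBoot P A B S ξ ω) ≤ r} =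
      P {ω | ¬ levyProkhorovDist (μ ω) (gaussianMaxLaw (empCov A B (S ω))) ≤ r} := by
  refine measure_congr ?_
  filter_upwards [condLawBoot_ae_eq A B hS hξ] with ω h
  simp only [Set.ofPred, h]

/-- The degenerate case `ν = 0`, excluded from the general bound, which divides by `ν`: both
covariance matrices vanish. -/
lemma gaussianMaxLaw_empCov_of_dyad_eq_zero {t n d d' : ℕ} [NeZero t]
    (A : Matrix (Fin n) (Fin d) ℝ) (B : Matrix (Fin n) (Fin d') ℝ)
    (h : ∀ (S : Matrix (Fin t) (Fin n) ℝ) i, dyad A B S i = 0) {Ω : Type*}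
    [MeasurableSpace Ω] (P : Measure Ω) (S : Ω → Matrix (Fin t) (Fin n) ℝ) (ω : Ω) :
    gaussianMaxLaw (empCov A B (S ω)) = gaussianMaxLaw (dyadCov P A B S) := by
  congr 1
  ext j k
  rw [empCov_apply, dyadCov_apply]
  simp [h, covariance]

end Conclusion

/-! ### Length sampling: almost surely bounded dyads. -/

section LengthSampling

variable {Ω : Type*} [MeasurableSpace Ω] {P : Measure Ω} {t n d d' : ℕ}

lemma abs_le_euclNorm {d : ℕ} (v : Fin d → ℝ) (j : Fin d) : |v j| ≤ euclNorm v := by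
  rw [← Real.sqrt_sq_eq_abs]
  exact Real.sqrt_le_sqrt (Finset.single_le_sum (f := fun j => v j ^ 2)
    (fun _ _ => sq_nonneg _) (Finset.mem_univ j))

lemma euclNorm_nonneg {d : ℕ} (v : Fin d → ℝ) : 0 ≤ euclNorm v := Real.sqrt_nonneg _

lemma sum_euclNorm_mul_le (A : Matrix (Fin n) (Fin d) ℝ) (B : Matrix (Fin n) (Fin d') ℝ) :
    ∑ l, euclNorm (A l) * euclNorm (B l) ≤ frob A * frob B := by
  have h := Real.sum_mul_le_sqrt_mul_sqrt Finset.univ (fun l => euclNorm (A l))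
    fun l => euclNorm (B l)
  have e : ∀ {m : ℕ} (v : Fin m → ℝ), euclNorm v ^ 2 = ∑ j, v j ^ 2 := fun v =>
    Real.sq_sqrt (Finset.sum_nonneg fun _ _ => sq_nonneg _)
  simp only [e] at h
  exact h

/-- When index `l` is drawn, the dyad entry is `A l j * B l k / p_l`. The probability cancels the
norms of the rows and leaves `∑ ‖a_l‖ ‖b_l‖`, which Cauchy–Schwarz bounds by the Frobenius norms. -/
lemma ae_abs_dyad_le_frob [NeZero t] [IsProbabilityMeasure P] {A : Matrix (Fin n) (Fin d) ℝ}
    {B : Matrix (Fin n) (Fin d') ℝ} {S : Ω → Matrix (Fin t) (Fin n) ℝ}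
    (h : IsLengthSampling P A B S) (j : Fin d) (k : Fin d') :
    ∀ᵐ ω ∂P, |dyad A B (S ω) 0 j k| ≤ frob A * frob B := by
  have ht : (0 : ℝ) < t := by exact_mod_cast Nat.pos_of_ne_zero (NeZero.ne t)
  have hrow : Measurable fun ω => S ω 0 :=
    (measurable_pi_apply (X := fun _ : Fin t => Fin n → ℝ) 0).comp h.measurable
  let g : (Fin n → ℝ) → ℝ := fun r =>
    |columnForm A (fun l => √(t : ℝ) * r l) j * columnForm B (fun l => √(t : ℝ) * r l) k|
  have hg : Measurable g := by
    simp only [g, columnForm]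
    fun_prop
  have hm : MeasurableSet {r | g r ≤ frob A * frob B} := measurableSet_le hg measurable_const
  suffices h' : ∀ᵐ r ∂P.map (fun ω => S ω 0), g r ≤ frob A * frob B by
    filter_upwards [(ae_map_iff hrow.aemeasurable hm).1 h'] with ω hω
    rw [dyad_apply]
    exact hω
  rw [h.law 0, ae_iff, Measure.finsetSum_apply]
  refine Finset.sum_eq_zero fun l _ => ?_
  rw [Measure.smul_apply, smul_eq_mul, mul_eq_zero]
  have hp0 : 0 ≤ lengthProb A B l := div_nonneg
    (mul_nonneg (euclNorm_nonneg _) (euclNorm_nonneg _)) h.sum_pos.le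
  -- An index of probability zero carries no mass; its nominal row would involve division by zero.
  rcases hp0.eq_or_lt with hp | hp
  · left
    rw [← hp, ENNReal.ofReal_zero]
  · right
    have hm' : MeasurableSet {r | ¬ g r ≤ frob A * frob B} := hm.compl
    rw [Measure.dirac_apply' _ hm']
    refine Set.indicator_of_notMem ?_ _
    simp only [Set.mem_ofPred_eq, not_not]
    set p := lengthProb A B l with hpdef
    have hform : ∀ {m : ℕ} (N : Matrix (Fin n) (Fin m) ℝ) (i : Fin m),
        columnForm N (fun l' => √(t : ℝ) *
          (Pi.single l (1 / √((t : ℝ) * p)) : Fin n → ℝ) l') i = N l i / √p := by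
      intro m N i
      simp only [columnForm, Pi.single_apply, mul_ite, mul_zero, Finset.sum_ite_eq',
        Finset.mem_univ, if_true]
      rw [Real.sqrt_mul ht.le]
      have : √(t : ℝ) ≠ 0 := (Real.sqrt_pos.2 ht).ne'
      field_simp
    simp only [g, hform]
    rw [div_mul_div_comm, Real.mul_self_sqrt hp.le, abs_div, abs_mul, abs_of_pos hp,
      div_le_iff₀ hp]
    have hS := sum_euclNorm_mul_le A B
    have hmul : p * ∑ i, euclNorm (A i) * euclNorm (B i) = euclNorm (A l) * euclNorm (B l) :=
      div_mul_cancel₀ _ h.sum_pos.ne'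
    calc |A l j| * |B l k| ≤ euclNorm (A l) * euclNorm (B l) :=
          mul_le_mul (abs_le_euclNorm _ j) (abs_le_euclNorm _ k) (abs_nonneg _)
            (euclNorm_nonneg _)
      _ = p * ∑ i, euclNorm (A i) * euclNorm (B i) := hmul.symm
      _ ≤ frob A * frob B * p := by rw [mul_comm]; gcongr

lemma integrable_abs_pow_of_ae_le [IsProbabilityMeasure P] {X : Ω → ℝ} (hX : Measurable X) {ν : ℝ}
    (h : ∀ᵐ ω ∂P, |X ω| ≤ ν) (q : ℕ) :
    Integrable (fun ω => |X ω| ^ q) P ∧ ∫ ω, |X ω| ^ q ∂P ≤ 1 * ν ^ q := by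
  have hb : ∀ᵐ ω ∂P, |X ω| ^ q ≤ ν ^ q := by
    filter_upwards [h] with ω hω using pow_le_pow_left₀ (abs_nonneg _) hω q
  have hi : Integrable (fun ω => |X ω| ^ q) P :=
    Integrable.mono' (integrable_const (ν ^ q)) (hX.norm.pow_const q).aestronglyMeasurable (by
      filter_upwards [hb] with ω hω
      rwa [Real.norm_eq_abs, abs_of_nonneg (by positivity)])
  refine ⟨hi, (integral_mono_ae hi (integrable_const _) hb).trans (by simp)⟩

lemma identDistrib_of_map_eq {α β : Type*} [MeasurableSpace α] [MeasurableSpace β]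
    {P : Measure α} {X Y : α → β} (hX : Measurable X) (hY : Measurable Y)
    (h : P.map X = P.map Y) : IdentDistrib X Y P P :=
  ⟨hX.aemeasurable, hY.aemeasurable, h⟩

lemma measurable_row {S : Ω → Matrix (Fin t) (Fin n) ℝ} (hS : Measurable S) (i : Fin t) :
    Measurable fun ω => S ω i :=
  (measurable_pi_apply (X := fun _ : Fin t => Fin n → ℝ) i).comp hS

theorem exists_measure_levyProkhorovDist_lengthSampling_le (C κ : ℝ) (hκ : 1 ≤ κ) :
    ∃ c : ℝ, 0 < c ∧ ∀ (t n d d' : ℕ) [NeZero t], 2 ≤ d → GrowthCondition C κ d d' t →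
      ∀ (A : Matrix (Fin n) (Fin d) ℝ) (B : Matrix (Fin n) (Fin d') ℝ) (Ω : Type*)
        [MeasurableSpace Ω] (P : Measure Ω) [IsProbabilityMeasure P]
        (S : Ω → Matrix (Fin t) (Fin n) ℝ) (ξ : Ω → Fin t → ℝ),
        IsLengthSampling P A B S → IsGaussianMultiplier P S ξ →
        P {ω | ¬ levyProkhorovDist (lawZ P A B S) (condLawBoot P A B S ξ ω) ≤
          c * bootRate (frob A * frob B) d t} ≤ ENNReal.ofReal (1 / t + 1 / (d * d')) := by
  obtain ⟨c, hc, h⟩ := exists_measure_levyProkhorovDist_empCov_le C κ hκ zero_le_one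
  refine ⟨c, hc, ?_⟩
  intro t n d d' _ hd hg A B Ω _ P _ S ξ hS hξ
  have : NeZero d := ⟨by omega⟩
  have : NeZero d' := ⟨(hg.pos_right hd).ne'⟩
  rw [measure_levyProkhorovDist_condLawBoot A B hS.measurable hξ]
  have hmom := fun j k => integrable_abs_pow_of_ae_le ((measurable_dyad A B 0 j k).comp
    hS.measurable) (ae_abs_dyad_le_frob hS j k) (momentOrder κ)
  exact h t n d d' hd hg A B P S hS.measurable hS.iIndep
    (fun i => identDistrib_of_map_eq (measurable_row hS.measurable i)
      (measurable_row hS.measurable 0) ((hS.law i).trans (hS.law 0).symm))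
    _ (hS.sum_pos.trans_le (sum_euclNorm_mul_le A B)) (fun j k => (hmom j k).1)
    fun j k => (hmom j k).2

end LengthSampling

/-! ### The entrywise maximum norm and `ν`. -/

section EntryMax

lemma abs_le_entryMax {m n : Type*} [Finite m] [Finite n] (M : Matrix m n ℝ) (i : m) (j : n) :
    |M i j| ≤ entryMax M :=
  le_ciSup (f := fun p : m × n => |M p.1 p.2|) (Set.finite_range _).bddAbove (i, j)

lemma entryMax_nonneg {m n : Type*} (M : Matrix m n ℝ) : 0 ≤ entryMax M :=
  Real.iSup_nonneg fun _ => abs_nonneg _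

lemma sum_sq_le_entryMax {n d : ℕ} (A : Matrix (Fin n) (Fin d) ℝ) (j : Fin d) :
    ∑ l, A l j ^ 2 ≤ entryMax (Aᵀ * A) := by
  refine le_trans (le_of_eq ?_) ((le_abs_self _).trans (abs_le_entryMax (Aᵀ * A) j j))
  rw [mul_apply]
  exact Finset.sum_congr rfl fun l _ => by rw [transpose_apply, sq]

lemma eq_zero_of_entryMax_eq_zero {n d : ℕ} {A : Matrix (Fin n) (Fin d) ℝ}
    (h : entryMax (Aᵀ * A) = 0) : A = 0 := by
  ext l j
  have h1 := (Finset.single_le_sum (f := fun l => A l j ^ 2) (fun _ _ => sq_nonneg _)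
    (Finset.mem_univ l)).trans (sum_sq_le_entryMax A j)
  rw [h] at h1
  simpa using le_antisymm h1 (sq_nonneg _)

lemma dyad_eq_zero_of_nu_eq_zero {t n d d' : ℕ} {A : Matrix (Fin n) (Fin d) ℝ}
    {B : Matrix (Fin n) (Fin d') ℝ} (h : nu A B = 0) (S : Matrix (Fin t) (Fin n) ℝ) (i : Fin t) :
    dyad A B S i = 0 := by
  rw [nu, Real.sqrt_eq_zero (mul_nonneg (entryMax_nonneg _) (entryMax_nonneg _)),
    mul_eq_zero] at h
  rcases h with h | h
  · simp [dyad, eq_zero_of_entryMax_eq_zero h]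
  · simp [dyad, eq_zero_of_entryMax_eq_zero h]

lemma nu_nonneg {n d d' : ℕ} (A : Matrix (Fin n) (Fin d) ℝ) (B : Matrix (Fin n) (Fin d') ℝ) :
    0 ≤ nu A B := Real.sqrt_nonneg _

lemma nu_eq_mul {n d d' : ℕ} (A : Matrix (Fin n) (Fin d) ℝ) (B : Matrix (Fin n) (Fin d') ℝ) :
    nu A B = √(entryMax (Aᵀ * A)) * √(entryMax (Bᵀ * B)) :=
  Real.sqrt_mul (entryMax_nonneg _) _

end EntryMax

/-! ### Sub-Gaussian sketches: moments of the dyads. -/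

section SubGaussian

variable {Ω : Type*} [MeasurableSpace Ω] {P : Measure Ω} {t n d d' : ℕ}

/-- Isolating the linear term makes it vanish on integrating a centred variable; what remains is
quadratic in the parameter. -/
lemma exp_le_add_exp_sq (x : ℝ) : Real.exp x ≤ x + Real.exp (x ^ 2) := by
  have h1 := Real.add_one_le_exp (x ^ 2)
  rcases le_or_gt |x| 1 with h | h
  · have h2 := Real.abs_exp_sub_one_sub_id_le h
    linarith [(abs_le.1 h2).2]
  · rcases lt_abs.1 h with h | h
    · have : Real.exp x ≤ Real.exp (x ^ 2) := Real.exp_le_exp.2 (by nlinarith)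
      linarith
    · have : Real.exp x ≤ 1 := Real.exp_le_one_iff.2 (by linarith)
      nlinarith

lemma exp_mul_le_of_mem_unitInterval {θ y : ℝ} (h0 : 0 ≤ θ) (h1 : θ ≤ 1) :
    Real.exp (θ * y) ≤ (1 - θ) + θ * Real.exp y := by
  have := convexOn_exp.2 (Set.mem_univ 0) (Set.mem_univ y) (by linarith : 0 ≤ 1 - θ) h0 (by ring)
  simpa [smul_eq_mul] using this

/-- A centred variable with `E exp(Y²) ≤ 2` has a sub-Gaussian moment generating function. -/
lemma hasSubgaussianMGF_of_integral_exp_sq_le [IsProbabilityMeasure P] {Y : Ω → ℝ}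
    (hY : Measurable Y) (hint : Integrable (fun ω => Real.exp (Y ω ^ 2)) P)
    (hexp : ∫ ω, Real.exp (Y ω ^ 2) ∂P ≤ 2) (hmean : ∫ ω, Y ω ∂P = 0) :
    HasSubgaussianMGF Y 2 P := by
  -- From `s y ≤ s ^ 2 / 2 + y ^ 2 / 2` and convexity of `exp` between `0` and `y ^ 2`.
  have hbound : ∀ s ω, Real.exp (s * Y ω) ≤
      Real.exp (s ^ 2 / 2) * ((1 - 1 / 2) + (1 / 2) * Real.exp (Y ω ^ 2)) := fun s ω => by
    refine le_trans ?_ (mul_le_mul_of_nonneg_left (exp_mul_le_of_mem_unitInterval (θ := 1 / 2)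
      (y := Y ω ^ 2) (by norm_num) (by norm_num)) (Real.exp_pos _).le)
    rw [← Real.exp_add, Real.exp_le_exp]
    nlinarith [sq_nonneg (s - Y ω)]
  have hgi : ∀ s : ℝ, Integrable (fun ω =>
      Real.exp (s ^ 2 / 2) * ((1 - 1 / 2) + (1 / 2) * Real.exp (Y ω ^ 2))) P := fun s =>
    ((integrable_const _).add (hint.const_mul _)).const_mul _
  have hi : ∀ s : ℝ, Integrable (fun ω => Real.exp (s * Y ω)) P := fun s =>
    (hgi s).mono' (hY.const_mul s).exp.aestronglyMeasurable (.of_forall fun ω => by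
      rw [Real.norm_eq_abs, abs_of_pos (Real.exp_pos _)]
      exact hbound s ω)
  refine ⟨hi, fun s => ?_⟩
  have e : ((2 : NNReal) : ℝ) * s ^ 2 / 2 = s ^ 2 := by push_cast; ring
  rw [e, mgf]
  -- Small parameters use the mean zero and the convexity bound for `exp (s ^ 2 * Y ^ 2)`. For large
  -- ones the crude bound suffices, since the extra factor `3 / 2` is at most `exp (s ^ 2 / 2)`.
  rcases le_or_gt (s ^ 2) 1 with hs | hs
  · have hYi : Integrable Y P := by
      refine hint.mono' hY.aestronglyMeasurable (.of_forall fun ω => ?_)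
      rw [Real.norm_eq_abs]
      have := Real.add_one_le_exp (Y ω ^ 2)
      have h2 := sq_abs (Y ω)
      nlinarith [sq_nonneg (|Y ω| - 1 / 2)]
    have hci : Integrable (fun ω => (1 - s ^ 2) + s ^ 2 * Real.exp (Y ω ^ 2)) P :=
      (integrable_const _).add (hint.const_mul _)
    calc ∫ ω, Real.exp (s * Y ω) ∂P ≤
          ∫ ω, (s * Y ω + ((1 - s ^ 2) + s ^ 2 * Real.exp (Y ω ^ 2))) ∂P := by
          refine integral_mono (hi s) ((hYi.const_mul _).add hci) fun ω => ?_
          refine (exp_le_add_exp_sq _).trans ?_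
          rw [mul_pow]
          have := exp_mul_le_of_mem_unitInterval (y := Y ω ^ 2) (sq_nonneg s) hs
          linarith
      _ = (1 - s ^ 2) + s ^ 2 * ∫ ω, Real.exp (Y ω ^ 2) ∂P := by
          rw [integral_add (hYi.const_mul _) hci,
            integral_add (integrable_const _) (hint.const_mul _), integral_const_mul,
            integral_const_mul, hmean]
          simp
      _ ≤ s ^ 2 + 1 := by nlinarith [sq_nonneg s]
      _ ≤ Real.exp (s ^ 2) := Real.add_one_le_exp _
  · calc ∫ ω, Real.exp (s * Y ω) ∂P ≤
          ∫ ω, Real.exp (s ^ 2 / 2) * ((1 - 1 / 2) + (1 / 2) * Real.exp (Y ω ^ 2)) ∂P :=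
          integral_mono (hi s) (hgi s) (hbound s)
      _ = Real.exp (s ^ 2 / 2) * ((1 - 1 / 2) + (1 / 2) * ∫ ω, Real.exp (Y ω ^ 2) ∂P) := by
          rw [integral_const_mul, integral_add (integrable_const _) (hint.const_mul _),
            integral_const_mul]
          simp
      _ ≤ Real.exp (s ^ 2 / 2) * Real.exp (s ^ 2 / 2) := by
          gcongr
          have := Real.add_one_le_exp (s ^ 2 / 2)
          linarith
      _ = Real.exp (s ^ 2) := by rw [← Real.exp_add]; ring_nf

/-- Doubling `C` makes the inequality strict, so that some admissible `r < 2 * C` exists without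
discussing whether the infimum is attained. -/
lemma integral_exp_sq_div_le_of_orliczNorm_le [IsProbabilityMeasure P] {X : Ω → ℝ}
    (hX : Measurable X) {C : ℝ} (hC : 0 < C) (h : orliczNorm psiTwo X P ≤ ENNReal.ofReal C) :
    Integrable (fun ω => Real.exp ((X ω / (2 * C)) ^ 2)) P ∧
      ∫ ω, Real.exp ((X ω / (2 * C)) ^ 2) ∂P ≤ 2 := by
  have h2 : orliczNorm psiTwo X P < ENNReal.ofReal (2 * C) :=
    h.trans_lt ((ENNReal.ofReal_lt_ofReal_iff (by linarith)).2 (by linarith))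
  simp only [orliczNorm, iInf_lt_iff] at h2
  obtain ⟨r, hr, hle, hlt⟩ := h2
  have hrC : r < 2 * C := (ENNReal.ofReal_lt_ofReal_iff (by linarith)).1 hlt
  have hm : Measurable fun ω => Real.exp ((X ω / (2 * C)) ^ 2) := by fun_prop
  have hl : ∫⁻ ω, ENNReal.ofReal (Real.exp ((X ω / (2 * C)) ^ 2)) ∂P ≤ 2 := by
    calc ∫⁻ ω, ENNReal.ofReal (Real.exp ((X ω / (2 * C)) ^ 2)) ∂P ≤
          ∫⁻ ω, (ENNReal.ofReal (psiTwo (|X ω| / r)) + 1) ∂P := by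
          refine lintegral_mono fun ω => ?_
          rw [← ENNReal.ofReal_one, ← ENNReal.ofReal_add
            (by unfold psiTwo; linarith [Real.add_one_le_exp ((|X ω| / r) ^ 2),
              sq_nonneg (|X ω| / r)]) zero_le_one]
          refine ENNReal.ofReal_le_ofReal ?_
          rw [psiTwo, sub_add_cancel, Real.exp_le_exp, div_pow, div_pow, sq_abs]
          gcongr
      _ = ∫⁻ ω, ENNReal.ofReal (psiTwo (|X ω| / r)) ∂P + 1 := by
          rw [lintegral_add_right _ measurable_const]; simp
      _ ≤ 1 + 1 := by gcongr
      _ = 2 := one_add_one_eq_two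
  have hi : Integrable (fun ω => Real.exp ((X ω / (2 * C)) ^ 2)) P :=
    (lintegral_ofReal_ne_top_iff_integrable hm.aestronglyMeasurable
      (.of_forall fun ω => (Real.exp_pos _).le)).1 (hl.trans_lt (by simp)).ne
  refine ⟨hi, ?_⟩
  rw [integral_eq_lintegral_of_nonneg_ae (.of_forall fun ω => (Real.exp_pos _).le)
    hm.aestronglyMeasurable]
  exact ENNReal.toReal_le_of_le_ofReal (by norm_num) (by simpa using hl)

/-- From `|G| ^ q ≤ q! * exp |G|` and the moment generating function at `±1`. -/
lemma integrable_abs_pow_of_hasSubgaussianMGF {G : Ω → ℝ} (hGm : Measurable G) {c : NNReal}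
    (hc : c ≤ 2) (hG : HasSubgaussianMGF G c P) (q : ℕ) :
    Integrable (fun ω => |G ω| ^ q) P ∧
      ∫ ω, |G ω| ^ q ∂P ≤ q.factorial * (2 * Real.exp 1) := by
  have hb : ∀ ω, |G ω| ^ q ≤
      q.factorial * (Real.exp (1 * G ω) + Real.exp (-1 * G ω)) := fun ω => by
    have h := Real.pow_div_factorial_le_exp |G ω| (abs_nonneg _) q
    rw [div_le_iff₀ (by positivity)] at h
    have h2 : Real.exp |G ω| ≤ Real.exp (1 * G ω) + Real.exp (-1 * G ω) := by
      rcases abs_cases (G ω) with ⟨e, _⟩ | ⟨e, _⟩ <;> rw [e] <;>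
        simp [(Real.exp_pos _).le]
    nlinarith [(Nat.cast_nonneg q.factorial : (0 : ℝ) ≤ q.factorial)]
  have hi := ((hG.integrable_exp_mul 1).add (hG.integrable_exp_mul (-1))).const_mul
    (q.factorial : ℝ)
  have hi' : Integrable (fun ω => |G ω| ^ q) P :=
    hi.mono' (hGm.norm.pow_const q).aestronglyMeasurable (.of_forall fun ω => by
      rw [Real.norm_eq_abs, abs_of_nonneg (by positivity)]
      exact hb ω)
  refine ⟨hi', (integral_mono hi' hi hb).trans ?_⟩
  have hmgf : ∀ s : ℝ, s ^ 2 = 1 → ∫ ω, Real.exp (s * G ω) ∂P ≤ Real.exp 1 := fun s hs => by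
    refine (hG.mgf_le s).trans (Real.exp_le_exp.2 ?_)
    have : (c : ℝ) ≤ 2 := by exact_mod_cast hc
    rw [hs]; linarith
  simp only [Pi.add_apply]
  rw [integral_const_mul, integral_add (hG.integrable_exp_mul 1) (hG.integrable_exp_mul (-1))]
  have h1 := hmgf 1 (by norm_num)
  have h2 := hmgf (-1) (by norm_num)
  gcongr
  linarith

/-- The joint law of the entries is a product measure, and currying its index set exhibits it as a
product of the laws of the rows. -/
lemma iIndepFun_row [IsProbabilityMeasure P] {S : Ω → Matrix (Fin t) (Fin n) ℝ}
    (hS : Measurable S) (h : iIndepFun (fun (p : Fin t × Fin n) ω => S ω p.1 p.2) P) :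
    iIndepFun (fun i ω => S ω i) P := by
  have hm : ∀ i l, Measurable fun ω => S ω i l := fun i l =>
    (measurable_pi_apply (X := fun _ : Fin n => ℝ) l).comp (measurable_row hS i)
  have hprob : ∀ i l, IsProbabilityMeasure (P.map fun ω => S ω i l) := fun i l =>
    Measure.isProbabilityMeasure_map (hm i l).aemeasurable
  have h1 := (iIndepFun_iff_map_fun_eq_infinitePi_map fun p : Fin t × Fin n => hm p.1 p.2).1 h
  have h2 : ∀ i, P.map (fun ω => S ω i) =
      Measure.infinitePi fun l => P.map fun ω => S ω i l := fun i =>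
    (iIndepFun_iff_map_fun_eq_infinitePi_map fun l => hm i l).1
      (h.precomp (g := fun l => (i, l)) fun l l' e => (Prod.ext_iff.1 e).2)
  refine (iIndepFun_iff_map_fun_eq_infinitePi_map (measurable_row hS)).2 ?_
  simp only [h2]
  rw [← Measure.infinitePi_map_curry (fun i l => P.map fun ω => S ω i l), ← h1]
  exact (Measure.map_map (MeasurableEquiv.curry (Fin t) (Fin n) ℝ).measurable
    (measurable_pi_lambda (fun ω (p : Fin t × Fin n) => S ω p.1 p.2) fun p => hm p.1 p.2)).symm

lemma identDistrib_row [IsProbabilityMeasure P] {S : Ω → Matrix (Fin t) (Fin n) ℝ}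
    (hS : Measurable S) (h : iIndepFun (fun (p : Fin t × Fin n) ω => S ω p.1 p.2) P)
    (hid : ∀ p q : Fin t × Fin n,
      IdentDistrib (fun ω => S ω p.1 p.2) (fun ω => S ω q.1 q.2) P P) (i k : Fin t) :
    IdentDistrib (fun ω => S ω i) (fun ω => S ω k) P P := by
  have hm : ∀ i l, Measurable fun ω => S ω i l := fun i l =>
    (measurable_pi_apply (X := fun _ : Fin n => ℝ) l).comp (measurable_row hS i)
  have h2 : ∀ i, P.map (fun ω => S ω i) =
      Measure.infinitePi fun l => P.map fun ω => S ω i l := fun i =>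
    (iIndepFun_iff_map_fun_eq_infinitePi_map fun l => hm i l).1
      (h.precomp (g := fun l => (i, l)) fun l l' e => (Prod.ext_iff.1 e).2)
  refine identDistrib_of_map_eq (measurable_row hS i) (measurable_row hS k) ?_
  rw [h2, h2]
  congr 1
  ext1 l
  exact (hid (i, l) (k, l)).map_eq

/-- Linear forms of a sub-Gaussian row are sub-Gaussian. -/
lemma IsSubGaussianSketch.hasSubgaussianMGF_columnForm [IsProbabilityMeasure P] [NeZero t] {C : ℝ}
    (hC : 0 < C) {S : Ω → Matrix (Fin t) (Fin n) ℝ} (h : IsSubGaussianSketch P C S)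
    (A : Matrix (Fin n) (Fin d) ℝ) {α : ℝ} (hα : 0 < α) (j : Fin d)
    (hA : ∑ l, A l j ^ 2 ≤ α ^ 2) :
    ∃ c : NNReal, c ≤ 2 ∧
      HasSubgaussianMGF (fun ω => columnForm A (scaledRow (S ω) 0) j / (2 * C * α)) c P := by
  have hm : ∀ l, Measurable fun ω => √(t : ℝ) * S ω 0 l := fun l =>
    ((measurable_pi_apply (X := fun _ : Fin n => ℝ) l).comp
      (measurable_row h.measurable 0)).const_mul _
  have hsub : ∀ l, HasSubgaussianMGF (fun ω => √(t : ℝ) * S ω 0 l / (2 * C)) 2 P := fun l => by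
    have h1 := integral_exp_sq_div_le_of_orliczNorm_le (hm l) hC (h.orlicz 0 l)
    refine hasSubgaussianMGF_of_integral_exp_sq_le ((hm l).div_const _) h1.1 h1.2 ?_
    rw [integral_div, integral_const_mul, h.mean, mul_zero, zero_div]
  have hind : iIndepFun (fun l ω => (A l j / α) * (√(t : ℝ) * S ω 0 l / (2 * C))) P :=
    (h.iIndep.precomp (g := fun l => ((0 : Fin t), l)) fun l l' e => (Prod.ext_iff.1 e).2).comp
      (fun l x => (A l j / α) * (√(t : ℝ) * x / (2 * C))) fun l => by fun_prop
  have hsum := HasSubgaussianMGF.sum_of_iIndepFun hind (s := Finset.univ)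
    fun l _ => (hsub l).const_mul (A l j / α)
  refine ⟨_, ?_, hsum.congr (.of_forall fun ω => ?_)⟩
  -- The variance proxies add up to twice the normalised squared column norm.
  · rw [← NNReal.coe_le_coe, NNReal.coe_sum]
    change ∑ l, (A l j / α) ^ 2 * 2 ≤ 2
    rw [← Finset.sum_mul]
    have : ∑ l, (A l j / α) ^ 2 ≤ 1 := by
      simp only [div_pow]
      rw [← Finset.sum_div, div_le_one (by positivity)]
      exact hA
    linarith
  · simp only [columnForm, scaledRow, Finset.sum_div]
    refine Finset.sum_congr rfl fun l _ => ?_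
    field_simp

/-- A dyad entry is a product of two linear forms of the same row, each sub-Gaussian at the scale of
its column norm. Splitting `|x y| ^ q` into powers of order `2 * q` gives a constant that depends on
`C` and `q` only. -/
lemma IsSubGaussianSketch.integrable_abs_dyad_pow [IsProbabilityMeasure P] [NeZero t] {C : ℝ}
    (hC : 0 < C) {S : Ω → Matrix (Fin t) (Fin n) ℝ} (h : IsSubGaussianSketch P C S)
    (A : Matrix (Fin n) (Fin d) ℝ) (B : Matrix (Fin n) (Fin d') ℝ) (hν : 0 < nu A B) (j : Fin d)
    (k : Fin d') (q : ℕ) :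
    Integrable (fun ω => |dyad A B (S ω) 0 j k| ^ q) P ∧
      ∫ ω, |dyad A B (S ω) 0 j k| ^ q ∂P ≤
        ((4 * C ^ 2) ^ q * (4 * ((2 * q).factorial * Real.exp 1))) * nu A B ^ q := by
  rw [nu_eq_mul] at hν ⊢
  set α := √(entryMax (Aᵀ * A)) with hα
  set β := √(entryMax (Bᵀ * B)) with hβ
  have hα0 : 0 < α := pos_of_mul_pos_left hν (Real.sqrt_nonneg _)
  have hβ0 : 0 < β := pos_of_mul_pos_right hν (Real.sqrt_nonneg _)
  have hform : ∀ {m : ℕ} (N : Matrix (Fin n) (Fin m) ℝ) (i : Fin m) (a : ℝ),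
      Measurable fun ω => columnForm N (scaledRow (S ω) 0) i / a := fun N i a => by
    have h := fun l => (measurable_pi_apply (X := fun _ : Fin n => ℝ) l).comp
      ((measurable_scaledRow (n := n) (0 : Fin t)).comp h.measurable)
    exact (Finset.measurable_fun_sum _ fun l _ => (h l).const_mul _).div_const _
  obtain ⟨c₁, hc₁, h₁⟩ := h.hasSubgaussianMGF_columnForm hC A hα0 j
    ((sum_sq_le_entryMax A j).trans_eq (Real.sq_sqrt (entryMax_nonneg _)).symm)
  obtain ⟨c₂, hc₂, h₂⟩ := h.hasSubgaussianMGF_columnForm hC B hβ0 k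
    ((sum_sq_le_entryMax B k).trans_eq (Real.sq_sqrt (entryMax_nonneg _)).symm)
  obtain ⟨i₁, b₁⟩ := integrable_abs_pow_of_hasSubgaussianMGF (hform A j _) hc₁ h₁ (2 * q)
  obtain ⟨i₂, b₂⟩ := integrable_abs_pow_of_hasSubgaussianMGF (hform B k _) hc₂ h₂ (2 * q)
  have hb : ∀ ω, |dyad A B (S ω) 0 j k| ^ q ≤ (4 * C ^ 2 * (α * β)) ^ q *
      (|columnForm A (scaledRow (S ω) 0) j / (2 * C * α)| ^ (2 * q) +
        |columnForm B (scaledRow (S ω) 0) k / (2 * C * β)| ^ (2 * q)) := fun ω => by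
    set x := columnForm A (scaledRow (S ω) 0) j / (2 * C * α) with hx
    set y := columnForm B (scaledRow (S ω) 0) k / (2 * C * β) with hy
    have e : dyad A B (S ω) 0 j k = 4 * C ^ 2 * (α * β) * (x * y) := by
      rw [dyad_apply, hx, hy]; field_simp; norm_num
    rw [e, abs_mul, mul_pow, abs_of_pos (by positivity), abs_mul, mul_pow, mul_comm 2 q, pow_mul,
      pow_mul]
    gcongr
    rw [mul_pow]
    nlinarith [sq_nonneg (|x| ^ q - |y| ^ q), sq_nonneg (|x| ^ q), sq_nonneg (|y| ^ q)]
  have hi := (i₁.add i₂).const_mul ((4 * C ^ 2 * (α * β)) ^ q)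
  have hi' : Integrable (fun ω => |dyad A B (S ω) 0 j k| ^ q) P :=
    hi.mono' (((measurable_dyad A B 0 j k).comp h.measurable).norm.pow_const q).aestronglyMeasurable
      (.of_forall fun ω => by
        rw [Real.norm_eq_abs, abs_of_nonneg (by positivity)]
        exact hb ω)
  refine ⟨hi', (integral_mono hi' hi hb).trans ?_⟩
  simp only [Pi.add_apply]
  rw [integral_const_mul, integral_add i₁ i₂, mul_pow]
  calc (4 * C ^ 2) ^ q * (α * β) ^ q * _ ≤ (4 * C ^ 2) ^ q * (α * β) ^ q *
        (4 * ((2 * q).factorial * Real.exp 1)) := by gcongr; linarith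
    _ = _ := by ring

theorem exists_measure_levyProkhorovDist_subGaussian_le (C κ : ℝ) (hC : 0 < C) (hκ : 1 ≤ κ) :
    ∃ c : ℝ, 0 < c ∧ ∀ (t n d d' : ℕ) [NeZero t], 2 ≤ d → GrowthCondition C κ d d' t →
      ∀ (A : Matrix (Fin n) (Fin d) ℝ) (B : Matrix (Fin n) (Fin d') ℝ) (Ω : Type*)
        [MeasurableSpace Ω] (P : Measure Ω) [IsProbabilityMeasure P]
        (S : Ω → Matrix (Fin t) (Fin n) ℝ) (ξ : Ω → Fin t → ℝ),
        IsSubGaussianSketch P C S → IsGaussianMultiplier P S ξ →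
        P {ω | ¬ levyProkhorovDist (lawZ P A B S) (condLawBoot P A B S ξ ω) ≤
          c * bootRate (nu A B) d t} ≤ ENNReal.ofReal (1 / t + 1 / (d * d')) := by
  obtain ⟨c, hc, h⟩ := exists_measure_levyProkhorovDist_empCov_le C κ hκ
    (M := (4 * C ^ 2) ^ momentOrder κ * (4 * ((2 * momentOrder κ).factorial * Real.exp 1)))
    (by positivity)
  refine ⟨c, hc, ?_⟩
  intro t n d d' _ hd hg A B Ω _ P _ S ξ hS hξ
  have : NeZero d := ⟨by omega⟩
  have : NeZero d' := ⟨(hg.pos_right hd).ne'⟩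
  rw [measure_levyProkhorovDist_condLawBoot A B hS.measurable hξ]
  rcases (nu_nonneg A B).eq_or_lt with hν | hν
  · refine le_of_eq_of_le ?_ zero_le
    convert measure_empty (μ := P)
    refine Set.eq_empty_of_forall_notMem fun ω hω => hω ?_
    rw [lawZ, gaussianMaxLaw_empCov_of_dyad_eq_zero A B (dyad_eq_zero_of_nu_eq_zero hν.symm) P S ω,
      levyProkhorovDist_self]
    exact mul_nonneg hc.le (by unfold bootRate; positivity)
  · have hmom := fun j k => hS.integrable_abs_dyad_pow hC A B hν j k (momentOrder κ)
    exact h t n d d' hd hg A B P S hS.measurable (iIndepFun_row hS.measurable hS.iIndep)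
      (fun i => identDistrib_row hS.measurable hS.iIndep hS.identDistrib i 0) _ hν
      (fun j k => (hmom j k).1) fun j k => (hmom j k).2

end SubGaussian

/-! ### Domination of Gaussian laws with proportional covariances. -/

section GaussianDomination

variable {ι : Type*} [Fintype ι] [DecidableEq ι]

lemma levyProkhorovDist_le_of_le_smul {μ ν : Measure ℝ} [IsProbabilityMeasure μ]
    [IsProbabilityMeasure ν] {ε : ℝ} (hε : 0 ≤ ε) (h : μ ≤ ENNReal.ofReal (1 + ε) • ν) :
    levyProkhorovDist μ ν ≤ ε := by
  have h1 : ∀ B : Set ℝ, μ B ≤ ν B + ENNReal.ofReal ε := fun B => by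
    refine (h B).trans ?_
    rw [Measure.smul_apply, smul_eq_mul, ENNReal.ofReal_add zero_le_one hε, ENNReal.ofReal_one,
      add_mul, one_mul]
    gcongr
    exact mul_le_of_le_one_right' prob_le_one
  refine levyProkhorovDist_le_of_forall_le _ _ hε fun δ B hδ hB => (h1 B).trans ?_
  gcongr
  exact Metric.self_subset_thickening (hε.trans_lt hδ) B

/-- Enlarging the variance only increases the exponential factor of the density, so the ratio is at
most that of the normalising constants. -/
lemma gaussianReal_le_smul {v w : NNReal} (hv : 0 < v) (hvw : v ≤ w) :
    gaussianReal 0 v ≤ ENNReal.ofReal √(w / v) • gaussianReal 0 w := by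
  have hw : 0 < w := hv.trans_le hvw
  have hv' : (0 : ℝ) < v := hv
  have hw' : (0 : ℝ) < w := hw
  have hvw' : (v : ℝ) ≤ w := hvw
  rw [gaussianReal_of_var_ne_zero _ hv.ne', gaussianReal_of_var_ne_zero _ hw.ne',
    ← withDensity_smul _ (measurable_gaussianPDF 0 w)]
  refine withDensity_mono (.of_forall fun x => ?_)
  simp only [Pi.smul_apply, gaussianPDF, smul_eq_mul]
  rw [← ENNReal.ofReal_mul (Real.sqrt_nonneg _)]
  refine ENNReal.ofReal_le_ofReal ?_
  simp only [gaussianPDFReal, sub_zero]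
  have e : √((w : ℝ) / v) * ((√(2 * Real.pi * w))⁻¹ * Real.exp (-x ^ 2 / (2 * w))) =
      (√(2 * Real.pi * v))⁻¹ * Real.exp (-x ^ 2 / (2 * w)) := by
    have hpi : (0 : ℝ) < 2 * Real.pi := by positivity
    rw [Real.sqrt_div hw'.le, Real.sqrt_mul hpi.le, Real.sqrt_mul hpi.le]
    have h1 := (Real.sqrt_pos.2 hw').ne'
    have h2 := (Real.sqrt_pos.2 hv').ne'
    have h3 := (Real.sqrt_pos.2 hpi).ne'
    generalize √(2 * Real.pi) = c at h3 ⊢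
    field_simp
  rw [e]
  refine mul_le_mul_of_nonneg_left (Real.exp_le_exp.2 ?_) (by positivity)
  rw [neg_div, neg_div, neg_le_neg_iff]
  gcongr

lemma map_smul_gaussianReal (d : ι → ℝ) (v : NNReal) :
    (gaussianReal 0 v).map (fun x => x • (WithLp.toLp 2 d : EuclideanSpace ℝ ι)) =
      multivariateGaussian 0 ((v : ℝ) • vecMulVec d d) := by
  have hpsd : ((v : ℝ) • vecMulVec d d).PosSemidef := by
    have := posSemidef_vecMulVec_self_star d
    rw [star_trivial] at this
    exact this.smul v.2
  have hm : Measurable fun x : ℝ => x • (WithLp.toLp 2 d : EuclideanSpace ℝ ι) := by fun_prop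
  have : IsProbabilityMeasure ((gaussianReal 0 v).map
      (fun x => x • (WithLp.toLp 2 d : EuclideanSpace ℝ ι))) :=
    Measure.isProbabilityMeasure_map hm.aemeasurable
  apply Measure.ext_of_charFun
  ext x
  rw [charFun_multivariateGaussian hpsd, charFun_apply, integral_map hm.aemeasurable
    (by fun_prop)]
  have h := charFun_gaussianReal (μ := 0) (v := v) (d ⬝ᵥ x.ofLp)
  rw [charFun_apply_real] at h
  have e : ∀ y : ℝ, inner ℝ (y • (WithLp.toLp 2 d : EuclideanSpace ℝ ι)) x =
      (d ⬝ᵥ x.ofLp) * y := fun y => by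
    rw [inner_smul_left, EuclideanSpace.inner_eq_star_dotProduct, star_trivial, dotProduct_comm]
    simp [mul_comm]
  simp_rw [e]
  push_cast
  rw [h, smul_mulVec, dotProduct_smul, vecMulVec_mulVec, dotProduct_smul]
  congr 1
  rw [dotProduct_comm x.ofLp d]
  simp
  left
  ring

/-- Domination survives convolution with the constants multiplying, so the number of summands
matters and the dimension does not. -/
lemma multivariateGaussian_sum_le_smul {κ : Type*} (s : Finset κ) (K L : κ → Matrix ι ι ℝ)
    (hK : ∀ i, (K i).PosSemidef) (hL : ∀ i, (L i).PosSemidef) {ρ : ℝ≥0∞}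
    (h : ∀ i, multivariateGaussian (0 : EuclideanSpace ℝ ι) (K i) ≤
      ρ • multivariateGaussian 0 (L i)) :
    multivariateGaussian (0 : EuclideanSpace ℝ ι) (∑ i ∈ s, K i) ≤
      ρ ^ s.card • multivariateGaussian 0 (∑ i ∈ s, L i) := by
  classical
  induction s using Finset.induction_on with
  | empty => simp
  | insert a s ha ih =>
    rw [Finset.sum_insert ha, Finset.sum_insert ha, Finset.card_insert_of_notMem ha,
      ← multivariateGaussian_conv (hK a) (posSemidef_sum s fun i _ => hK i),
      ← multivariateGaussian_conv (hL a) (posSemidef_sum s fun i _ => hL i), Measure.conv,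
      Measure.conv, ← Measure.map_smul, pow_succ']
    refine Measure.map_mono ?_ (by fun_prop)
    refine Measure.le_iff.2 fun B hB => ?_
    rw [Measure.smul_apply, Measure.prod_apply hB, Measure.prod_apply hB]
    calc ∫⁻ x, multivariateGaussian 0 (∑ i ∈ s, K i) (Prod.mk x ⁻¹' B)
          ∂(multivariateGaussian 0 (K a)) ≤
          ∫⁻ x, ρ ^ s.card * multivariateGaussian 0 (∑ i ∈ s, L i) (Prod.mk x ⁻¹' B)
            ∂(ρ • multivariateGaussian 0 (L a)) :=
          lintegral_mono' (h a) fun x => ih _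
      _ = _ := by
          rw [lintegral_smul_measure, lintegral_const_mul _ (measurable_measure_prodMk_left hB),
            smul_eq_mul, smul_eq_mul, mul_assoc]

/-- The matrix `∑ v_i d_i d_iᵀ`. -/
noncomputable def gramSum {κ : Type*} [Fintype κ] (v : κ → ℝ) (d : κ → ι → ℝ) : Matrix ι ι ℝ :=
  ∑ i, v i • vecMulVec (d i) (d i)

/-- Each rank-one summand is the image of a one-dimensional Gaussian law, which is dominated with
constant `√(w i / v i) ≤ ρ`. The vectors `d i` may be arbitrarily large and high-dimensional. -/
lemma levyProkhorovDist_gaussianMaxLaw_gramSum_le {κ : Type*} [Fintype κ] {v w : κ → ℝ}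
    (d : κ → ι → ℝ) {ρ : ℝ} (hρ : 1 ≤ ρ) (hv : ∀ i, 0 < v i) (hvw : ∀ i, v i ≤ w i)
    (hwv : ∀ i, w i ≤ ρ ^ 2 * v i) :
    levyProkhorovDist (gaussianMaxLaw (gramSum v d)) (gaussianMaxLaw (gramSum w d)) ≤
      ρ ^ Fintype.card κ - 1 := by
  have hw : ∀ i, 0 < w i := fun i => (hv i).trans_le (hvw i)
  refine levyProkhorovDist_le_of_le_smul (by linarith [one_le_pow₀ hρ (n := Fintype.card κ)]) ?_
  rw [add_sub_cancel, gaussianMaxLaw, gaussianMaxLaw, ← Measure.map_smul]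
  refine Measure.map_mono ?_ continuous_iSup_apply.measurable
  have hpsd : ∀ u : κ → ℝ, (∀ i, 0 < u i) → ∀ i, (u i • vecMulVec (d i) (d i)).PosSemidef :=
    fun u hu i => by
      have := posSemidef_vecMulVec_self_star (d i)
      rw [star_trivial] at this
      exact this.smul (hu i).le
  rw [ENNReal.ofReal_pow (by linarith)]
  refine multivariateGaussian_sum_le_smul Finset.univ _ _ (hpsd v hv) (hpsd w hw) fun i => ?_
  have e : ∀ (u : κ → ℝ) (hu : 0 ≤ u i), multivariateGaussian (0 : EuclideanSpace ℝ ι)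
      (u i • vecMulVec (d i) (d i)) = (gaussianReal 0 ⟨u i, hu⟩).map
        (fun x => x • (WithLp.toLp 2 (d i) : EuclideanSpace ℝ ι)) := fun u hu =>
    (map_smul_gaussianReal (d i) ⟨u i, hu⟩).symm
  rw [e v (hv i).le, e w (hw i).le, ← Measure.map_smul]
  refine Measure.map_mono ?_ (by fun_prop)
  refine (gaussianReal_le_smul (v := ⟨v i, (hv i).le⟩) (w := ⟨w i, (hw i).le⟩) (hv i)
    (hvw i)).trans fun B => ?_
  rw [Measure.smul_apply, Measure.smul_apply]
  refine mul_le_mul_left (ENNReal.ofReal_le_ofReal ?_) _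
  rw [Real.sqrt_le_left (by linarith)]
  exact (div_le_iff₀ (hv i)).2 (hwv i)

end GaussianDomination

/-! ### Covariances of the SRHT for fixed signs. -/

section WalshHadamard

variable {Ω : Type*} [MeasurableSpace Ω] {P : Measure Ω} {t m d d' : ℕ}

lemma abs_walshHadamard (m : ℕ) (u l : Fin (2 ^ m)) : |walshHadamard m u l| = 1 := by
  induction m with
  | zero => simp [walshHadamard]
  | succ m ih =>
    simp only [walshHadamard, reindex_apply, submatrix_apply]
    generalize (Equiv.symm _) u = u'
    generalize (Equiv.symm _) l = l'
    rcases u' with u' | u' <;> rcases l' with l' | l' <;> simp [ih]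

/-- The SRHT matrix with sampling matrix `q` and signs `e`. -/
noncomputable def srhtMatrix (e : Fin (2 ^ m) → ℝ) (q : Matrix (Fin t) (Fin (2 ^ m)) ℝ) :
    Matrix (Fin t) (Fin (2 ^ m)) ℝ :=
  q * ((1 / √((2 : ℝ) ^ m)) • walshHadamard m) * Matrix.diagonal e

/-- The possible rows `e_u / √(t / n)` of the sampling matrix. -/
noncomputable def sampleRow (t : ℕ) {m : ℕ} (u : Fin (2 ^ m)) : Fin (2 ^ m) → ℝ :=
  Pi.single u (1 / √((t : ℝ) / (2 : ℝ) ^ m))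

lemma sampleRow_injective [NeZero t] : Function.Injective (sampleRow t (m := m)) := by
  have ht : (0 : ℝ) < t := by exact_mod_cast Nat.pos_of_ne_zero (NeZero.ne t)
  intro u v h
  by_contra huv
  have h1 := congrFun h u
  have h2 : (1 : ℝ) / √((t : ℝ) / (2 : ℝ) ^ m) ≠ 0 := by positivity
  rw [sampleRow, sampleRow, Pi.single_eq_same, Pi.single_eq_of_ne huv] at h1
  exact h2 h1

/-- The dyad that belongs to the index `u` and the signs `e`. -/
noncomputable def rowDyad (A : Matrix (Fin (2 ^ m)) (Fin d) ℝ) (B : Matrix (Fin (2 ^ m)) (Fin d') ℝ)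
    (e : Fin (2 ^ m) → ℝ) (u : Fin (2 ^ m)) : Matrix (Fin d) (Fin d') ℝ :=
  Matrix.of fun j k => columnForm A (fun l => walshHadamard m u l * e l) j *
    columnForm B (fun l => walshHadamard m u l * e l) k

lemma dyad_srhtMatrix [NeZero t] (A : Matrix (Fin (2 ^ m)) (Fin d) ℝ)
    (B : Matrix (Fin (2 ^ m)) (Fin d') ℝ) (e : Fin (2 ^ m) → ℝ)
    {q : Matrix (Fin t) (Fin (2 ^ m)) ℝ} {i : Fin t} {u : Fin (2 ^ m)} (h : q i = sampleRow t u) :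
    dyad A B (srhtMatrix e q) i = rowDyad A B e u := by
  have ht : (0 : ℝ) < t := by exact_mod_cast Nat.pos_of_ne_zero (NeZero.ne t)
  have hrow : scaledRow (srhtMatrix e q) i = fun l => walshHadamard m u l * e l := by
    ext l
    rw [scaledRow, srhtMatrix, mul_diagonal, mul_apply, h]
    simp only [sampleRow, Pi.single_apply, ite_mul, zero_mul, Finset.sum_ite_eq', Finset.mem_univ,
      if_true, Matrix.smul_apply, smul_eq_mul]
    have h1 : √(t : ℝ) ≠ 0 := (Real.sqrt_pos.2 ht).ne'
    have h2 : √((2 : ℝ) ^ m) ≠ 0 := (Real.sqrt_pos.2 (by positivity)).ne'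
    rw [Real.sqrt_div ht.le]
    field_simp
  ext j k
  rw [dyad_apply, hrow, rowDyad, of_apply]

lemma measurable_srhtMatrix (e : Fin (2 ^ m) → ℝ) :
    Measurable (srhtMatrix (t := t) e) := by
  refine measurable_pi_lambda (δ := Fin t) (X := fun _ => Fin (2 ^ m) → ℝ) _ fun i =>
    measurable_pi_lambda _ fun l => ?_
  have h : ∀ q : Matrix (Fin t) (Fin (2 ^ m)) ℝ, srhtMatrix e q i l =
      (∑ k, q i k * ((1 / √((2 : ℝ) ^ m)) • walshHadamard m) k l) * e l := fun q => by
    rw [srhtMatrix, mul_diagonal, mul_apply]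
  simp only [h]
  exact (Finset.measurable_fun_sum _ fun k _ => (measurable_entry i k).mul_const _).mul_const _

lemma ae_exists_eq_of_map_eq {β κ : Type*} [MeasurableSpace β] [MeasurableSingletonClass β]
    [Fintype κ] {X : Ω → β} (hX : Measurable X) {w : κ → ℝ≥0∞} {x : κ → β}
    (h : P.map X = ∑ l, w l • Measure.dirac (x l)) : ∀ᵐ ω ∂P, ∃ l, X ω = x l := by
  have hm : MeasurableSet {y | ∃ l, y = x l} := by
    have : {y | ∃ l, y = x l} = Set.range x := by
      ext y
      exact exists_congr fun l => eq_comm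
    rw [this]
    exact (Set.finite_range x).measurableSet
  refine (ae_map_iff hX.aemeasurable hm).1 ?_
  rw [h, ae_iff, Measure.finsetSum_apply]
  refine Finset.sum_eq_zero fun l _ => ?_
  have hm' : MeasurableSet {y | ¬ ∃ l, y = x l} := hm.compl
  rw [Measure.smul_apply, Measure.dirac_apply' _ hm', Set.indicator_of_notMem, smul_zero]
  exact fun h => h ⟨l, rfl⟩

lemma integral_comp_of_map_eq {β κ : Type*} [MeasurableSpace β] [Fintype κ] {X : Ω → β}
    (hX : Measurable X) {w : κ → ℝ≥0∞} (hw : ∀ l, w l ≠ ∞) {x : κ → β}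
    (h : P.map X = ∑ l, w l • Measure.dirac (x l)) {g : β → ℝ} (hg : Measurable g) :
    ∫ ω, g (X ω) ∂P = ∑ l, (w l).toReal * g (x l) := by
  have hi : ∀ l, Integrable g (Measure.dirac (x l)) := fun l =>
    integrable_dirac' hg.stronglyMeasurable (by simp)
  rw [← integral_map hX.aemeasurable hg.aestronglyMeasurable, h,
    integral_finsetSum_measure fun l _ => (hi l).smul_measure (hw l)]
  refine Finset.sum_congr rfl fun l _ => ?_
  rw [integral_smul_measure, integral_dirac' _ _ hg.stronglyMeasurable, smul_eq_mul]

/-- The signed differences of the dyads of two indices. -/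
noncomputable def dyadDiff (A : Matrix (Fin (2 ^ m)) (Fin d) ℝ)
    (B : Matrix (Fin (2 ^ m)) (Fin d') ℝ) (e : Fin (2 ^ m) → ℝ)
    (p : Fin (2 ^ m) × Fin (2 ^ m)) (j : Triple d d') : ℝ :=
  signedEntry j (rowDyad A B e p.1) - signedEntry j (rowDyad A B e p.2)

/-- A covariance is half the mean product of the differences between two independent copies. This
removes the centring and exhibits the covariance as a sum of rank-one matrices with weights `p u * p
v / 2`. -/
lemma sum_mul_sub_mul_sub {κ : Type*} [Fintype κ] (p a b : κ → ℝ) (hp : ∑ u, p u = 1) :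
    ∑ x : κ × κ, p x.1 * p x.2 / 2 * ((a x.1 - a x.2) * (b x.1 - b x.2)) =
      ∑ u, p u * (a u * b u) - (∑ u, p u * a u) * ∑ u, p u * b u := by
  have h1 : ∀ f g : κ → ℝ, ∑ x : κ × κ, f x.1 * g x.2 = (∑ u, f u) * ∑ u, g u := fun f g => by
    rw [Fintype.sum_prod_type, Finset.sum_mul_sum]
  have h2 : ∀ x : κ × κ, p x.1 * p x.2 / 2 * ((a x.1 - a x.2) * (b x.1 - b x.2)) =
      (1 / 2) * (p x.1 * (a x.1 * b x.1) * p x.2) + (1 / 2) * (p x.1 * (p x.2 * (a x.2 * b x.2))) -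
        ((1 / 2) * (p x.1 * a x.1 * (p x.2 * b x.2)) +
          (1 / 2) * (p x.1 * b x.1 * (p x.2 * a x.2))) := fun x => by ring
  simp only [h2, Finset.sum_add_distrib, Finset.sum_sub_distrib, ← Finset.mul_sum]
  rw [h1 (fun u => p u * (a u * b u)) p, h1 p fun u => p u * (a u * b u),
    h1 (fun u => p u * a u) fun u => p u * b u, h1 (fun u => p u * b u) fun u => p u * a u, hp]
  ring

lemma gramSum_dyadDiff_apply (A : Matrix (Fin (2 ^ m)) (Fin d) ℝ)
    (B : Matrix (Fin (2 ^ m)) (Fin d') ℝ) (e : Fin (2 ^ m) → ℝ) {p : Fin (2 ^ m) → ℝ}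
    (hp : ∑ u, p u = 1) (j k : Triple d d') :
    gramSum (fun x => p x.1 * p x.2 / 2) (dyadDiff A B e) j k =
      ((j.2.2 : ℤ) : ℝ) * ((k.2.2 : ℤ) : ℝ) *
        (∑ u, p u * (rowDyad A B e u j.1 j.2.1 * rowDyad A B e u k.1 k.2.1) -
          (∑ u, p u * rowDyad A B e u j.1 j.2.1) * ∑ u, p u * rowDyad A B e u k.1 k.2.1) := by
  rw [← sum_mul_sub_mul_sub p _ _ hp, gramSum, Matrix.sum_apply, Finset.mul_sum]
  refine Finset.sum_congr rfl fun x _ => ?_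
  simp only [Matrix.smul_apply, vecMulVec_apply, dyadDiff, signedEntry, smul_eq_mul]
  ring

/-- The relative frequency of the index `u` among the sampled rows. -/
noncomputable def sampleFreq (q : Matrix (Fin t) (Fin (2 ^ m)) ℝ) (u : Fin (2 ^ m)) : ℝ :=
  (1 / (t : ℝ)) * ∑ i, if q i = sampleRow t u then 1 else 0

lemma sum_sampleFreq_mul [NeZero t] {q : Matrix (Fin t) (Fin (2 ^ m)) ℝ}
    {idx : Fin t → Fin (2 ^ m)} (hq : ∀ i, q i = sampleRow t (idx i)) (g : Fin (2 ^ m) → ℝ) :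
    ∑ u, sampleFreq q u * g u = (1 / (t : ℝ)) * ∑ i, g (idx i) := by
  simp only [sampleFreq, hq, sampleRow_injective.eq_iff, mul_assoc, Finset.sum_mul, ite_mul,
    one_mul, zero_mul]
  rw [← Finset.mul_sum, Finset.sum_comm]
  simp

lemma sum_sampleFreq [NeZero t] {q : Matrix (Fin t) (Fin (2 ^ m)) ℝ}
    {idx : Fin t → Fin (2 ^ m)} (hq : ∀ i, q i = sampleRow t (idx i)) :
    ∑ u, sampleFreq q u = 1 := by
  have ht : (t : ℝ) ≠ 0 := by exact_mod_cast NeZero.ne t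
  have := sum_sampleFreq_mul hq fun _ => 1
  simpa [ht] using this

/-- The sampled rows enter only through their frequencies: the vectors are the same as for the true
covariance in `dyadCov_srhtMatrix`, where the weights are uniform. -/
lemma empCov_srhtMatrix [NeZero t] (A : Matrix (Fin (2 ^ m)) (Fin d) ℝ)
    (B : Matrix (Fin (2 ^ m)) (Fin d') ℝ) (e : Fin (2 ^ m) → ℝ)
    {q : Matrix (Fin t) (Fin (2 ^ m)) ℝ} {idx : Fin t → Fin (2 ^ m)}
    (hq : ∀ i, q i = sampleRow t (idx i)) :
    empCov A B (srhtMatrix e q) =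
      gramSum (fun x => sampleFreq q x.1 * sampleFreq q x.2 / 2) (dyadDiff A B e) := by
  ext j k
  rw [gramSum_dyadDiff_apply A B e (sum_sampleFreq hq), empCov_apply, sum_sampleFreq_mul hq,
    sum_sampleFreq_mul hq, sum_sampleFreq_mul hq]
  simp only [dyad_srhtMatrix A B e (hq _)]

lemma ae_exists_idx {Q : Ω → Matrix (Fin t) (Fin (2 ^ m)) ℝ} (hQ : Measurable Q)
    (hlaw : ∀ i, P.map (fun ω => Q ω i) =
      ∑ u, ENNReal.ofReal (1 / (2 : ℝ) ^ m) • Measure.dirac (sampleRow t u)) :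
    ∀ᵐ ω ∂P, ∃ idx : Fin t → Fin (2 ^ m), ∀ i, Q ω i = sampleRow t (idx i) := by
  have h1 : ∀ i, ∀ᵐ ω ∂P, ∃ u, Q ω i = sampleRow t u := fun i =>
    ae_exists_eq_of_map_eq (measurable_row hQ i) (hlaw i)
  filter_upwards [ae_all_iff.2 h1] with ω hω
  exact Classical.skolem.1 hω

lemma dyadCov_srhtMatrix [NeZero t] [IsProbabilityMeasure P]
    {Q : Ω → Matrix (Fin t) (Fin (2 ^ m)) ℝ} (hQ : Measurable Q)
    (hlaw : ∀ i, P.map (fun ω => Q ω i) =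
      ∑ u, ENNReal.ofReal (1 / (2 : ℝ) ^ m) • Measure.dirac (sampleRow t u))
    (A : Matrix (Fin (2 ^ m)) (Fin d) ℝ) (B : Matrix (Fin (2 ^ m)) (Fin d') ℝ)
    (e : Fin (2 ^ m) → ℝ) :
    dyadCov P A B (fun ω => srhtMatrix e (Q ω)) =
      gramSum (fun _ => (1 / (2 : ℝ) ^ m) * (1 / (2 : ℝ) ^ m) / 2) (dyadDiff A B e) := by
  have hsum : ∑ _u : Fin (2 ^ m), 1 / (2 : ℝ) ^ m = 1 := by simp
  let w : (Fin (2 ^ m) → ℝ) → Fin (2 ^ m) → ℝ := fun r l =>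
    √(t : ℝ) * ((r ᵥ* ((1 / √((2 : ℝ) ^ m)) • walshHadamard m)) l * e l)
  have hw : Measurable w := by
    refine measurable_pi_lambda _ fun l => ?_
    simp only [w, vecMul, dotProduct]
    fun_prop
  -- The dyad entries as functions of the first sampling row alone, so that expectations become
  -- finite sums over its possible values.
  let G : Fin d → Fin d' → (Fin (2 ^ m) → ℝ) → ℝ := fun j k r =>
    columnForm A (w r) j * columnForm B (w r) k
  have hform : ∀ {c : ℕ} (N : Matrix (Fin (2 ^ m)) (Fin c) ℝ) (i : Fin c),
      Measurable fun r => columnForm N (w r) i := fun N i => by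
    have hl := fun l => (measurable_pi_apply (X := fun _ : Fin (2 ^ m) => ℝ) l).comp hw
    exact Finset.measurable_fun_sum _ fun l _ => (hl l).const_mul _
  have hG : ∀ j k, Measurable (G j k) := fun j k => (hform A j).mul (hform B k)
  have hGd : ∀ (q : Matrix (Fin t) (Fin (2 ^ m)) ℝ) j k,
      dyad A B (srhtMatrix e q) 0 j k = G j k (q 0) := fun q j k => by
    rw [dyad_apply]
    have : scaledRow (srhtMatrix e q) 0 = w (q 0) := by
      ext l
      simp only [scaledRow, srhtMatrix, mul_diagonal, w]
      rfl
    rw [this]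
  have hGr : ∀ u j k, G j k (sampleRow t u) = rowDyad A B e u j k := fun u j k => by
    have := hGd (fun _ => sampleRow t u) j k
    rw [← this, dyad_srhtMatrix A B e (q := fun _ => sampleRow t u) (i := 0) rfl]
  have hint : ∀ g : (Fin (2 ^ m) → ℝ) → ℝ, Measurable g →
      ∫ ω, g (Q ω 0) ∂P = ∑ u, 1 / (2 : ℝ) ^ m * g (sampleRow t u) := fun g hg => by
    rw [integral_comp_of_map_eq (measurable_row hQ 0)
      (fun _ => ENNReal.ofReal_ne_top) (hlaw 0) hg]
    refine Finset.sum_congr rfl fun u _ => ?_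
    rw [ENNReal.toReal_ofReal (by positivity)]
  have hmem : ∀ j k, MemLp (fun ω => G j k (Q ω 0)) 2 P := fun j k => by
    refine MemLp.of_bound ((hG j k).comp (measurable_row hQ 0)).aestronglyMeasurable
      (∑ u, |rowDyad A B e u j k|) ?_
    filter_upwards [ae_exists_idx hQ hlaw] with ω ⟨idx, hidx⟩
    rw [hidx, hGr, Real.norm_eq_abs]
    exact Finset.single_le_sum (f := fun u => |rowDyad A B e u j k|) (fun _ _ => abs_nonneg _)
      (Finset.mem_univ _)
  ext j k
  rw [gramSum_dyadDiff_apply A B e hsum, dyadCov_apply]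
  simp only [hGd]
  rw [covariance_eq_sub (hmem _ _) (hmem _ _)]
  simp only [Pi.mul_apply]
  rw [hint (fun r => G j.1 j.2.1 r * G k.1 k.2.1 r) ((hG _ _).mul (hG _ _)), hint _ (hG _ _), hint _ (hG _ _)]
  simp only [hGr]

end WalshHadamard

/-! ### Conditioning on the signs. -/

section SignConditioning

variable {Ω : Type*} [MeasurableSpace Ω] {P : Measure Ω} {t m d d' : ℕ}

instance instMeasurableSingletonClassMatrix {k l : Type*} [Countable k] [Countable l] :
    MeasurableSingletonClass (Matrix k l ℝ) :=
  inferInstanceAs (MeasurableSingletonClass (k → l → ℝ))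

/-- Conditioning on finitely many good values of `X`. Neither `T` nor `B x` is assumed measurable;
intersecting with the finite set `F` of values of `Y` restores the measurability that independence
needs. -/
lemma measure_le_add_of_indepFun [IsProbabilityMeasure P] {α β : Type*} [MeasurableSpace α]
    [MeasurableSpace β] [MeasurableSingletonClass α] [MeasurableSingletonClass β] {X : Ω → α}
    {Y : Ω → β} (hX : Measurable X) (hXY : IndepFun X Y P) {F : Set β}
    (hF : F.Finite) (hYF : ∀ᵐ ω ∂P, Y ω ∈ F) (G : Finset α) (B : α → Set β) {δ : ℝ≥0∞}
    (hB : ∀ x ∈ G, P (Y ⁻¹' B x) ≤ δ) {T : Set Ω}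
    (hT : ∀ᵐ ω ∂P, ω ∈ T → X ω ∈ G → Y ω ∈ B (X ω)) : P T ≤ δ + P {ω | X ω ∉ G} := by
  have h1 : P T ≤ P ((⋃ x ∈ G, X ⁻¹' {x} ∩ Y ⁻¹' (B x ∩ F)) ∪ {ω | X ω ∉ G}) := by
    refine measure_mono_ae ?_
    filter_upwards [hYF, hT] with ω h1 h2 h3
    by_cases hG : X ω ∈ G
    · exact Or.inl (Set.mem_biUnion hG ⟨rfl, h2 h3 hG, h1⟩)
    · exact Or.inr hG
  refine h1.trans ((measure_union_le _ _).trans ?_)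
  gcongr
  calc P (⋃ x ∈ G, X ⁻¹' {x} ∩ Y ⁻¹' (B x ∩ F)) ≤
        ∑ x ∈ G, P (X ⁻¹' {x} ∩ Y ⁻¹' (B x ∩ F)) := measure_biUnion_finset_le _ _
    _ ≤ ∑ x ∈ G, P (X ⁻¹' {x}) * δ := by
        refine Finset.sum_le_sum fun x hx => ?_
        rw [hXY.measure_inter_preimage_eq_mul _ _ (measurableSet_singleton x)
          (hF.subset Set.inter_subset_right).measurableSet]
        gcongr
        exact (measure_mono (Set.preimage_mono Set.inter_subset_left)).trans (hB x hx)
    _ = P (X ⁻¹' ↑G) * δ := by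
        rw [← Finset.sum_mul, sum_measure_preimage_singleton G fun x _ =>
          hX (measurableSet_singleton x)]
    _ ≤ δ := mul_le_of_le_one_left' prob_le_one

lemma IsSRHT.ae_sign {D : Ω → Matrix (Fin (2 ^ m)) (Fin (2 ^ m)) ℝ} {ε : Ω → Fin (2 ^ m) → ℝ}
    {Q S : Ω → Matrix (Fin t) (Fin (2 ^ m)) ℝ} (h : IsSRHT P D ε Q S) :
    ∀ᵐ ω ∂P, ∀ l, ε ω l = 1 ∨ ε ω l = -1 := by
  refine ae_all_iff.2 fun l => ?_
  have h1 := ae_exists_eq_of_map_eq ((measurable_pi_apply l).comp h.measurable_sign)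
    (w := fun _ : Fin 2 => (1 / 2 : ℝ≥0∞)) (x := ![(1 : ℝ), -1])
    ((h.law_sign l).trans (by simp [Fin.sum_univ_two]))
  filter_upwards [h1] with ω ⟨k, hk⟩
  fin_cases k
  · exact Or.inl hk
  · exact Or.inr hk

lemma finite_setOf_sign (n : ℕ) : {e : Fin n → ℝ | ∀ l, e l = 1 ∨ e l = -1}.Finite := by
  refine (Set.Finite.pi' fun _ : Fin n => Set.toFinite {(1 : ℝ), -1}).subset fun e he l => ?_
  exact he l

/-- Given `D`, the signs are frozen, while by independence each sampling row keeps its law, and the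
covariance depends on nothing else. -/
lemma IsSRHT.dyadCov_cond [NeZero t] [IsProbabilityMeasure P]
    {D : Ω → Matrix (Fin (2 ^ m)) (Fin (2 ^ m)) ℝ} {ε : Ω → Fin (2 ^ m) → ℝ}
    {Q S : Ω → Matrix (Fin t) (Fin (2 ^ m)) ℝ} (h : IsSRHT P D ε Q S)
    (A : Matrix (Fin (2 ^ m)) (Fin d) ℝ) (B : Matrix (Fin (2 ^ m)) (Fin d') ℝ)
    {e : Fin (2 ^ m) → ℝ} (he : P (ε ⁻¹' {e}) ≠ 0) :
    dyadCov (cond P (D ⁻¹' {Matrix.diagonal e})) A B S =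
      dyadCov P A B (fun ω => srhtMatrix e (Q ω)) := by
  have hDe : D ⁻¹' {Matrix.diagonal e} = ε ⁻¹' {e} := by
    ext ω
    simp only [Set.mem_preimage, Set.mem_singleton_iff, h.diag_eq]
    exact Matrix.diagonal_injective.eq_iff
  have hme : MeasurableSet (ε ⁻¹' {e}) := h.measurable_sign (measurableSet_singleton e)
  rw [hDe]
  have : IsProbabilityMeasure (cond P (ε ⁻¹' {e})) := cond_isProbabilityMeasure he
  have hlaw : ∀ i, (cond P (ε ⁻¹' {e})).map (fun ω => Q ω i) =
      ∑ u, ENNReal.ofReal (1 / (2 : ℝ) ^ m) • Measure.dirac (sampleRow t u) := fun i => by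
    refine Eq.trans ?_ (h.law_sample i)
    ext s hs
    have hrow := measurable_row h.measurable_sample i
    rw [Measure.map_apply hrow hs, Measure.map_apply hrow hs, cond_apply hme]
    have hi : IndepFun ε (fun ω => Q ω i) P := h.indep.comp measurable_id
      (measurable_pi_apply (X := fun _ : Fin t => Fin (2 ^ m) → ℝ) i)
    rw [hi.measure_inter_preimage_eq_mul _ _ (measurableSet_singleton e) hs, ← mul_assoc,
      ENNReal.inv_mul_cancel he (measure_ne_top _ _), one_mul]
  have hcongr : dyadCov (cond P (ε ⁻¹' {e})) A B S =
      dyadCov (cond P (ε ⁻¹' {e})) A B (fun ω => srhtMatrix e (Q ω)) := by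
    have hS : ∀ᵐ ω ∂(cond P (ε ⁻¹' {e})), S ω = srhtMatrix e (Q ω) := by
      filter_upwards [ae_cond_mem hme] with ω hω
      rw [h.sketch_eq, h.diag_eq, show ε ω = e from hω, srhtMatrix]
    ext j k
    simp only [dyadCov, of_apply, covariance]
    have hj : ∀ j : Triple d d', (fun ω => signedEntry j (dyad A B (S ω) 0))
        =ᵐ[cond P (ε ⁻¹' {e})] fun ω => signedEntry j (dyad A B (srhtMatrix e (Q ω)) 0) :=
      fun j => by filter_upwards [hS] with ω hω using by rw [hω]
    rw [integral_congr_ae (hj j), integral_congr_ae (hj k)]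
    refine integral_congr_ae ?_
    filter_upwards [hS] with ω hω using by rw [hω]
  rw [hcongr, dyadCov_srhtMatrix h.measurable_sample hlaw,
    dyadCov_srhtMatrix h.measurable_sample h.law_sample]

lemma IsSRHT.measure_levyProkhorovDist_le [NeZero t] [IsProbabilityMeasure P]
    {D : Ω → Matrix (Fin (2 ^ m)) (Fin (2 ^ m)) ℝ} {ε : Ω → Fin (2 ^ m) → ℝ}
    {Q S : Ω → Matrix (Fin t) (Fin (2 ^ m)) ℝ} (h : IsSRHT P D ε Q S)
    (A : Matrix (Fin (2 ^ m)) (Fin d) ℝ) (B : Matrix (Fin (2 ^ m)) (Fin d') ℝ) {r : ℝ} {δ : ℝ≥0∞}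
    (good : (Fin (2 ^ m) → ℝ) → Prop)
    (hδ : ∀ e : Fin (2 ^ m) → ℝ, (∀ l, e l = 1 ∨ e l = -1) → good e →
      P {ω | ¬ levyProkhorovDist (lawZ P A B (fun ω => srhtMatrix e (Q ω)))
        (gaussianMaxLaw (empCov A B (srhtMatrix e (Q ω)))) ≤ r} ≤ δ) :
    P {ω | ¬ levyProkhorovDist (condLawZ P A B S D ω) (gaussianMaxLaw (empCov A B (S ω))) ≤ r} ≤
      δ + P {ω | ¬ good (ε ω)} := by
  classical
  have hfin := finite_setOf_sign (2 ^ m)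
  -- Sign vectors of probability zero are discarded, since conditioning on them is meaningless;
  -- almost surely they do not occur.
  set G : Finset (Fin (2 ^ m) → ℝ) :=
    hfin.toFinset.filter fun e => good e ∧ P (ε ⁻¹' {e}) ≠ 0 with hG
  have hpos : ∀ᵐ ω ∂P, P (ε ⁻¹' {ε ω}) ≠ 0 := by
    have h1 : ∀ᵐ ω ∂P, ∀ e ∈ {e : Fin (2 ^ m) → ℝ | ∀ l, e l = 1 ∨ e l = -1},
        P (ε ⁻¹' {e}) = 0 → ε ω ≠ e := by
      refine (ae_ball_iff hfin.countable).2 fun e _ => ?_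
      by_cases h0 : P (ε ⁻¹' {e}) = 0
      · filter_upwards [measure_eq_zero_iff_ae_notMem.1 h0] with ω hω _ using hω
      · exact .of_forall fun ω h => absurd h h0
    filter_upwards [h1, h.ae_sign] with ω h1 h2 h3 using h1 _ h2 h3 rfl
  have hF : (Set.range fun (idx : Fin t → Fin (2 ^ m)) =>
      (Matrix.of fun i => sampleRow t (idx i) : Matrix (Fin t) (Fin (2 ^ m)) ℝ)).Finite :=
    Set.finite_range _
  refine (measure_le_add_of_indepFun (δ := δ) h.measurable_sign h.indep hF ?_ G
    (fun e => {q | ¬ levyProkhorovDist (lawZ P A B (fun ω => srhtMatrix e (Q ω)))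
      (gaussianMaxLaw (empCov A B (srhtMatrix e q))) ≤ r}) (fun e he => ?_)
    (.of_forall fun ω hω hGω => ?_)).trans ?_
  · filter_upwards [ae_exists_idx h.measurable_sample h.law_sample] with ω ⟨idx, hidx⟩
    exact ⟨idx, funext fun i => (hidx i).symm⟩
  · rw [hG, Finset.mem_filter, Set.Finite.mem_toFinset] at he
    exact hδ e he.1 he.2.1
  · rw [hG, Finset.mem_filter, Set.Finite.mem_toFinset] at hGω
    intro hle
    refine hω ?_
    rw [condLawZ, h.diag_eq, h.dyadCov_cond A B hGω.2.2, h.sketch_eq, h.diag_eq]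
    exact hle
  · gcongr 1
    refine measure_mono_ae ?_
    filter_upwards [hpos, h.ae_sign] with ω h1 h2 h3 h4
    refine h3 ?_
    rw [hG, Finset.mem_filter, Set.Finite.mem_toFinset]
    exact ⟨h2, h4, h1⟩

end SignConditioning

/-! ### Hoeffding bounds for the randomised Hadamard rows. -/

section SignTail

variable {Ω : Type*} [MeasurableSpace Ω] {P : Measure Ω} {t m d d' : ℕ}

lemma measure_le_abs_of_hasSubgaussianMGF [IsProbabilityMeasure P] {X : Ω → ℝ} {c : NNReal}
    (h : HasSubgaussianMGF X c P) {σ : ℝ} (hc : (c : ℝ) ≤ σ ^ 2) (hσ : 0 < σ) {x : ℝ}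
    (hx : 0 ≤ x) : P {ω | σ * x ≤ |X ω|} ≤ ENNReal.ofReal (2 * Real.exp (-x ^ 2 / 2)) := by
  have h' : HasSubgaussianMGF X ⟨σ ^ 2, sq_nonneg σ⟩ P :=
    ⟨h.integrable_exp_mul, fun s => (h.mgf_le s).trans (Real.exp_le_exp.2 (by
      have : (c : ℝ) * s ^ 2 ≤ σ ^ 2 * s ^ 2 := by gcongr
      change (c : ℝ) * s ^ 2 / 2 ≤ σ ^ 2 * s ^ 2 / 2
      linarith))⟩
  have hσx : 0 ≤ σ * x := by positivity
  have e : -(σ * x) ^ 2 / (2 * σ ^ 2) = -x ^ 2 / 2 := by field_simp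
  have e1 : P.real {ω | σ * x ≤ X ω} ≤ Real.exp (-x ^ 2 / 2) :=
    (h'.measure_ge_le hσx).trans_eq (congrArg Real.exp e)
  have e2 : P.real {ω | σ * x ≤ (-X) ω} ≤ Real.exp (-x ^ 2 / 2) :=
    (h'.neg.measure_ge_le hσx).trans_eq (congrArg Real.exp e)
  have sub : {ω | σ * x ≤ |X ω|} ⊆ {ω | σ * x ≤ X ω} ∪ {ω | σ * x ≤ (-X) ω} := fun ω hω =>
    le_abs.1 (show σ * x ≤ |X ω| from hω)
  refine (measure_mono sub).trans ((measure_union_le _ _).trans ?_)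
  rw [← ofReal_measureReal, ← ofReal_measureReal (s := {ω | σ * x ≤ (-X) ω}),
    ← ENNReal.ofReal_add (by positivity) (by positivity)]
  exact ENNReal.ofReal_le_ofReal (by linarith)

/-- Hoeffding's inequality for the linear forms of a row of the SRHT matrix. -/
lemma IsSRHT.measure_le_abs_columnForm [IsProbabilityMeasure P]
    {D : Ω → Matrix (Fin (2 ^ m)) (Fin (2 ^ m)) ℝ} {ε : Ω → Fin (2 ^ m) → ℝ}
    {Q S : Ω → Matrix (Fin t) (Fin (2 ^ m)) ℝ} (h : IsSRHT P D ε Q S)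
    (A : Matrix (Fin (2 ^ m)) (Fin d) ℝ) {α : ℝ} (hα : 0 < α) (u : Fin (2 ^ m)) (j : Fin d)
    (hA : ∑ l, A l j ^ 2 ≤ α ^ 2) {x : ℝ} (hx : 0 ≤ x) :
    P {ω | α * x ≤ |columnForm A (fun l => walshHadamard m u l * ε ω l) j|} ≤
      ENNReal.ofReal (2 * Real.exp (-x ^ 2 / 2)) := by
  have hm : ∀ l, Measurable fun ω => ε ω l := fun l =>
    (measurable_pi_apply l).comp h.measurable_sign
  have hlaw : ∀ l, P.map (fun ω => ε ω l) =
      ∑ k : Fin 2, (1 / 2 : ℝ≥0∞) • Measure.dirac ((![(1 : ℝ), -1]) k) := fun l =>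
    (h.law_sign l).trans (by simp [Fin.sum_univ_two])
  have hsub : ∀ l, HasSubgaussianMGF (fun ω => ε ω l) ((‖(1 : ℝ) - -1‖₊ / 2) ^ 2) P := fun l => by
    refine hasSubgaussianMGF_of_mem_Icc_of_integral_eq_zero (hm l).aemeasurable ?_ ?_
    · filter_upwards [h.ae_sign] with ω hω
      rcases hω l with e | e <;> rw [e] <;> norm_num
    · have := integral_comp_of_map_eq (hm l) (fun _ => by simp) (hlaw l) measurable_id
      simpa [Fin.sum_univ_two] using this
  have hind : iIndepFun (fun l ω => (A l j * walshHadamard m u l) * ε ω l) P :=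
    h.iIndep_sign.comp (fun l x => (A l j * walshHadamard m u l) * x) fun l => by fun_prop
  have hsum := HasSubgaussianMGF.sum_of_iIndepFun hind (s := Finset.univ)
    fun l _ => (hsub l).const_mul (A l j * walshHadamard m u l)
  have e : ∀ ω, columnForm A (fun l => walshHadamard m u l * ε ω l) j =
      ∑ l, (A l j * walshHadamard m u l) * ε ω l := fun ω => by
    simp only [columnForm, mul_assoc]
  simp only [e]
  refine measure_le_abs_of_hasSubgaussianMGF hsum ?_ hα hx
  rw [NNReal.coe_sum]
  have hone : (((‖(1 : ℝ) - -1‖₊ / 2) ^ 2 : NNReal) : ℝ) = 1 := by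
    push_cast
    rw [Real.norm_eq_abs]
    norm_num
  refine le_trans (le_of_eq ?_) hA
  refine Finset.sum_congr rfl fun l _ => ?_
  change (A l j * walshHadamard m u l) ^ 2 * (((‖(1 : ℝ) - -1‖₊ / 2) ^ 2 : NNReal) : ℝ) = _
  rw [hone, mul_one, mul_pow, ← sq_abs (walshHadamard m u l), abs_walshHadamard, one_pow, mul_one]

/-- The threshold `√(2 p log n)` makes each Gaussian tail equal to `n ^ (-p)`, before the union over
`n * d` linear forms. -/
lemma IsSRHT.measure_exists_lt_abs_columnForm [IsProbabilityMeasure P]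
    {D : Ω → Matrix (Fin (2 ^ m)) (Fin (2 ^ m)) ℝ} {ε : Ω → Fin (2 ^ m) → ℝ}
    {Q S : Ω → Matrix (Fin t) (Fin (2 ^ m)) ℝ} (h : IsSRHT P D ε Q S)
    (A : Matrix (Fin (2 ^ m)) (Fin d) ℝ) {α : ℝ} (hα : 0 < α)
    (hA : ∀ j, ∑ l, A l j ^ 2 ≤ α ^ 2) (p : ℕ) :
    P {ω | ∃ u j, α * √(2 * p * Real.log (2 ^ m)) <
        |columnForm A (fun l => walshHadamard m u l * ε ω l) j|} ≤
      ENNReal.ofReal (2 ^ m * d * (2 * (1 / ((2 : ℝ) ^ m) ^ p))) := by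
  have hlog : 0 ≤ Real.log (2 ^ m) := Real.log_nonneg (one_le_pow₀ (by norm_num))
  have hx : Real.exp (-√(2 * p * Real.log (2 ^ m)) ^ 2 / 2) = 1 / ((2 : ℝ) ^ m) ^ p := by
    rw [Real.sq_sqrt (by positivity), show -(2 * p * Real.log (2 ^ m)) / 2 =
      -(p * Real.log (2 ^ m)) by ring, Real.exp_neg, ← Real.log_pow, Real.exp_log (by positivity),
      one_div]
  have hsub : {ω | ∃ u j, α * √(2 * p * Real.log (2 ^ m)) <
        |columnForm A (fun l => walshHadamard m u l * ε ω l) j|} ⊆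
      ⋃ x : Fin (2 ^ m) × Fin d, {ω | α * √(2 * p * Real.log (2 ^ m)) ≤
        |columnForm A (fun l => walshHadamard m x.1 l * ε ω l) x.2|} := by
    rintro ω ⟨u, j, hω⟩
    exact Set.mem_iUnion.2 ⟨(u, j), hω.le⟩
  refine (measure_mono hsub).trans ((measure_iUnion_fintype_le _ _).trans
    ((Finset.sum_le_sum fun x _ => h.measure_le_abs_columnForm A hα x.1 x.2 (hA x.2)
      (Real.sqrt_nonneg _)).trans ?_))
  rw [hx, Finset.sum_const, Finset.card_univ, nsmul_eq_mul, ← ENNReal.ofReal_natCast,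
    ← ENNReal.ofReal_mul (by positivity)]
  refine ENNReal.ofReal_le_ofReal (le_of_eq ?_)
  simp

end SignTail

/-! ### SRHT with `t` at most `n^32`. -/

section FewSamples

lemma GrowthCondition.add_le_of_le_pow {C κ : ℝ} {d d' t : ℕ} (h : GrowthCondition C κ d d' t)
    (hκ : 1 ≤ κ) {n : ℝ} (hn : 1 ≤ n) (ht : (t : ℝ) ≤ n ^ 32) :
    (d : ℝ) + d' ≤ 2 * max C 1 * (max C 1) ^ κ * n ^ ⌈32 * κ⌉₊ := by
  have hC : 1 ≤ max C 1 := le_max_right _ _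
  have h1 : (d : ℝ) ≤ (max C 1) ^ κ * n ^ ⌈32 * κ⌉₊ := by
    refine (h.le_rpow hκ).trans ?_
    rw [Real.mul_rpow (by positivity) (Nat.cast_nonneg _)]
    gcongr
    calc (t : ℝ) ^ κ ≤ (n ^ 32) ^ κ := by gcongr
      _ = n ^ (32 * κ) := by
          rw [← Real.rpow_natCast, ← Real.rpow_mul (by positivity)]; norm_num
      _ ≤ n ^ ((⌈32 * κ⌉₊ : ℕ) : ℝ) := Real.rpow_le_rpow_of_exponent_le hn (Nat.le_ceil _)
      _ = _ := Real.rpow_natCast _ _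
  have h2 : (d' : ℝ) ≤ max C 1 * d :=
    h.d'_le.trans (mul_le_mul_of_nonneg_right (le_max_left _ _) (Nat.cast_nonneg _))
  have h3 : (d : ℝ) ≤ max C 1 * d := le_mul_of_one_le_left (Nat.cast_nonneg _) hC
  calc (d : ℝ) + d' ≤ 2 * max C 1 * d := by linarith
    _ ≤ 2 * max C 1 * ((max C 1) ^ κ * n ^ ⌈32 * κ⌉₊) := by gcongr
    _ = _ := by ring

/-- The SRHT case when `t` is at most polynomially large in `n`. -/
theorem exists_measure_levyProkhorovDist_srht_le_of_le_pow (C κ : ℝ) (hκ : 1 ≤ κ) :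
    ∃ c : ℝ, 0 < c ∧ ∀ (t m d d' : ℕ) [NeZero t], 2 ≤ d → GrowthCondition C κ d d' t →
      1 ≤ m → (t : ℝ) ≤ ((2 : ℝ) ^ m) ^ 32 →
      ∀ (A : Matrix (Fin (2 ^ m)) (Fin d) ℝ) (B : Matrix (Fin (2 ^ m)) (Fin d') ℝ),
        0 < nu A B → ∀ (Ω : Type*) [MeasurableSpace Ω] (P : Measure Ω) [IsProbabilityMeasure P]
        (D : Ω → Matrix (Fin (2 ^ m)) (Fin (2 ^ m)) ℝ) (ε : Ω → Fin (2 ^ m) → ℝ)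
        (Q S : Ω → Matrix (Fin t) (Fin (2 ^ m)) ℝ), IsSRHT P D ε Q S →
        P {ω | ¬ levyProkhorovDist (condLawZ P A B S D ω) (gaussianMaxLaw (empCov A B (S ω))) ≤
          c * bootRate (Real.log (2 ^ m) * nu A B) d t} ≤
          ENNReal.ofReal (1 / t + 1 / (d * d') + c / 2 ^ m) := by
  obtain ⟨c₀, hc₀, h₀⟩ := exists_measure_levyProkhorovDist_empCov_le C κ hκ zero_le_one
  -- There are `n * (d + d')` linear forms and `d + d'` is at most of order `n ^ ⌈32 * κ⌉₊`; the
  -- summand `2` pays for the factor `n` and leaves `1 / n`.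
  set p := ⌈32 * κ⌉₊ + 2 with hp
  set C₁ := 2 * max C 1 * (max C 1) ^ κ with hC₁
  have hC₁0 : 0 < C₁ := by
    have : 0 < max C 1 := lt_max_of_lt_right one_pos
    positivity
  have hp0 : (0 : ℝ) < p := by rw [hp]; positivity
  refine ⟨c₀ * (2 * p) ^ (1 / 2 : ℝ) + 2 * C₁, by positivity, ?_⟩
  intro t m d d' _ hd hg hm1 htn A B hν Ω _ P _ D ε Q S hS
  set n : ℝ := 2 ^ m with hn
  have hn2 : 2 ≤ n := by
    calc (2 : ℝ) = 2 ^ 1 := (pow_one 2).symm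
      _ ≤ 2 ^ m := pow_le_pow_right₀ (by norm_num) hm1
  have hlog : 0 < Real.log n := Real.log_pos (by linarith)
  set α := √(entryMax (Aᵀ * A)) with hα
  set β := √(entryMax (Bᵀ * B)) with hβ
  have hνeq : nu A B = α * β := nu_eq_mul A B
  have hαβ : 0 < α * β := hνeq ▸ hν
  have hα0 : 0 < α := pos_of_mul_pos_left hαβ (Real.sqrt_nonneg _)
  have hβ0 : 0 < β := pos_of_mul_pos_right hαβ (Real.sqrt_nonneg _)
  set L := 2 * p * Real.log n with hL
  have hL0 : 0 < L := by positivity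
  have hAα : ∀ j, ∑ l, A l j ^ 2 ≤ α ^ 2 := fun j =>
    (sum_sq_le_entryMax A j).trans_eq (Real.sq_sqrt (entryMax_nonneg _)).symm
  have hBβ : ∀ j, ∑ l, B l j ^ 2 ≤ β ^ 2 := fun j =>
    (sum_sq_le_entryMax B j).trans_eq (Real.sq_sqrt (entryMax_nonneg _)).symm
  have hrate : bootRate (L * nu A B) d t =
      (2 * p) ^ (1 / 2 : ℝ) * bootRate (Real.log n * nu A B) d t := by
    rw [hL, mul_assoc (2 * (p : ℝ)), bootRate_mul (by positivity) (by positivity)]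
  have hmain := hS.measure_levyProkhorovDist_le A B
    (r := (c₀ * (2 * p) ^ (1 / 2 : ℝ) + 2 * C₁) * bootRate (Real.log n * nu A B) d t)
    (δ := ENNReal.ofReal (1 / t + 1 / (d * d')))
    (fun e => (∀ u j, |columnForm A (fun l => walshHadamard m u l * e l) j| ≤ α * √L) ∧
      ∀ u k, |columnForm B (fun l => walshHadamard m u l * e l) k| ≤ β * √L) ?_
  · refine hmain.trans ?_
    have hbad : P {ω | ¬ ((∀ u j, |columnForm A (fun l => walshHadamard m u l * ε ω l) j| ≤
        α * √L) ∧ ∀ u k, |columnForm B (fun l => walshHadamard m u l * ε ω l) k| ≤ β * √L)} ≤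
        ENNReal.ofReal (2 * C₁ / n) := by
      have hsub : {ω | ¬ ((∀ u j, |columnForm A (fun l => walshHadamard m u l * ε ω l) j| ≤
          α * √L) ∧ ∀ u k, |columnForm B (fun l => walshHadamard m u l * ε ω l) k| ≤ β * √L)} ⊆
          {ω | ∃ u j, α * √L < |columnForm A (fun l => walshHadamard m u l * ε ω l) j|} ∪
          {ω | ∃ u k, β * √L < |columnForm B (fun l => walshHadamard m u l * ε ω l) k|} := by
        intro ω hω
        rcases not_and_or.1 hω with h | h
        · left
          push Not at h
          exact h
        · right
          push Not at h
          exact h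
      refine (measure_mono hsub).trans ((measure_union_le _ _).trans
        ((add_le_add (hS.measure_exists_lt_abs_columnForm A hα0 hAα p)
          (hS.measure_exists_lt_abs_columnForm B hβ0 hBβ p)).trans ?_))
      rw [← ENNReal.ofReal_add (by positivity) (by positivity)]
      refine ENNReal.ofReal_le_ofReal ?_
      have hdd := hg.add_le_of_le_pow hκ (by linarith : 1 ≤ n) htn
      rw [← hC₁] at hdd
      rw [← hn]
      calc n * d * (2 * (1 / n ^ p)) + n * d' * (2 * (1 / n ^ p)) =
            2 * n * (d + d') * (1 / n ^ p) := by ring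
        _ ≤ 2 * n * (C₁ * n ^ ⌈32 * κ⌉₊) * (1 / n ^ p) := by gcongr
        _ = 2 * C₁ / n := by
            rw [hp, pow_add]
            field_simp
    refine (add_le_add le_rfl hbad).trans ?_
    rw [← ENNReal.ofReal_add (by positivity) (by positivity)]
    refine ENNReal.ofReal_le_ofReal ?_
    gcongr
    have : 0 ≤ c₀ * (2 * p : ℝ) ^ (1 / 2 : ℝ) := by positivity
    linarith
  -- For good signs every possible dyad is bounded by `L * nu A B`, so the general theorem applies
  -- at this scale, and the factor `L = 2 p log n` becomes the extra `(log n)^{1/2}` in the rate.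
  · rintro e - ⟨hA', hB'⟩
    have hbound : ∀ j k, ∀ᵐ ω ∂P, |dyad A B (srhtMatrix e (Q ω)) 0 j k| ≤ L * nu A B :=
      fun j k => by
        filter_upwards [ae_exists_idx hS.measurable_sample hS.law_sample] with ω ⟨idx, hidx⟩
        rw [dyad_srhtMatrix A B e (hidx 0), rowDyad, of_apply, abs_mul]
        calc _ ≤ (α * √L) * (β * √L) :=
              mul_le_mul (hA' _ _) (hB' _ _) (abs_nonneg _) (by positivity)
          _ = L * nu A B := by
              rw [hνeq, mul_mul_mul_comm, Real.mul_self_sqrt hL0.le, mul_comm]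
    have hSm : Measurable fun ω => srhtMatrix e (Q ω) :=
      (measurable_srhtMatrix e).comp hS.measurable_sample
    let g : (Fin (2 ^ m) → ℝ) → Fin (2 ^ m) → ℝ := fun r l =>
      (r ᵥ* ((1 / √((2 : ℝ) ^ m)) • walshHadamard m)) l * e l
    have hg' : Measurable g := by
      refine measurable_pi_lambda _ fun l => ?_
      simp only [g, vecMul, dotProduct]
      fun_prop
    have hrow : ∀ i, (fun ω => srhtMatrix e (Q ω) i) = fun ω => g (Q ω i) := fun i => by
      funext ω l
      simp only [srhtMatrix, mul_diagonal, g]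
      rfl
    have hind : iIndepFun (fun i ω => srhtMatrix e (Q ω) i) P :=
      (iIndepFun_congr fun i => .of_eq (hrow i)).2
        (hS.iIndep_sample.comp (fun _ => g) fun _ => hg')
    have hid : ∀ i, IdentDistrib (fun ω => srhtMatrix e (Q ω) i)
        (fun ω => srhtMatrix e (Q ω) 0) P P := fun i => by
      rw [hrow i, hrow 0]
      exact (identDistrib_of_map_eq (measurable_row hS.measurable_sample i)
        (measurable_row hS.measurable_sample 0)
        ((hS.law_sample i).trans (hS.law_sample 0).symm)).comp hg'
    have hmom := fun j k => integrable_abs_pow_of_ae_le ((measurable_dyad A B 0 j k).comp hSm)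
      (hbound j k) (momentOrder κ)
    refine (measure_mono ?_).trans
      (h₀ t (2 ^ m) d d' hd hg A B P _ hSm hind hid (L * nu A B) (by positivity)
        (fun j k => (hmom j k).1) fun j k => (hmom j k).2)
    intro ω hω hle
    refine hω (hle.trans ?_)
    rw [hrate, ← mul_assoc]
    have := bootRate_pos (mul_pos hlog hν) hd (Nat.pos_of_ne_zero (NeZero.ne t))
    gcongr
    linarith

end FewSamples

/-! ### SRHT with `t` at least `n^32`: ingredients. -/

section ManySamples

variable {Ω : Type*} [MeasurableSpace Ω] {P : Measure Ω} {t m d d' : ℕ}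

/-- Neither family of weights dominates the other, so both are compared with the constant weight
built from `(1 + η) / n`. The ratio of pair weights is at most `ρ ^ 2`, and over `n ^ 2` pairs `ρ ^
(n ^ 2) - 1 ≤ 8 * η * n ^ 2`. -/
lemma levyProkhorovDist_gaussianMaxLaw_gramSum_freq_le {ι : Type*} [Fintype ι] [DecidableEq ι]
    {κ : Type*} [Fintype κ] [Nonempty κ] (D : κ × κ → ι → ℝ) {n η : ℝ}
    (hn : n = Fintype.card κ) (hη0 : 0 ≤ η) (hη : η ≤ 1 / 2) (hηn : 4 * η * n ^ 2 ≤ 1) {p : κ → ℝ}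
    (hp : ∀ u, |p u - 1 / n| ≤ η / n) :
    levyProkhorovDist (gaussianMaxLaw (gramSum (fun _ => 1 / n * (1 / n) / 2) D))
      (gaussianMaxLaw (gramSum (fun x => p x.1 * p x.2 / 2) D)) ≤ 16 * η * n ^ 2 := by
  have hn0 : 0 < n := by rw [hn]; exact_mod_cast Fintype.card_pos
  set ρ := (1 + η) / (1 - η) with hρ
  have h1η : 0 < 1 - η := by linarith
  have hρ1 : 1 ≤ ρ := by rw [hρ, one_le_div h1η]; linarith
  have hρle : ρ ≤ 1 + 4 * η := by rw [hρ, div_le_iff₀ h1η]; nlinarith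
  have hρeq : ρ * (1 - η) = 1 + η := div_mul_cancel₀ _ h1η.ne'
  have hpow : ρ ^ Fintype.card (κ × κ) - 1 ≤ 8 * η * n ^ 2 := by
    have hcard : ((Fintype.card (κ × κ) : ℕ) : ℝ) = n ^ 2 := by
      rw [Fintype.card_prod, hn]; push_cast; ring
    have h1 : ρ ^ Fintype.card (κ × κ) ≤ Real.exp (4 * η * n ^ 2) := by
      calc ρ ^ Fintype.card (κ × κ) ≤ Real.exp (4 * η) ^ Fintype.card (κ × κ) := by
            gcongr
            linarith [Real.add_one_le_exp (4 * η)]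
        _ = _ := by rw [← Real.exp_nat_mul, hcard]; ring_nf
    have h0 : 0 ≤ 4 * η * n ^ 2 := by positivity
    have h2 := Real.abs_exp_sub_one_le (x := 4 * η * n ^ 2) (by rwa [abs_of_nonneg h0])
    rw [abs_of_nonneg h0] at h2
    linarith [(abs_le.1 h2).2]
  have hlo : ∀ u, (1 - η) / n ≤ p u := fun u => by
    have := (abs_le.1 (hp u)).1
    rw [sub_div]; linarith
  have hhi : ∀ u, p u ≤ (1 + η) / n := fun u => by
    have := (abs_le.1 (hp u)).2
    rw [add_div]; linarith
  have hpos : ∀ u, 0 < p u := fun u => (by positivity : 0 < (1 - η) / n).trans_le (hlo u)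
  have key : ∀ v : κ → ℝ, (∀ u, (1 - η) / n ≤ v u) → (∀ u, v u ≤ (1 + η) / n) →
      levyProkhorovDist (gaussianMaxLaw (gramSum (fun x => v x.1 * v x.2 / 2) D))
        (gaussianMaxLaw (gramSum (fun _ => (1 + η) / n * ((1 + η) / n) / 2) D)) ≤
        8 * η * n ^ 2 := fun v h1 h2 => by
    have hv : ∀ u, 0 < v u := fun u => (by positivity : 0 < (1 - η) / n).trans_le (h1 u)
    refine (levyProkhorovDist_gaussianMaxLaw_gramSum_le D hρ1 (fun x => ?_) (fun x => ?_)
      fun x => ?_).trans hpow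
    · have := hv x.1
      have := hv x.2
      positivity
    · have := mul_le_mul (h2 x.1) (h2 x.2) (hv x.2).le (by positivity)
      linarith
    · have := mul_le_mul (h1 x.1) (h1 x.2) (by positivity) (hv x.1).le
      have h3 : (1 + η) / n * ((1 + η) / n) = ρ ^ 2 * ((1 - η) / n * ((1 - η) / n)) := by
        rw [← hρeq]; ring
      rw [h3]
      nlinarith [mul_le_mul_of_nonneg_left this (sq_nonneg ρ)]
  have k1 := key (fun _ => 1 / n) (fun u => by gcongr; linarith) fun u => by gcongr; linarith
  have k2 := key p hlo hhi
  have tri := levyProkhorovDist_triangle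
    (gaussianMaxLaw (gramSum (fun _ => 1 / n * (1 / n) / 2) D))
    (gaussianMaxLaw (gramSum (fun _ => (1 + η) / n * ((1 + η) / n) / 2) D))
    (gaussianMaxLaw (gramSum (fun x => p x.1 * p x.2 / 2) D))
  rw [levyProkhorovDist_comm (gaussianMaxLaw (gramSum (fun x => p x.1 * p x.2 / 2) D))] at k2
  linarith

/-- Chebyshev's inequality for the frequencies of the sampled rows. -/
lemma measure_exists_lt_abs_sampleFreq_sub [NeZero t] [IsProbabilityMeasure P]
    {Q : Ω → Matrix (Fin t) (Fin (2 ^ m)) ℝ} (hQ : Measurable Q)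
    (hind : iIndepFun (fun i ω => Q ω i) P)
    (hlaw : ∀ i, P.map (fun ω => Q ω i) =
      ∑ u, ENNReal.ofReal (1 / (2 : ℝ) ^ m) • Measure.dirac (sampleRow t u)) {a : ℝ} (ha : 0 < a) :
    P {ω | ∃ u, a < |sampleFreq (Q ω) u - 1 / (2 : ℝ) ^ m|} ≤
      ENNReal.ofReal (2 ^ m * (1 / (t * a ^ 2))) := by
  have ht : (0 : ℝ) < t := by exact_mod_cast Nat.pos_of_ne_zero (NeZero.ne t)
  let g : Fin (2 ^ m) → (Fin (2 ^ m) → ℝ) → ℝ := fun u r => Set.indicator {sampleRow t u} 1 r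
  have hg : ∀ u, Measurable (g u) := fun u =>
    measurable_one.indicator (measurableSet_singleton _)
  have hg01 : ∀ u r, g u r = 0 ∨ g u r = 1 := fun u r => by
    by_cases h : r ∈ ({sampleRow t u} : Set (Fin (2 ^ m) → ℝ))
    · exact Or.inr (Set.indicator_of_mem h _)
    · exact Or.inl (Set.indicator_of_notMem h _)
  let X : Fin (2 ^ m) → Fin t → Ω → ℝ := fun u i ω => g u (Q ω i)
  have hX : ∀ u i, Measurable (X u i) := fun u i => (hg u).comp (measurable_row hQ i)
  have hXL : ∀ u i, MemLp (X u i) 2 P := fun u i =>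
    MemLp.of_bound (hX u i).aestronglyMeasurable 1 (.of_forall fun ω => by
      rcases hg01 u (Q ω i) with h | h <;> simp [X, h])
  have hfreq : ∀ u ω, sampleFreq (Q ω) u = (1 / (t : ℝ)) * (∑ i, X u i) ω := fun u ω => by
    rw [sampleFreq, Finset.sum_apply]
    congr 1
    refine Finset.sum_congr rfl fun i _ => ?_
    simp only [X, g, Set.indicator_apply, Set.mem_singleton_iff, Pi.one_apply]
  have hmean : ∀ u i, ∫ ω, X u i ω ∂P = 1 / (2 : ℝ) ^ m := fun u i => by
    rw [integral_comp_of_map_eq (measurable_row hQ i) (fun _ => ENNReal.ofReal_ne_top) (hlaw i)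
      (hg u)]
    simp only [g, Set.indicator_apply, Set.mem_singleton_iff, sampleRow_injective.eq_iff]
    rw [ENNReal.toReal_ofReal (by positivity)]
    simp
  have hvar : ∀ u, variance (∑ i, X u i) P ≤ t := fun u => by
    rw [IndepFun.variance_sum (fun i _ => hXL u i) fun i _ k _ hik =>
      (hind.indepFun hik).comp (hg u) (hg u)]
    have h1 : ∀ i, variance (X u i) P ≤ 1 := fun i => by
      refine (variance_le_expectation_sq (hX u i).aestronglyMeasurable).trans ?_
      refine (integral_mono (hXL u i).integrable_sq (integrable_const 1) fun ω => ?_).trans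
        (by simp)
      rcases hg01 u (Q ω i) with h | h <;> simp [X, h]
    calc ∑ i, variance (X u i) P ≤ ∑ _i : Fin t, (1 : ℝ) := Finset.sum_le_sum fun i _ => h1 i
      _ = t := by simp
  have hone : ∀ u, P {ω | a < |sampleFreq (Q ω) u - 1 / (2 : ℝ) ^ m|} ≤
      ENNReal.ofReal (1 / (t * a ^ 2)) := fun u => by
    have hmem : MemLp (∑ i, X u i) 2 P := memLp_finsetSum' _ fun i _ => hXL u i
    have hE : ∫ ω, (∑ i, X u i) ω ∂P = t * (1 / (2 : ℝ) ^ m) := by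
      simp only [Finset.sum_apply]
      rw [integral_finsetSum _ fun i _ => (hXL u i).integrable one_le_two]
      simp [hmean]
    have h := meas_ge_le_variance_div_sq hmem (c := t * a) (by positivity)
    refine (measure_mono ?_).trans (h.trans (ENNReal.ofReal_le_ofReal ?_))
    · intro ω hω
      have hω' : a < |sampleFreq (Q ω) u - 1 / (2 : ℝ) ^ m| := hω
      rw [hfreq] at hω'
      change t * a ≤ |(∑ i, X u i) ω - ∫ ω, (∑ i, X u i) ω ∂P|
      rw [hE, show (∑ i, X u i) ω - t * (1 / (2 : ℝ) ^ m) =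
        t * (1 / (t : ℝ) * (∑ i, X u i) ω - 1 / (2 : ℝ) ^ m) by field_simp, abs_mul,
        abs_of_pos ht]
      gcongr
    · calc variance (∑ i, X u i) P / (t * a) ^ 2 ≤ t / (t * a) ^ 2 := by gcongr; exact hvar u
        _ = 1 / (t * a ^ 2) := by field_simp
  have : {ω | ∃ u, a < |sampleFreq (Q ω) u - 1 / (2 : ℝ) ^ m|} =
      ⋃ u, {ω | a < |sampleFreq (Q ω) u - 1 / (2 : ℝ) ^ m|} := by ext; simp
  rw [this]
  refine (measure_iUnion_fintype_le _ _).trans ((Finset.sum_le_sum fun u _ => hone u).trans ?_)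
  rw [Finset.sum_const, Finset.card_univ, nsmul_eq_mul, ← ENNReal.ofReal_natCast,
    ← ENNReal.ofReal_mul (by positivity)]
  refine ENNReal.ofReal_le_ofReal (le_of_eq ?_)
  simp

/-- Cauchy–Schwarz with rows of `±1` entries; this crude bound holds for all signs and avoids any
union over columns. -/
lemma abs_rowDyad_le (A : Matrix (Fin (2 ^ m)) (Fin d) ℝ) (B : Matrix (Fin (2 ^ m)) (Fin d') ℝ)
    {e : Fin (2 ^ m) → ℝ} (he : ∀ l, e l = 1 ∨ e l = -1) (u : Fin (2 ^ m)) (j : Fin d)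
    (k : Fin d') : |rowDyad A B e u j k| ≤ 2 ^ m * nu A B := by
  have hform : ∀ {c : ℕ} (N : Matrix (Fin (2 ^ m)) (Fin c) ℝ) (i : Fin c),
      |columnForm N (fun l => walshHadamard m u l * e l) i| ≤
        √((2 : ℝ) ^ m) * √(entryMax (Nᵀ * N)) := fun N i => by
    rw [← Real.sqrt_sq_eq_abs, ← Real.sqrt_mul (by positivity)]
    refine Real.sqrt_le_sqrt ?_
    have h := Finset.sum_mul_sq_le_sq_mul_sq Finset.univ (fun l => N l i)
      fun l => walshHadamard m u l * e l
    have h1 : ∑ l, (walshHadamard m u l * e l) ^ 2 = (2 : ℝ) ^ m := by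
      have h2 : ∀ l, (walshHadamard m u l * e l) ^ 2 = 1 := fun l => by
        rw [← sq_abs, abs_mul, abs_walshHadamard, one_mul, sq_abs]
        rcases he l with h | h <;> rw [h] <;> norm_num
      simp [h2]
    rw [h1] at h
    refine h.trans ?_
    rw [mul_comm]
    gcongr
    exact sum_sq_le_entryMax N i
  rw [rowDyad, of_apply, abs_mul, nu_eq_mul]
  refine (mul_le_mul (hform A j) (hform B k) (abs_nonneg _) (by positivity)).trans_eq ?_
  rw [mul_mul_mul_comm, Real.mul_self_sqrt (by positivity)]

lemma gramSum_dyadDiff_diag_le (A : Matrix (Fin (2 ^ m)) (Fin d) ℝ)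
    (B : Matrix (Fin (2 ^ m)) (Fin d') ℝ) {e : Fin (2 ^ m) → ℝ} (he : ∀ l, e l = 1 ∨ e l = -1)
    {p : Fin (2 ^ m) → ℝ} (hp0 : ∀ u, 0 ≤ p u) (hp : ∑ u, p u = 1) (j : Triple d d') :
    gramSum (fun x => p x.1 * p x.2 / 2) (dyadDiff A B e) j j ≤ (2 ^ m * nu A B) ^ 2 := by
  have hs : ((j.2.2 : ℤ) : ℝ) * ((j.2.2 : ℤ) : ℝ) = 1 := by
    rcases Int.units_eq_one_or j.2.2 with h | h <;> simp [h]
  rw [gramSum_dyadDiff_apply A B e hp, hs, one_mul]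
  have h1 : ∑ u, p u * (rowDyad A B e u j.1 j.2.1 * rowDyad A B e u j.1 j.2.1) ≤
      ∑ u, p u * (2 ^ m * nu A B) ^ 2 := by
    refine Finset.sum_le_sum fun u _ => mul_le_mul_of_nonneg_left ?_ (hp0 u)
    rw [← sq, ← sq_abs]
    exact pow_le_pow_left₀ (abs_nonneg _) (abs_rowDyad_le A B he u _ _) 2
  rw [← Finset.sum_mul, hp, one_mul] at h1
  nlinarith [mul_self_nonneg (∑ u, p u * rowDyad A B e u j.1 j.2.1)]

lemma posSemidef_gramSum {ι κ : Type*} [Fintype ι] [Fintype κ] {v : κ → ℝ} (hv : ∀ i, 0 ≤ v i)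
    (D : κ → ι → ℝ) : (gramSum v D).PosSemidef := by
  refine posSemidef_sum _ fun i _ => ?_
  have := posSemidef_vecMulVec_self_star (D i)
  rw [star_trivial] at this
  exact this.smul (hv i)

end ManySamples

/-! ### SRHT: large `t` and conclusion. -/

section SRHT

lemma bootRate_sq {ν : ℝ} (hν : 0 ≤ ν) {d t : ℕ} :
    bootRate ν d t ^ 2 = ν * Real.log d / ((t : ℝ) ^ (1 / 8 : ℝ)) ^ 2 := by
  unfold bootRate
  rw [div_pow, mul_pow, Real.sq_sqrt (Real.log_natCast_nonneg _), ← Real.sqrt_eq_rpow,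
    Real.sq_sqrt hν]

/-- One factor `exp (-y)` absorbs `2 * N`, the other is at most `2 / y ^ 2`. -/
lemma two_mul_mul_exp_neg_le {N y r : ℝ} (hN : 1 ≤ N) (h1 : Real.log N + 1 ≤ y)
    (h2 : 2 / y ^ 2 ≤ r) : 2 * N * Real.exp (-(2 * y)) ≤ r := by
  have hy : 0 < y := by linarith [Real.log_nonneg hN]
  have e1 : 2 * N ≤ Real.exp y := by
    calc 2 * N ≤ Real.exp 1 * Real.exp (Real.log N) := by
          rw [Real.exp_log (by linarith)]
          have := Real.exp_one_gt_d9
          gcongr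
          linarith
      _ = Real.exp (Real.log N + 1) := by rw [← Real.exp_add, add_comm]
      _ ≤ Real.exp y := Real.exp_le_exp.2 h1
  have e2 : y ^ 2 / 2 ≤ Real.exp y := by
    linarith [Real.quadratic_le_exp_of_nonneg hy.le]
  calc 2 * N * Real.exp (-(2 * y)) ≤ Real.exp y * Real.exp (-(2 * y)) := by gcongr
    _ = (Real.exp y)⁻¹ := by rw [← Real.exp_add, ← Real.exp_neg]; ring_nf
    _ ≤ (y ^ 2 / 2)⁻¹ := inv_anti₀ (by positivity) e2
    _ = 2 / y ^ 2 := inv_div _ _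
    _ ≤ r := h2

/-- The tail condition for two small Gaussian maxima. -/
lemma two_mul_mul_exp_neg_le_of_small {N a b c ν l l' n s : ℝ} (hN : 1 ≤ N) (ha : 0 < a)
    (hNa : Real.log N + 1 ≤ a * l') (hc : 32 + 32 * a ≤ c) (hν : 0 < ν) (hl : 1 / 2 ≤ l)
    (hl' : 1 / 2 ≤ l') (hn : 2 ≤ n) (hns : n ^ 4 ≤ s) (hνs : ν * s ^ 4 ≤ 1) (hb : 0 < b)
    (hb2 : b ^ 2 = l * ν * l' / s ^ 2) :
    2 * N * Real.exp (-(c * b / 2) ^ 2 / (2 * (n * ν) ^ 2)) ≤ c * b / 2 := by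
  have hs : 0 < s := (by positivity : 0 < n ^ 4).trans_le hns
  have hn4 : n ^ 2 ≤ n ^ 4 := pow_le_pow_right₀ (by linarith) (by norm_num)
  have hc0 : 0 < c := by linarith
  have hlpos : 0 < l := by linarith
  have hlpos' : 0 < l' := by linarith
  -- The exponent is a multiple of `l * l' / u`. The hypotheses `n ^ 4 ≤ s` and `ν * s ^ 4 ≤ 1` give
  -- `u ≤ 1` and `u ^ 4 ≤ ν / s ^ 2`, hence `u ^ 2 ≤ 2 * b`. So the exponent beats `log N`, and the
  -- remaining factor `2 / y ^ 2`, of order `u ^ 2`, is below the rate.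
  set u := s ^ 2 * n ^ 2 * ν with hu
  have hu0 : 0 < u := by positivity
  have hs1 : 1 ≤ s := by
    have : 1 ≤ n ^ 4 := one_le_pow₀ (by linarith)
    linarith
  have hu1 : u ≤ 1 := by
    calc u ≤ s ^ 2 * s * ν := by rw [hu]; gcongr; linarith
      _ = ν * s ^ 3 := by ring
      _ ≤ ν * s ^ 4 := by gcongr; norm_num
      _ ≤ 1 := hνs
  have hu4 : u ^ 4 ≤ ν / s ^ 2 := by
    rw [le_div_iff₀ (by positivity)]
    calc u ^ 4 * s ^ 2 = s ^ 10 * (n ^ 4) ^ 2 * ν ^ 4 := by rw [hu]; ring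
      _ ≤ s ^ 10 * s ^ 2 * ν ^ 4 := by gcongr
      _ = ν * (ν * s ^ 4) ^ 3 := by ring
      _ ≤ ν * 1 ^ 3 := by gcongr
      _ = ν := by ring
  have hub : u ^ 2 ≤ 2 * b := by
    have hll : 1 / 4 ≤ l * l' := by nlinarith
    have : u ^ 4 ≤ 4 * b ^ 2 := by
      rw [hb2]
      refine hu4.trans ?_
      rw [← mul_div_assoc]
      gcongr
      nlinarith
    nlinarith [sq_nonneg (u ^ 2), mul_pos hb hb]
  set y := c ^ 2 * (l * l') / (16 * u) with hy
  have hexp : -(c * b / 2) ^ 2 / (2 * (n * ν) ^ 2) = -(2 * y) := by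
    have : (c * b / 2) ^ 2 = c ^ 2 / 4 * (l * ν * l' / s ^ 2) := by rw [← hb2]; ring
    rw [this, hy, hu]
    field_simp
    norm_num
  rw [hexp]
  have hy1 : a * l' ≤ y := by
    rw [hy, le_div_iff₀ (by positivity)]
    calc a * l' * (16 * u) ≤ a * l' * (16 * 1) := by gcongr
      _ = 32 * a * (1 / 2 * l') := by ring
      _ ≤ c ^ 2 * (l * l') := by
        have hc2 : 32 * a ≤ c ^ 2 := by nlinarith
        gcongr
  have hy2 : c ^ 2 / (64 * u) ≤ y := by
    rw [hy, div_le_div_iff₀ (by positivity) (by positivity)]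
    have hll : 1 / 4 ≤ l * l' := by nlinarith
    nlinarith [mul_le_mul_of_nonneg_left hll (by positivity : 0 ≤ c ^ 2 * (64 * u))]
  refine two_mul_mul_exp_neg_le hN (hNa.trans hy1) ?_
  have hc32 : 32 ≤ c := by linarith
  calc 2 / y ^ 2 ≤ 2 / (c ^ 2 / (64 * u)) ^ 2 := by gcongr
    _ = 8192 * u ^ 2 / c ^ 4 := by field_simp; norm_num
    _ ≤ c * b / 2 := by
        rw [div_le_iff₀ (by positivity)]
        have hc5 : (32 : ℝ) ^ 5 ≤ c ^ 5 := by gcongr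
        calc 8192 * u ^ 2 ≤ 8192 * (2 * b) := by gcongr
          _ ≤ 32 ^ 5 * b / 2 := by linarith
          _ ≤ c ^ 5 * b / 2 := by gcongr
          _ = c * b / 2 * c ^ 4 := by ring

/-- Both laws are compared with that of zero covariance, as perturbations of it. -/
lemma levyProkhorovDist_gaussianMaxLaw_le_of_small {ι : Type*} [Fintype ι] [DecidableEq ι]
    [Nonempty ι] {K₁ K₂ : Matrix ι ι ℝ} (h₁ : K₁.PosSemidef) (h₂ : K₂.PosSemidef) {τ r : ℝ}
    (hr : 0 < r) (hτ₁ : ∀ j, K₁ j j ≤ τ) (hτ₂ : ∀ j, K₂ j j ≤ τ)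
    (h : 2 * Fintype.card ι * Real.exp (-r ^ 2 / (2 * τ)) ≤ r) :
    levyProkhorovDist (gaussianMaxLaw K₁) (gaussianMaxLaw K₂) ≤ 2 * r := by
  have k1 := levyProkhorovDist_gaussianMaxLaw_add_le PosSemidef.zero h₁ hr hτ₁ h
  have k2 := levyProkhorovDist_gaussianMaxLaw_add_le PosSemidef.zero h₂ hr hτ₂ h
  rw [zero_add] at k1 k2
  rw [levyProkhorovDist_comm] at k2
  have := levyProkhorovDist_triangle (gaussianMaxLaw K₁) (gaussianMaxLaw (0 : Matrix ι ι ℝ))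
    (gaussianMaxLaw K₂)
  linarith

/-- Both Gaussian maxima are close when the frequencies `p` are nearly uniform. -/
lemma levyProkhorovDist_gramSum_dyadDiff_le {m d d' : ℕ} [NeZero d] [NeZero d']
    (A : Matrix (Fin (2 ^ m)) (Fin d) ℝ) (B : Matrix (Fin (2 ^ m)) (Fin d') ℝ)
    {e : Fin (2 ^ m) → ℝ} (he : ∀ l, e l = 1 ∨ e l = -1) {p : Fin (2 ^ m) → ℝ}
    (hp0 : ∀ u, 0 ≤ p u) (hp1 : ∑ u, p u = 1) {n s a b c l l' : ℝ} (hnm : n = 2 ^ m) (ha : 0 < a)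
    (hNa : Real.log (Fintype.card (Triple d d')) + 1 ≤ a * l') (hc : 32 + 32 * a ≤ c)
    (hν : 0 < nu A B) (hl : 1 / 2 ≤ l) (hl' : 1 / 2 ≤ l') (hn : 2 ≤ n) (hns : n ^ 4 ≤ s)
    (hb : 0 < b) (hb2 : b ^ 2 = l * nu A B * l' / s ^ 2)
    (hp : ∀ u, |p u - 1 / n| ≤ n / s ^ 4) :
    levyProkhorovDist (gaussianMaxLaw (gramSum (fun _ => 1 / n * (1 / n) / 2) (dyadDiff A B e)))
      (gaussianMaxLaw (gramSum (fun x => p x.1 * p x.2 / 2) (dyadDiff A B e))) ≤ c * b := by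
  have hn0 : 0 < n := by linarith
  have hs0 : 0 < s := (by positivity : 0 < n ^ 4).trans_le hns
  -- In the first case `b ≥ 1 / (2 * s ^ 3)`, while the relative comparison with `η = n ^ 2 / s ^ 4`
  -- costs at most `16 / s ^ 3`. In the second case the variances, at most `(n * nu A B) ^ 2`, are
  -- so small that both maxima are negligible at scale `b`.
  rcases le_or_gt 1 (nu A B * s ^ 4) with hνs | hνs
  · have hs16 : 16 ≤ s := by
      refine le_trans ?_ hns
      calc (16 : ℝ) = 2 ^ 4 := by norm_num
        _ ≤ n ^ 4 := by gcongr
    have hs3 : 1 / s ^ 3 ≤ 1 / 4 := by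
      have : (16 : ℝ) ^ 3 ≤ s ^ 3 := by gcongr
      gcongr
      linarith
    have hη4 : n ^ 2 / s ^ 4 * n ^ 2 ≤ 1 / s ^ 3 := by
      rw [div_mul_eq_mul_div, div_le_div_iff₀ (by positivity) (by positivity)]
      nlinarith [pow_pos hs0 3]
    have hη0 : 0 ≤ n ^ 2 / s ^ 4 := by positivity
    have hη : n ^ 2 / s ^ 4 ≤ 1 / 2 := by
      have : 1 ≤ n ^ 2 := one_le_pow₀ (by linarith)
      linarith [mul_le_mul_of_nonneg_left this hη0]
    have hη1 : 4 * (n ^ 2 / s ^ 4) * n ^ 2 ≤ 1 := by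
      rw [mul_assoc]
      linarith
    have hp' : ∀ u, |p u - 1 / n| ≤ n ^ 2 / s ^ 4 / n := fun u =>
      (hp u).trans_eq (by field_simp)
    have hcard : n = Fintype.card (Fin (2 ^ m)) := by simp [hnm]
    have hLP := levyProkhorovDist_gaussianMaxLaw_gramSum_freq_le (dyadDiff A B e) hcard hη0 hη hη1
      hp'
    refine hLP.trans ?_
    have hbs : 1 / (2 * s ^ 3) ≤ b := by
      refine (pow_le_pow_iff_left₀ (by positivity) hb.le (n := 2) (by norm_num)).1 ?_
      have hll : 1 / 4 ≤ l * l' := by nlinarith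
      rw [hb2, div_pow, div_le_div_iff₀ (by positivity) (by positivity)]
      have h1 : 1 / 4 ≤ l * l' * (nu A B * s ^ 4) := by nlinarith
      linarith [mul_le_mul_of_nonneg_right h1 (sq_nonneg s)]
    have h1 : 16 * (1 / s ^ 3) = 32 * (1 / (2 * s ^ 3)) := by field_simp; norm_num
    have h2 : 32 * b ≤ c * b := by gcongr; linarith
    rw [mul_assoc]
    linarith
  · have hone : ∑ _u : Fin (2 ^ m), 1 / n = 1 := by simp [hnm]
    have hcard : (1 : ℝ) ≤ Fintype.card (Triple d d') := by exact_mod_cast Fintype.card_pos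
    have hc0 : 0 < c := by linarith
    have htail := two_mul_mul_exp_neg_le_of_small hcard ha hNa hc hν hl hl' hn hns hνs.le hb hb2
    have hn' : ∀ u : Fin (2 ^ m), 0 ≤ 1 / n := fun _ => by positivity
    have hpsd₁ := posSemidef_gramSum (v := fun _ : Fin (2 ^ m) × Fin (2 ^ m) =>
      1 / n * (1 / n) / 2) (fun _ => by positivity) (dyadDiff A B e)
    have hpsd₂ := posSemidef_gramSum (v := fun x : Fin (2 ^ m) × Fin (2 ^ m) => p x.1 * p x.2 / 2)
      (fun x => div_nonneg (mul_nonneg (hp0 x.1) (hp0 x.2)) zero_le_two) (dyadDiff A B e)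
    have hd₁ := gramSum_dyadDiff_diag_le A B he hn' hone
    have hd₂ := gramSum_dyadDiff_diag_le A B he hp0 hp1
    rw [← hnm] at hd₁ hd₂
    have hr : 0 < c * b / 2 := by positivity
    have := levyProkhorovDist_gaussianMaxLaw_le_of_small hpsd₁ hpsd₂ hr hd₁ hd₂ htail
    linarith

/-- The SRHT case when `t` is polynomially large in `n`. -/
theorem exists_measure_levyProkhorovDist_srht_le_of_pow_le (C κ : ℝ) :
    ∃ c : ℝ, 0 < c ∧ ∀ (t m d d' : ℕ) [NeZero t], 2 ≤ d → GrowthCondition C κ d d' t →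
      1 ≤ m → ((2 : ℝ) ^ m) ^ 32 ≤ t →
      ∀ (A : Matrix (Fin (2 ^ m)) (Fin d) ℝ) (B : Matrix (Fin (2 ^ m)) (Fin d') ℝ),
        0 < nu A B → ∀ (Ω : Type*) [MeasurableSpace Ω] (P : Measure Ω) [IsProbabilityMeasure P]
        (D : Ω → Matrix (Fin (2 ^ m)) (Fin (2 ^ m)) ℝ) (ε : Ω → Fin (2 ^ m) → ℝ)
        (Q S : Ω → Matrix (Fin t) (Fin (2 ^ m)) ℝ), IsSRHT P D ε Q S →
        P {ω | ¬ levyProkhorovDist (condLawZ P A B S D ω) (gaussianMaxLaw (empCov A B (S ω))) ≤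
          c * bootRate (Real.log (2 ^ m) * nu A B) d t} ≤
          ENNReal.ofReal (1 / t + 1 / (d * d') + c / 2 ^ m) := by
  set a := 4 + 2 * Real.log (2 * max C 1) with ha
  have ha0 : 0 < a := by
    have : 0 ≤ Real.log (2 * max C 1) :=
      Real.log_nonneg (by linarith [le_max_right C 1])
    linarith
  refine ⟨32 + 32 * a, by positivity, ?_⟩
  intro t m d d' _ hd hg hm1 htn A B hν Ω _ P _ D ε Q S hS
  set c := 32 + 32 * a with hc
  set n : ℝ := 2 ^ m with hn
  have : NeZero d := ⟨by omega⟩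
  have : NeZero d' := ⟨(hg.pos_right hd).ne'⟩
  have ht : (0 : ℝ) < t := by exact_mod_cast Nat.pos_of_ne_zero (NeZero.ne t)
  have hn2 : 2 ≤ n := by
    calc (2 : ℝ) = 2 ^ 1 := (pow_one 2).symm
      _ ≤ 2 ^ m := pow_le_pow_right₀ (by norm_num) hm1
  have hn0 : 0 < n := by linarith
  have hlogn : 1 / 2 ≤ Real.log n := by
    have := Real.log_two_gt_d9
    have := Real.log_le_log (by norm_num) hn2
    linarith
  have hlogd := half_le_log hd
  set s := (t : ℝ) ^ (1 / 8 : ℝ) with hs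
  have hs0 : 0 < s := Real.rpow_pos_of_pos ht _
  have hs8 : s ^ 8 = t := by
    rw [hs, ← Real.rpow_natCast, ← Real.rpow_mul ht.le]; norm_num
  -- The exponent `32` in the case distinction is `4 * 8`, as `s` is the eighth root of `t`.
  have hns : n ^ 4 ≤ s := by
    refine (pow_le_pow_iff_left₀ (by positivity) hs0.le (n := 8) (by norm_num)).1 ?_
    rw [hs8, ← pow_mul]
    exact htn
  set b := bootRate (Real.log n * nu A B) d t with hb
  have hlν : 0 < Real.log n * nu A B := mul_pos (by linarith) hν
  have hb0 : 0 < b := bootRate_pos hlν hd (Nat.pos_of_ne_zero (NeZero.ne t))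
  have hb2 : b ^ 2 = Real.log n * nu A B * Real.log d / s ^ 2 := bootRate_sq hlν.le
  -- Every sign vector is good here; only the sampling can fail, with probability at most `1 / n`.
  have hmain := hS.measure_levyProkhorovDist_le A B (r := c * b)
    (δ := ENNReal.ofReal (1 / n)) (fun _ => True) ?_
  · refine hmain.trans ?_
    simp only [not_true_eq_false, Set.ofPred_false, measure_empty, add_zero]
    refine ENNReal.ofReal_le_ofReal ?_
    have h1 : 1 / n ≤ c / n := by gcongr; linarith
    have h2 : (0 : ℝ) ≤ 1 / t + 1 / (d * d') := by positivity
    linarith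
  · intro e he _
    -- With deviation `n / s ^ 4 = n / √t`, Chebyshev's inequality and the union over `n` indices
    -- leave exactly `1 / n`.
    have hcheb := measure_exists_lt_abs_sampleFreq_sub hS.measurable_sample hS.iIndep_sample
      hS.law_sample (a := n / s ^ 4) (by positivity)
    have hprob : n * (1 / (t * (n / s ^ 4) ^ 2)) = 1 / n := by
      rw [← hs8]
      field_simp
    rw [← hn, hprob] at hcheb
    refine (measure_mono_ae ?_).trans hcheb
    filter_upwards [ae_exists_idx hS.measurable_sample hS.law_sample] with ω ⟨idx, hidx⟩ hω
    by_contra hcon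
    refine hω ?_
    have hp : ∀ u, |sampleFreq (Q ω) u - 1 / n| ≤ n / s ^ 4 := fun u =>
      not_lt.1 fun h => hcon ⟨u, h⟩
    rw [lawZ, dyadCov_srhtMatrix hS.measurable_sample hS.law_sample,
      empCov_srhtMatrix A B e hidx, ← hn]
    have hfreq0 : ∀ u, 0 ≤ sampleFreq (Q ω) u := fun u => by
      unfold sampleFreq
      refine mul_nonneg (by positivity) (Finset.sum_nonneg fun i _ => ?_)
      split_ifs <;> norm_num
    have hle := levyProkhorovDist_gramSum_dyadDiff_le A B he hfreq0 (sum_sampleFreq hidx) hn ha0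
      (hg.log_card_triple_le hd) le_rfl hν hlogn hlogd hn2 hns hb0 hb2 hp
    exact hle

lemma IsSRHT.measurable_sketch {Ω : Type*} [MeasurableSpace Ω] {P : Measure Ω} {t m : ℕ}
    {D : Ω → Matrix (Fin (2 ^ m)) (Fin (2 ^ m)) ℝ} {ε : Ω → Fin (2 ^ m) → ℝ}
    {Q S : Ω → Matrix (Fin t) (Fin (2 ^ m)) ℝ} (h : IsSRHT P D ε Q S) : Measurable S := by
  refine measurable_pi_lambda (δ := Fin t) (X := fun _ => Fin (2 ^ m) → ℝ) _ fun i =>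
    measurable_pi_lambda _ fun l => ?_
  have e : ∀ ω, S ω i l =
      (∑ k, Q ω i k * ((1 / √((2 : ℝ) ^ m)) • walshHadamard m) k l) * ε ω l := fun ω => by
    rw [h.sketch_eq, h.diag_eq, mul_diagonal, mul_apply]
  simp only [e]
  exact (Finset.measurable_fun_sum _ fun k _ =>
    ((measurable_entry i k).comp h.measurable_sample).mul_const _).mul
      ((measurable_pi_apply l).comp h.measurable_sign)

theorem exists_measure_levyProkhorovDist_srht_le (C κ : ℝ) (hκ : 1 ≤ κ) :
    ∃ c : ℝ, 0 < c ∧ ∀ (t m d d' : ℕ) [NeZero t], 2 ≤ d → GrowthCondition C κ d d' t →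
      ∀ (A : Matrix (Fin (2 ^ m)) (Fin d) ℝ) (B : Matrix (Fin (2 ^ m)) (Fin d') ℝ)
        (Ω : Type*) [MeasurableSpace Ω] (P : Measure Ω) [IsProbabilityMeasure P]
        (D : Ω → Matrix (Fin (2 ^ m)) (Fin (2 ^ m)) ℝ) (ε : Ω → Fin (2 ^ m) → ℝ)
        (Q S : Ω → Matrix (Fin t) (Fin (2 ^ m)) ℝ) (ξ : Ω → Fin t → ℝ),
        IsSRHT P D ε Q S → IsGaussianMultiplier P S ξ →
        P {ω | ¬ levyProkhorovDist (condLawZ P A B S D ω) (condLawBoot P A B S ξ ω) ≤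
          c * bootRate (Real.log (2 ^ m) * nu A B) d t} ≤
          ENNReal.ofReal (1 / t + 1 / (d * d') + c / 2 ^ m) := by
  obtain ⟨c₁, hc₁, h₁⟩ := exists_measure_levyProkhorovDist_srht_le_of_le_pow C κ hκ
  obtain ⟨c₂, hc₂, h₂⟩ := exists_measure_levyProkhorovDist_srht_le_of_pow_le C κ
  refine ⟨1 + c₁ + c₂, by positivity, ?_⟩
  intro t m d d' _ hd hg A B Ω _ P _ D ε Q S ξ hS hξ
  have : NeZero d := ⟨by omega⟩
  have : NeZero d' := ⟨(hg.pos_right hd).ne'⟩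
  rw [measure_levyProkhorovDist_condLawBoot A B hS.measurable_sketch hξ]
  have hlog : 0 ≤ Real.log (2 ^ m) := Real.log_nonneg (one_le_pow₀ (by norm_num))
  have hrate : 0 ≤ bootRate (Real.log (2 ^ m) * nu A B) d t := by
    have := mul_nonneg hlog (nu_nonneg A B)
    unfold bootRate
    positivity
  rcases (nu_nonneg A B).eq_or_lt with hν | hν
  · refine le_of_eq_of_le ?_ zero_le
    convert measure_empty (μ := P)
    refine Set.eq_empty_of_forall_notMem fun ω hω => hω ?_
    rw [condLawZ, gaussianMaxLaw_empCov_of_dyad_eq_zero A B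
      (dyad_eq_zero_of_nu_eq_zero hν.symm) (cond P (D ⁻¹' {D ω})) S ω, levyProkhorovDist_self]
    exact mul_nonneg (by positivity) hrate
  -- For `n = 1` the rate vanishes, but the allowed failure probability `c / n` already exceeds one,
  -- thanks to the summand `1` in the constant.
  rcases Nat.eq_zero_or_pos m with rfl | hm
  · refine prob_le_one.trans ?_
    rw [← ENNReal.ofReal_one]
    refine ENNReal.ofReal_le_ofReal ?_
    have h2 : (0 : ℝ) ≤ 1 / t + 1 / (d * d') := by positivity
    rw [pow_zero, div_one]
    linarith
  have step : ∀ c : ℝ, c ≤ 1 + c₁ + c₂ →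
      P {ω | ¬ levyProkhorovDist (condLawZ P A B S D ω) (gaussianMaxLaw (empCov A B (S ω))) ≤
        c * bootRate (Real.log (2 ^ m) * nu A B) d t} ≤
        ENNReal.ofReal (1 / t + 1 / (d * d') + c / 2 ^ m) →
      P {ω | ¬ levyProkhorovDist (condLawZ P A B S D ω) (gaussianMaxLaw (empCov A B (S ω))) ≤
        (1 + c₁ + c₂) * bootRate (Real.log (2 ^ m) * nu A B) d t} ≤
        ENNReal.ofReal (1 / t + 1 / (d * d') + (1 + c₁ + c₂) / 2 ^ m) := by
    intro c hc h
    refine (measure_mono ?_).trans (h.trans (ENNReal.ofReal_le_ofReal (by gcongr)))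
    intro ω hω hle
    exact hω (hle.trans (mul_le_mul_of_nonneg_right hc hrate))
  rcases le_total (t : ℝ) (((2 : ℝ) ^ m) ^ 32) with htn | htn
  · exact step c₁ (by linarith) (h₁ t m d d' hd hg hm htn A B hν Ω P D ε Q S hS)
  · exact step c₂ (by linarith) (h₂ t m d d' hd hg hm htn A B hν Ω P D ε Q S hS)

end SRHT

end SketchBootstrap

/-! ### The three cases combined with one constant. -/

open SketchBootstrap in
theorem proposition2 (C κ : ℝ) (hC : 0 < C) (hκ : 1 ≤ κ) :
    ∃ c : ℝ, 0 < c ∧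
      -- (a) sub-Gaussian case
      (∀ (t n d d' : ℕ) [NeZero t], 2 ≤ d → GrowthCondition C κ d d' t →
        ∀ (A : Matrix (Fin n) (Fin d) ℝ) (B : Matrix (Fin n) (Fin d') ℝ),
        nu A B ^ (2 / 3 : ℝ) * Real.log d ^ 5 ≤ C * t →
        ∀ (Ω : Type*) [MeasurableSpace Ω] (P : Measure Ω) [IsProbabilityMeasure P]
          (S : Ω → Matrix (Fin t) (Fin n) ℝ) (ξ : Ω → Fin t → ℝ),
        IsSubGaussianSketch P C S → IsGaussianMultiplier P S ξ →
        P {ω | ¬ levyProkhorovDist (lawZ P A B S) (condLawBoot P A B S ξ ω) ≤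
            c * nu A B ^ (1 / 2 : ℝ) * √(Real.log d) / (t : ℝ) ^ (1 / 8 : ℝ)} ≤
          ENNReal.ofReal (1 / t + 1 / (d * d'))) ∧
      -- (b) length-sampling case
      (∀ (t n d d' : ℕ) [NeZero t], 2 ≤ d → GrowthCondition C κ d d' t →
        ∀ (A : Matrix (Fin n) (Fin d) ℝ) (B : Matrix (Fin n) (Fin d') ℝ),
        (frob A * frob B) ^ (2 / 3 : ℝ) * Real.log d ^ 5 ≤ C * t →
        ∀ (Ω : Type*) [MeasurableSpace Ω] (P : Measure Ω) [IsProbabilityMeasure P]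
          (S : Ω → Matrix (Fin t) (Fin n) ℝ) (ξ : Ω → Fin t → ℝ),
        IsLengthSampling P A B S → IsGaussianMultiplier P S ξ →
        P {ω | ¬ levyProkhorovDist (lawZ P A B S) (condLawBoot P A B S ξ ω) ≤
            c * (frob A * frob B) ^ (1 / 2 : ℝ) * √(Real.log d) / (t : ℝ) ^ (1 / 8 : ℝ)} ≤
          ENNReal.ofReal (1 / t + 1 / (d * d'))) ∧
      -- (c) SRHT case, with `n = 2 ^ m`
      (∀ (t m d d' : ℕ) [NeZero t], 2 ≤ d → GrowthCondition C κ d d' t →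
        ∀ (A : Matrix (Fin (2 ^ m)) (Fin d) ℝ) (B : Matrix (Fin (2 ^ m)) (Fin d') ℝ),
        nu A B ^ (2 / 3 : ℝ) * Real.log (2 ^ m) ^ 2 * Real.log d ^ 5 ≤ C * t →
        ∀ (Ω : Type*) [MeasurableSpace Ω] (P : Measure Ω) [IsProbabilityMeasure P]
          (D : Ω → Matrix (Fin (2 ^ m)) (Fin (2 ^ m)) ℝ) (ε : Ω → Fin (2 ^ m) → ℝ)
          (Q S : Ω → Matrix (Fin t) (Fin (2 ^ m)) ℝ) (ξ : Ω → Fin t → ℝ),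
        IsSRHT P D ε Q S → IsGaussianMultiplier P S ξ →
        P {ω | ¬ levyProkhorovDist (condLawZ P A B S D ω) (condLawBoot P A B S ξ ω) ≤
            c * nu A B ^ (1 / 2 : ℝ) * Real.log (2 ^ m) ^ (1 / 2 : ℝ) * √(Real.log d) /
              (t : ℝ) ^ (1 / 8 : ℝ)} ≤
          ENNReal.ofReal (1 / t + 1 / (d * d') + c / 2 ^ m)) := by
  obtain ⟨c₁, hc₁, h₁⟩ := exists_measure_levyProkhorovDist_subGaussian_le C κ hC hκ
  obtain ⟨c₂, hc₂, h₂⟩ := exists_measure_levyProkhorovDist_lengthSampling_le C κ hκ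
  obtain ⟨c₃, hc₃, h₃⟩ := exists_measure_levyProkhorovDist_srht_le C κ hκ
  refine ⟨c₁ + c₂ + c₃, by positivity, ?_, ?_, ?_⟩
  · intro t n d d' _ hd hg A B _ Ω _ P _ S ξ hS hξ
    refine (measure_mono ?_).trans (h₁ t n d d' hd hg A B Ω P S ξ hS hξ)
    intro ω hω hle
    refine hω (hle.trans ?_)
    have := nu_nonneg A B
    rw [bootRate, ← mul_div_assoc, ← mul_assoc]
    gcongr
    linarith
  · intro t n d d' _ hd hg A B _ Ω _ P _ S ξ hS hξ
    refine (measure_mono ?_).trans (h₂ t n d d' hd hg A B Ω P S ξ hS hξ)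
    intro ω hω hle
    refine hω (hle.trans ?_)
    have : 0 ≤ frob A * frob B := mul_nonneg (Real.sqrt_nonneg _) (Real.sqrt_nonneg _)
    rw [bootRate, ← mul_div_assoc, ← mul_assoc]
    gcongr
    linarith
  · intro t m d d' _ hd hg A B _ Ω _ P _ D ε Q S ξ hS hξ
    refine (measure_mono ?_).trans ((h₃ t m d d' hd hg A B Ω P D ε Q S ξ hS hξ).trans
      (ENNReal.ofReal_le_ofReal ?_))
    · intro ω hω hle
      refine hω (hle.trans ?_)
      have := nu_nonneg A B
      have hlog : 0 ≤ Real.log (2 ^ m) := Real.log_nonneg (one_le_pow₀ (by norm_num))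
      rw [bootRate, Real.mul_rpow hlog this, mul_comm (Real.log (2 ^ m) ^ (1 / 2 : ℝ)),
        ← mul_div_assoc, ← mul_assoc, ← mul_assoc]
      gcongr
      linarith
    · gcongr
      linarith
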